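/- **Setting.** Let $(X_s)_{s\ge 0}$ be real random variables on a probability space $(\Omega,\mathcal F,\mathbb P)$, let $t\ge 0$, $\tau>0$, and for $\varepsilon>0$ put $Y_\varepsilon:=X^{(\varepsilon t)}_{\varepsilon\tau}:=X_{\varepsilon t+\varepsilon\tau}-X_{\varepsilon t}$. Set $\Lambda_\varepsilon(u):=\varepsilon\log\mathbb E[e^{uY_\varepsilon/\varepsilon}]$ for $u\in\mathcal D_\varepsilon:=\{u\in\mathbb R:|\Lambda_\varepsilon(u)|<\infty\}$, and, for complex $z$ with $\Re z\in\mathcal D_\varepsilon$, $\Re\Lambda_\varepsilon(z):=\varepsilon\log|\mathbb E[e^{zY_\varepsilon/\varepsilon}]|\in[-\infty,\infty)$. **Assumption.** The sets $\mathcal D_\varepsilon$ have a limit $\mathcal D_0=\bigcup_{\varepsilon>0}\bigcap_{0<s\le\varepsilon}\mathcal D_s=\bigcap_{\varepsilon>0}\bigcup_{0<s\le\varepsilon}\mathcal D_s$; write $\mathcal D_0^o$ for its interior. There are functions $\Lambda_0,\Lambda_1,\Lambda_2:\mathcal D_0^o\to\mathbb R$ and $\Re\Lambda_0:\{z\in\mathbb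 C:\Re z\in\mathcal D_0^o\}\to\mathbb R$ such that: 1. for each $u\in\mathcal D_0^o$, $\Lambda_\varepsilon(u)=\Lambda_0(u)+\Lambda_1(u)\varepsilon+\Lambda_2(u)\varepsilon^2+O(\varepsilon^3)$ as $\varepsilon\downarrow0$; 2. for some $\varepsilon_0>0$, $(\varepsilon,u)\mapsto\Lambda_\varepsilon(u)$ is finite and $C^\infty$ on $(0,\varepsilon_0)\times\mathcal D_0^o$; 3. $0\in\mathcal D_0^o$; 4. $\Lambda_0$ is strictly convex and differentiable on $\mathcal D_0^o$, and $|\Lambda_0'(u_n)|\to\infty$ whenever $u_n\in\mathcal D_0^o$ converges to a boundary point of $\mathcal D_0^o$; 5. (a) $\Re\Lambda_\varepsilon(z)=\Re\Lambda_0(z)+O(\varepsilon)$ as $\varepsilon\downarrow0$, locally uniformly in $z$ with $\Re z\in\mathcal D_0^o\setminus\{0\}$ (in particular $\Re\Lambda_\varepsilon$ is finite near each such $z$ for small $\varepsilon$); and for each $p_r\in\mathcal D_0^o\setminus\{0\}$: (b) $L(p_i):=\Re\Lambda_0(p_r+\mathrm i p_i)$, $p_i\in\mathbb R$, has a unique maximum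 at $p_i=0$ and is bounded away from $L(0)$ as $|p_i|\to\infty$; (c) there are $\varepsilon_1,p_i^*>0$ and $M$ with $\Re\Lambda_\varepsilon(p_r+\mathrm i p_i)-L(p_i)\le M\varepsilon$ for all $|p_i|\ge p_i^*$ and $0<\varepsilon\le\varepsilon_1$. Assume moreover $\Lambda_0'(0)=0$. **Coefficients.** Let $\Lambda^*(k):=\sup_{u\in\mathcal D_0^o}\{uk-\Lambda_0(u)\}\in(-\infty,\infty]$, and let $k\ne0$ lie in the interior of $\{\Lambda^*<\infty\}$ (this is every $k\neq 0$ if $\Lambda^*$ is finite on $\mathbb R$). Then there is a unique $u^*=u^*(k)\in\mathcal D_0^o$ with $\Lambda_0'(u^*)=k$; moreover $u^*\ne0$, $\Lambda^*(k)>0$, $\Lambda_0$ is $C^4$ and $\Lambda_1$ is $C^2$ near $u^*$, and $\Lambda_0''(u^*)>0$. Write $\Lambda_2=\Lambda_2(u^*)$ and $\Lambda_{i,l}=\partial_u^l\Lambda_i(u^*)$, and define $$\Upsilon_0=\Lambda_2-\frac{5\Lambda_{0,3}^2}{24\Lambda_{0,2}^3}+\frac{4\Lambda_{1,1}\Lambda_{0,3}+\Lambda_{0,4}}{8\Lambda_{0,2}^2}-\frac{\Lambda_{1,1}^2+\Lambda_{1,2}}{2\Lambda_{0,2}}-\frac{\Lambda_{0,3}}{u^*\Lambda_{0,2}^2}-\frac{3-2u^*\Lambda_{1,1}}{(u^*)^2\Lambda_{0,2}},$$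 $$v_0=\frac{k^2}{2\tau\Lambda^*(k)},\qquad v_1=\frac{v_0^2\tau}{k}\left[1+\frac2k\log\left(\frac{k^2e^{\Lambda_1(u^*)}}{(u^*)^2\sqrt{\Lambda_{0,2}}\,(\tau v_0)^{3/2}}\right)\right],$$ $$v_2=\frac{2\tau^2v_0^3}{k^2}\left(\frac3{k^2}+\frac18\right)+\frac{2\tau v_0^2}{k^2}\left(\Upsilon_0+\frac1{u^*}\right)+\frac{v_1^2}{v_0}-\frac{3\tau}{k^2}v_0v_1 .$$ **Conclusion.** Suppose that $k>0$, or that $\mathbb E[e^{Y_\varepsilon}]=1$ for all small $\varepsilon$ (as holds when $e^X$ is a martingale). Then for all small $\varepsilon>0$ the forward implied volatility $\sigma_{\varepsilon t,\varepsilon\tau}(k)>0$, i.e. the solution $\sigma$ of $\mathbb E(e^{Y_\varepsilon}-e^k)^+=C_{\mathrm{BS}}(\varepsilon\tau,k,\sigma)$, exists and is unique, and $$\sigma_{\varepsilon t,\varepsilon\tau}^2(k)=v_0+v_1\varepsilon+v_2\varepsilon^2+O(\varepsilon^3)\qquad(\varepsilon\downarrow0).$$ Here $C_{\mathrm{BS}}(\theta,k,\sigma)=\mathcal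 N(d_+)-e^k\mathcal N(d_-)$ with $d_\pm=-\frac{k}{\sigma\sqrt\theta}\pm\frac12\sigma\sqrt\theta$ and $\mathcal N$ the standard normal distribution function. If $k<0$, the same existence, uniqueness and expansion hold, without the condition $\mathbb E[e^{Y_\varepsilon}]=1$, for the implied volatility of the put, defined by $\mathbb E(e^k-e^{Y_\varepsilon})^+=e^k\mathcal N(-d_-)-\mathcal N(-d_+)$. -/

import Mathlib

open MeasureTheory ProbabilityTheory Filter Asymptotics Set
open scoped Topology NNReal ContDiff

namespace FwdSmile

noncomputable section

/-! ### The re-normalised logarithmic moment generating function -/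

/-- `Λ_ε(u) = ε log E[exp(u Y_ε / ε)]`; meaningful for `u ∈ lmgfDomain P Y ε`. -/
def lmgf {Ω : Type*} [MeasurableSpace Ω] (P : Measure Ω) (Y : ℝ → Ω → ℝ) (ε u : ℝ) : ℝ :=
  ε * cgf (Y ε) P (u / ε)

/-- `𝒟_ε = {u : |Λ_ε(u)| < ∞}`, the set of `u` where `exp(u Y_ε / ε)` has a finite expectation. -/
def lmgfDomain {Ω : Type*} [MeasurableSpace Ω] (P : Measure Ω) (Y : ℝ → Ω → ℝ) (ε : ℝ) : Set ℝ :=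
  {u | u / ε ∈ integrableExpSet (Y ε) P}

/-- `liminf_{ε ↓ 0} 𝒟_ε = ⋃_{ε > 0} ⋂_{0 < s ≤ ε} 𝒟_s`. -/
def domainLiminf {Ω : Type*} [MeasurableSpace Ω] (P : Measure Ω) (Y : ℝ → Ω → ℝ) : Set ℝ :=
  ⋃ ε ∈ Ioi (0 : ℝ), ⋂ s ∈ Ioc (0 : ℝ) ε, lmgfDomain P Y s

/-- `limsup_{ε ↓ 0} 𝒟_ε = ⋂_{ε > 0} ⋃_{0 < s ≤ ε} 𝒟_s`. -/
def domainLimsup {Ω : Type*} [MeasurableSpace Ω] (P : Measure Ω) (Y : ℝ → Ω → ℝ) : Set ℝ :=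
  ⋂ ε ∈ Ioi (0 : ℝ), ⋃ s ∈ Ioc (0 : ℝ) ε, lmgfDomain P Y s

/-- The interior `𝒟₀ᵒ` of the limit `𝒟₀` of the domains (the existence of the limit, i.e. equality
of the liminf and the limsup, is part of `Admissible` below). -/
def limitInterior {Ω : Type*} [MeasurableSpace Ω] (P : Measure Ω) (Y : ℝ → Ω → ℝ) : Set ℝ :=
  interior (domainLiminf P Y)

/-- The expectation `E[exp(z Y_ε / ε)]` for complex `z`. -/
def scaledComplexMGF {Ω : Type*} [MeasurableSpace Ω] (P : Measure Ω) (Y : ℝ → Ω → ℝ)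
    (ε : ℝ) (z : ℂ) : ℂ :=
  complexMGF (Y ε) P (z / (ε : ℂ))

/-- `Re Λ_ε(z) = ε log |E[exp(z Y_ε / ε)]|` for complex `z`, where the expectation is nonzero
(where it vanishes, `Re Λ_ε(z)` is to be read as `-∞`; this is treated explicitly below). -/
def reLmgf {Ω : Type*} [MeasurableSpace Ω] (P : Measure Ω) (Y : ℝ → Ω → ℝ)
    (ε : ℝ) (z : ℂ) : ℝ :=
  ε * Real.log ‖scaledComplexMGF P Y ε z‖

/-- The standing assumption on a family `(Y_ε)_{ε > 0}`, with expansion coefficients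
`Λ₀, Λ₁, Λ₂` on `𝒟₀ᵒ`. The function `ReΛ₀` is `z ↦ Re Λ₀(z)` on the complex strip; at each point of
the strip off the imaginary axis it is determined by `tail_expansion`, being the limit of
`Re Λ_ε(z)` there. -/
structure Admissible {Ω : Type*} [MeasurableSpace Ω] (P : Measure Ω) (Y : ℝ → Ω → ℝ)
    (Λ₀ Λ₁ Λ₂ : ℝ → ℝ) (ReΛ₀ : ℂ → ℝ) : Prop where
  /-- The domains `𝒟_ε` have a limit `𝒟₀` as `ε ↓ 0`. -/
  domain_limit : domainLiminf P Y = domainLimsup P Y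
  /-- Expansion property. -/
  expansion : ∀ u ∈ limitInterior P Y,
    (fun ε : ℝ => lmgf P Y ε u - (Λ₀ u + Λ₁ u * ε + Λ₂ u * ε ^ 2)) =O[𝓝[>] 0] fun ε => ε ^ 3
  /-- Differentiability: `(ε, u) ↦ Λ_ε(u)` is finite and smooth on `(0, ε₀) × 𝒟₀ᵒ`. -/
  smooth : ∃ ε₀ > 0, (∀ ε ∈ Ioo (0 : ℝ) ε₀, limitInterior P Y ⊆ lmgfDomain P Y ε) ∧
    ContDiffOn ℝ ∞ (fun q : ℝ × ℝ => lmgf P Y q.1 q.2) (Ioo (0 : ℝ) ε₀ ×ˢ limitInterior P Y)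
  /-- Non-degenerate interior. -/
  zero_mem : (0 : ℝ) ∈ limitInterior P Y
  /-- Strict convexity of `Λ₀` on `𝒟₀ᵒ`. -/
  strictConvex : StrictConvexOn ℝ (limitInterior P Y) Λ₀
  /-- Essential smoothness of `Λ₀`: differentiability on `𝒟₀ᵒ` ... -/
  differentiable : DifferentiableOn ℝ Λ₀ (limitInterior P Y)
  /-- ... and steepness at the boundary. -/
  steep : ∀ b ∈ frontier (limitInterior P Y), ∀ u : ℕ → ℝ, (∀ n, u n ∈ limitInterior P Y) →
    Tendsto u atTop (𝓝 b) → Tendsto (fun n => |deriv Λ₀ (u n)|) atTop atTop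
  /-- Tail error control (a): `Re Λ_ε(z) = Re Λ₀(z) + O(ε)`, locally uniformly in `z = p_r + i p_i`
  with `p_r ∈ 𝒟₀ᵒ \ {0}`, `p_i ∈ ℝ` (an `O` along the product filter is exactly a locally uniform
  `O`). In particular `Re Λ_ε` is finite there for small `ε`. -/
  tail_expansion : ∀ z₀ : ℂ, z₀.re ∈ limitInterior P Y → z₀.re ≠ 0 →
    (∀ᶠ q in (𝓝[>] (0 : ℝ)) ×ˢ (𝓝 z₀), scaledComplexMGF P Y q.1 q.2 ≠ 0) ∧
    (fun q : ℝ × ℂ => reLmgf P Y q.1 q.2 - ReΛ₀ q.2) =O[(𝓝[>] (0 : ℝ)) ×ˢ (𝓝 z₀)] fun q => q.1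
  /-- Tail error control (b), first half: `L(p_i) = Re Λ₀(p_r + i p_i)` has its unique maximum at
  `p_i = 0`. -/
  tail_max : ∀ pr ∈ limitInterior P Y, pr ≠ 0 → ∀ pi : ℝ, pi ≠ 0 →
    ReΛ₀ ⟨pr, pi⟩ < ReΛ₀ ⟨pr, 0⟩
  /-- Tail error control (b), second half: `L` is bounded away from `L(0)` at infinity. -/
  tail_gap : ∀ pr ∈ limitInterior P Y, pr ≠ 0 → ∃ η > 0, ∃ K : ℝ, ∀ pi : ℝ, K ≤ |pi| →
    ReΛ₀ ⟨pr, pi⟩ ≤ ReΛ₀ ⟨pr, 0⟩ - η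
  /-- Tail error control (c): uniform upper bound for large `|p_i|`. Where the expectation vanishes
  the left side is `-∞` and nothing is required. -/
  tail_uniform : ∀ pr ∈ limitInterior P Y, pr ≠ 0 → ∃ ε₁ > 0, ∃ p₀ > 0, ∃ M : ℝ,
    ∀ pi : ℝ, p₀ ≤ |pi| → ∀ ε ∈ Ioc (0 : ℝ) ε₁, scaledComplexMGF P Y ε ⟨pr, pi⟩ ≠ 0 →
      reLmgf P Y ε ⟨pr, pi⟩ - ReΛ₀ ⟨pr, pi⟩ ≤ M * ε

/-! ### Rate function, saddlepoint and coefficients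

In what follows `D` stands for the open interval `𝒟₀ᵒ` on which the `Λᵢ` live. -/

/-- The set over which the supremum defining `Λ*(k)` is taken. -/
def legendreValues (D : Set ℝ) (Λ₀ : ℝ → ℝ) (k : ℝ) : Set ℝ :=
  (fun u => u * k - Λ₀ u) '' D

/-- The effective domain `{k : Λ*(k) < ∞}`. -/
def rateDomain (D : Set ℝ) (Λ₀ : ℝ → ℝ) : Set ℝ :=
  {k | BddAbove (legendreValues D Λ₀ k)}

/-- The Fenchel-Legendre transform `Λ*(k) = sup_u (u k - Λ₀(u))`. -/
def rate (D : Set ℝ) (Λ₀ : ℝ → ℝ) (k : ℝ) : ℝ :=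
  sSup (legendreValues D Λ₀ k)

/-- `u` is a saddlepoint for `k`: `u ∈ 𝒟₀ᵒ` and `Λ₀'(u) = k`. -/
def IsSaddle (D : Set ℝ) (Λ₀ : ℝ → ℝ) (k u : ℝ) : Prop :=
  u ∈ D ∧ deriv Λ₀ u = k

/-- The saddlepoint `u*(k)` (its existence and uniqueness are part of the theorem). -/
def saddle (D : Set ℝ) (Λ₀ : ℝ → ℝ) (k : ℝ) : ℝ :=
  Classical.epsilon (IsSaddle D Λ₀ k)

/-- The function `Υ(b, k)`, written in terms of `u = u*(k)`. Here `Λ_{i,l} = ∂ᵘˡ Λᵢ(u)`. -/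
def upsilon (Λ₀ Λ₁ Λ₂ : ℝ → ℝ) (b u : ℝ) : ℝ :=
  let L02 := iteratedDeriv 2 Λ₀ u
  let L03 := iteratedDeriv 3 Λ₀ u
  let L04 := iteratedDeriv 4 Λ₀ u
  let L11 := iteratedDeriv 1 Λ₁ u
  let L12 := iteratedDeriv 2 Λ₁ u
  Λ₂ u - 5 * L03 ^ 2 / (24 * L02 ^ 3) + (4 * L11 * L03 + L04) / (8 * L02 ^ 2)
    - (L11 ^ 2 + L12) / (2 * L02) - L03 / (2 * u * L02 ^ 2) - L03 / (2 * (u - b) * L02 ^ 2)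
    - (L11 * (b - 2 * u) + 3) / (u * (u - b) * L02)
    - b ^ 2 / (u ^ 2 * (u - b) ^ 2 * L02)

/-- `v₀(k) = k² / (2 τ Λ*(k))`. -/
def v0 (D : Set ℝ) (Λ₀ : ℝ → ℝ) (τ k : ℝ) : ℝ :=
  k ^ 2 / (2 * τ * rate D Λ₀ k)

/-- The first-order coefficient `v₁(k)`. -/
def v1 (D : Set ℝ) (Λ₀ Λ₁ : ℝ → ℝ) (τ k : ℝ) : ℝ :=
  v0 D Λ₀ τ k ^ 2 * τ / k *
    (1 + 2 / k * Real.log (k ^ 2 * Real.exp (Λ₁ (saddle D Λ₀ k)) /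
      (saddle D Λ₀ k ^ 2 * √(iteratedDeriv 2 Λ₀ (saddle D Λ₀ k)) *
        (τ * v0 D Λ₀ τ k) ^ (3 / 2 : ℝ))))

/-- The second-order coefficient `v₂(k)`. -/
def v2 (D : Set ℝ) (Λ₀ Λ₁ Λ₂ : ℝ → ℝ) (τ k : ℝ) : ℝ :=
  2 * τ ^ 2 * v0 D Λ₀ τ k ^ 3 / k ^ 2 * (3 / k ^ 2 + 1 / 8)
    + 2 * τ * v0 D Λ₀ τ k ^ 2 / k ^ 2 *
        (upsilon Λ₀ Λ₁ Λ₂ 0 (saddle D Λ₀ k) + 1 / saddle D Λ₀ k)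
    + v1 D Λ₀ Λ₁ τ k ^ 2 / v0 D Λ₀ τ k
    - 3 * τ / k ^ 2 * v0 D Λ₀ τ k * v1 D Λ₀ Λ₁ τ k

/-! ### Black-Scholes prices -/

/-- The standard Gaussian distribution function. -/
def normalCdf (x : ℝ) : ℝ := cdf (gaussianReal 0 1) x

/-- `d₊ = -k / (Σ √τ) + Σ √τ / 2`. -/
def dPlus (τ k σ : ℝ) : ℝ := -k / (σ * √τ) + σ * √τ / 2

/-- `d₋ = -k / (Σ √τ) - Σ √τ / 2`. -/
def dMinus (τ k σ : ℝ) : ℝ := -k / (σ * √τ) - σ * √τ / 2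

/-- Black-Scholes price of a call with maturity `τ`, log-strike `k` and volatility `σ > 0`. -/
def bsCall (τ k σ : ℝ) : ℝ :=
  normalCdf (dPlus τ k σ) - Real.exp k * normalCdf (dMinus τ k σ)

/-- Black-Scholes price of a put with maturity `τ`, log-strike `k` and volatility `σ > 0`. -/
def bsPut (τ k σ : ℝ) : ℝ :=
  Real.exp k * normalCdf (-dMinus τ k σ) - normalCdf (-dPlus τ k σ)

/-! ### Forward-start options -/

/-- The forward increment `X_τ^{(t)} = X_{t+τ} - X_t`. -/
def fwd {Ω : Type*} (X : ℝ≥0 → Ω → ℝ) (t τ : ℝ≥0) (x : Ω) : ℝ :=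
  X (t + τ) x - X t x

/-- The diagonal family `Y_ε = X_{ετ}^{(εt)}`, `ε > 0`. -/
def diag {Ω : Type*} (X : ℝ≥0 → Ω → ℝ) (t τ : ℝ≥0) (ε : ℝ) (x : Ω) : ℝ :=
  fwd X (ε.toNNReal * t) (ε.toNNReal * τ) x

/-- Price `E(e^Z - e^k)⁺` of a call on `e^Z` with log-strike `k`. -/
def callPrice {Ω : Type*} [MeasurableSpace Ω] (P : Measure Ω) (Z : Ω → ℝ) (k : ℝ) : ℝ :=
  ∫ x, max (Real.exp (Z x) - Real.exp k) 0 ∂P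

/-- Price `E(e^k - e^Z)⁺` of a put on `e^Z` with log-strike `k`. -/
def putPrice {Ω : Type*} [MeasurableSpace Ω] (P : Measure Ω) (Z : Ω → ℝ) (k : ℝ) : ℝ :=
  ∫ x, max (Real.exp k - Real.exp (Z x)) 0 ∂P

/-- `σ` is the implied volatility of the observed price `price` for the Black-Scholes formula
`bs : σ ↦ bs σ`. -/
def IsImpliedVol (bs : ℝ → ℝ) (price σ : ℝ) : Prop :=
  0 < σ ∧ price = bs σ

/-- For all small `ε > 0` the price `price ε` has exactly one implied volatility `σ_ε` (with respect
to `bs ε`), and `σ_ε² = w₀ + w₁ ε + w₂ ε² + O(ε³)` as `ε ↓ 0`. -/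
def SmileExpansion (bs : ℝ → ℝ → ℝ) (price : ℝ → ℝ) (w₀ w₁ w₂ : ℝ) : Prop :=
  (∀ᶠ ε in 𝓝[>] (0 : ℝ), ∃! σ, IsImpliedVol (bs ε) (price ε) σ) ∧
  ∀ σ : ℝ → ℝ, (∀ᶠ ε in 𝓝[>] (0 : ℝ), IsImpliedVol (bs ε) (price ε) (σ ε)) →
    (fun ε => σ ε ^ 2 - (w₀ + w₁ * ε + w₂ * ε ^ 2)) =O[𝓝[>] 0] fun ε => ε ^ 3

end

end FwdSmile

namespace FwdSmile

/-! ### Interpolation and quantitative uniqueness for holomorphic functions -/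

/-! The price of an out-of-the-money option is a Fourier integral along the vertical line through
the saddlepoint `u` (`callPrice_eq`, `putPrice_eq`), with the same integrand `e^{-zk/ε} E[e^{zY/ε}]
/ (z (z - ε))` for calls and puts. Near the real axis this is `exp((Λ_ε(z) - z k) / ε)` up to the
rational factor, and `Λ₀(z) - z k` is critical at `u`. Laplace's method with one correction term
(`laplace_integral`, `vertical_laplace`) evaluates this part, and away from the real axis the tail
conditions make the integrand exponentially smaller (`Admissible.tail_bound`). Hence `log price =
-Λ*(k)/ε + (3/2) log ε + q₁ + q₂ ε + O(ε²)` (`Admissible.log_price_expansion`).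

The logarithm of the Black-Scholes price has an expansion of the same shape in `ε` and the variance
`w` (`log_bsOtm_expansion`), and `v₀, v₁, v₂` are the coefficients of the polynomial in `ε` along
which the two agree up to `O(ε²)`. Since the Black-Scholes expression grows in `w` at rate at least
a constant over `ε`, moving `w` by `± K ε³` outweighs an error `O(ε²)`. The price is therefore
caught between two Black-Scholes prices, and continuity and strict monotonicity in the volatility
give existence, uniqueness and the expansion (`smileExpansion_bsOtm`).

The delicate point is regularity. The expansion of `Λ_ε` is assumed at each real `u` separately,
whereas Laplace's method uses higher derivatives of `Λ₀` and `Λ₁` and a remainder that is uniform on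
a complex disc. Nonvanishing of the moment generating function on a disc gives a holomorphic
extension of `Λ_ε`, which the Borel-Carathéodory inequality bounds uniformly in `ε`
(`Admissible.exists_local_log`). On a set of large measure the pointwise constants are uniformly
bounded, and a Remez-type inequality for Taylor polynomials spreads the estimate from that set to a
disc, losing only a power of `ε` (`bound_on_ball_of_bound_on_set`, `exists_holomorphic_limit`).
Three rounds of this, one for each coefficient, give `Λ_ε = H₀ + ε H₁ + O(ε²)` uniformly on a disc,
with `H₀` and `H₁` holomorphic (`exists_holomorphic_expansion`).

Strict convexity alone allows `Λ₀''(u) = 0`. It is excluded because `|E e^{zY/ε}|` is at most its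
value at `Re z`, so that `Re H₀(z) ≤ H₀(Re z)`; this fixes the order and the sign of the leading
nonlinear Taylor term (`iteratedDeriv_two_pos`). -/

/-- Cauchy's estimate on the circle of radius `R / 2` bounds the `j`-th Taylor term by `A q ^ j`
with `q = 2‖z - c‖ / R ≤ 1 / 2`; the geometric tail costs a factor 2. -/
lemma taylor_remainder_bound {f : ℂ → ℂ} {c : ℂ} {R A : ℝ} (hR : 0 < R)
    (hf : DifferentiableOn ℂ f (Metric.ball c R)) (hA : ∀ z ∈ Metric.ball c R, ‖f z‖ ≤ A)
    (n : ℕ) {z : ℂ} (hz : ‖z - c‖ ≤ R / 4) :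
    ‖f z - ∑ j ∈ Finset.range n, ((j.factorial : ℂ)⁻¹ * iteratedDeriv j f c) * (z - c) ^ j‖
      ≤ 2 * A * (2 * ‖z - c‖ / R) ^ n := by
  have hzb : z ∈ Metric.ball c R := by rw [mem_ball_iff_norm]; linarith
  have hA0 : 0 ≤ A := (norm_nonneg _).trans (hA c (Metric.mem_ball_self hR))
  have hs := Complex.hasSum_taylorSeries_on_ball hf hzb
  have hcoef : ∀ j : ℕ, ‖iteratedDeriv j f c‖ ≤ j.factorial * A / (R / 2) ^ j := fun j => by
    apply Complex.norm_iteratedDeriv_le_of_forall_mem_sphere_norm_le j (by linarith)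
    · apply DifferentiableOn.diffContOnCl
      apply hf.mono
      rw [closure_ball _ (by linarith)]
      exact Metric.closedBall_subset_ball (by linarith)
    · intro w hw
      exact hA w (by rw [Metric.mem_ball, Metric.mem_sphere.mp hw]; linarith)
  set q := 2 * ‖z - c‖ / R with hq
  have hq0 : 0 ≤ q := by positivity
  have hq1 : q ≤ 1 / 2 := by rw [hq, div_le_iff₀ hR]; linarith
  have hterm : ∀ j : ℕ, ‖((j.factorial : ℂ)⁻¹ • (z - c) ^ j • iteratedDeriv j f c)‖ ≤ A * q ^ j := by
    intro j
    rw [norm_smul, norm_smul, norm_pow, norm_inv, Complex.norm_natCast]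
    have hj : (0 : ℝ) < j.factorial := by positivity
    calc (j.factorial : ℝ)⁻¹ * (‖z - c‖ ^ j * ‖iteratedDeriv j f c‖)
        ≤ (j.factorial : ℝ)⁻¹ * (‖z - c‖ ^ j * (j.factorial * A / (R / 2) ^ j)) := by
          gcongr; exact hcoef j
      _ = A * q ^ j := by
          rw [hq, show 2 * ‖z - c‖ / R = ‖z - c‖ / (R / 2) by field_simp, div_pow ‖z - c‖]
          field_simp
  have hs' := (hasSum_nat_add_iff' n).mpr hs
  have hg : HasSum (fun j : ℕ => A * q ^ (j + n)) (A * q ^ n * (1 - q)⁻¹) := by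
    have := (hasSum_geometric_of_lt_one hq0 (by linarith)).mul_left (A * q ^ n)
    convert! this using 2 with j
    ring
  have := tsum_of_norm_bounded hg (fun j => hterm (j + n))
  rw [hs'.tsum_eq] at this
  calc _ = ‖f z - ∑ i ∈ Finset.range n, ((i.factorial : ℂ)⁻¹ • (z - c) ^ i • iteratedDeriv i f c)‖ := by
        congr 2; apply Finset.sum_congr rfl; intro i _; simp only [smul_eq_mul]; ring
    _ ≤ A * q ^ n * (1 - q)⁻¹ := this
    _ ≤ A * q ^ n * 2 := by
        gcongr
        rw [inv_le_comm₀ (by linarith) (by norm_num)]; linarith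
    _ = _ := by ring

/-- Greedy choice: if no further point could be added, the balls of radius `h` around the chosen
points would cover `E`, contradicting its measure. -/
lemma exists_separated {E : Set ℝ} {h : ℝ} (hh : 0 < h) (m : ℕ)
    (hE : ENNReal.ofReal (m * (2 * h)) < volume E) :
    ∃ s : Finset ℝ, (s : Set ℝ) ⊆ E ∧ s.card = m + 1 ∧ ∀ x ∈ s, ∀ y ∈ s, x ≠ y → h ≤ |x - y| := by
  induction m with
  | zero =>
    obtain ⟨x, hx⟩ : E.Nonempty := by
      rw [nonempty_iff_ne_empty]; rintro rfl; simp at hE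
    exact ⟨{x}, by simpa using hx, by simp, by simp⟩
  | succ m ih =>
    obtain ⟨s, hsE, hcard, hsep⟩ := ih (lt_of_le_of_lt (ENNReal.ofReal_le_ofReal (by
      push_cast; nlinarith)) hE)
    obtain ⟨x, hxE, hx⟩ : ∃ x ∈ E, ∀ y ∈ s, h ≤ |x - y| := by
      by_contra! hcon
      have hsub : E ⊆ ⋃ y ∈ s, Metric.ball y h := by
        intro x hx
        obtain ⟨y, hy, hxy⟩ := hcon x hx
        simp only [mem_iUnion]
        exact ⟨y, hy, by rwa [Metric.mem_ball, Real.dist_eq]⟩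
      refine absurd hE (not_lt.mpr ?_)
      calc volume E ≤ ∑ y ∈ s, volume (Metric.ball y h) :=
            (measure_mono hsub).trans (measure_biUnion_finset_le _ _)
        _ = _ := by
            simp only [Real.volume_ball, Finset.sum_const, hcard]
            rw [nsmul_eq_mul, ENNReal.ofReal_mul (p := ((m + 1 : ℕ) : ℝ)) (by positivity),
              ENNReal.ofReal_natCast]
    have hxs : x ∉ s := fun hxs => by
      have := hx x hxs; simp at this; linarith
    refine ⟨insert x s, ?_, by rw [Finset.card_insert_of_notMem hxs, hcard], ?_⟩
    · rw [Finset.coe_insert]; exact insert_subset hxE hsE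
    · intro a ha b hb hab
      rw [Finset.mem_insert] at ha hb
      rcases ha with rfl | ha <;> rcases hb with rfl | hb
      · exact absurd rfl hab
      · exact hx b hb
      · rw [abs_sub_comm]; exact hx a ha
      · exact hsep a ha b hb hab

lemma exists_separated_sequence {E : Set ℝ} {h : ℝ} (hh : 0 < h) (m : ℕ)
    (hE : ENNReal.ofReal (m * (2 * h)) < volume E) :
    ∃ x : ℕ → ℝ, (∀ i ∈ Finset.range (m + 1), x i ∈ E) ∧
      ∀ i ∈ Finset.range (m + 1), ∀ j ∈ Finset.range (m + 1), |(i : ℝ) - j| * h ≤ |x i - x j| := by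
  obtain ⟨s, hsE, hcard, hsep⟩ := exists_separated hh m hE
  set e := s.orderEmbOfFin hcard
  -- Consecutive points in increasing order differ by at least `h`, so subtracting `i * h` leaves a
  -- monotone sequence; gaps between arbitrary indices follow by telescoping.
  have hmono : Monotone (fun i : Fin (m + 1) => e i - (i : ℕ) * h) := by
    rw [Fin.monotone_iff_le_succ]
    intro i
    have h1 : e i.castSucc < e i.succ := e.strictMono Fin.castSucc_lt_succ
    have h2 := hsep _ (s.orderEmbOfFin_mem hcard i.succ) _ (s.orderEmbOfFin_mem hcard i.castSucc) h1.ne'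
    change h ≤ |e i.succ - e i.castSucc| at h2
    rw [abs_of_pos (by linarith)] at h2
    simp only [Fin.val_castSucc, Fin.val_succ]; push_cast; linarith
  have key : ∀ i j : Fin (m + 1), i ≤ j → ((j : ℕ) - (i : ℕ) : ℝ) * h ≤ e j - e i := by
    intro i j hij
    have := hmono hij
    simp only at this
    linarith
  refine ⟨fun i => if hi : i < m + 1 then e ⟨i, hi⟩ else 0, ?_, ?_⟩
  · intro i hi
    rw [Finset.mem_range] at hi
    simp only [hi, dif_pos]
    exact hsE (s.orderEmbOfFin_mem hcard _)
  · intro i hi j hj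
    rw [Finset.mem_range] at hi hj
    simp only [hi, hj, dif_pos]
    rcases le_total i j with hij | hij
    · have := key ⟨i, hi⟩ ⟨j, hj⟩ hij
      have hc : (i : ℝ) ≤ j := by exact_mod_cast hij
      rw [abs_sub_comm, abs_of_nonneg (by linarith), abs_sub_comm]
      exact this.trans (le_abs_self _)
    · have := key ⟨j, hj⟩ ⟨i, hi⟩ hij
      have hc : (j : ℝ) ≤ i := by exact_mod_cast hij
      rw [abs_of_nonneg (by linarith)]
      exact this.trans (le_abs_self _)

lemma prod_abs_sub_erase {m i : ℕ} (hi : i ∈ Finset.range (m + 1)) :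
    ∏ j ∈ (Finset.range (m + 1)).erase i, |(i : ℝ) - j| = i.factorial * (m - i).factorial := by
  have him : i ≤ m := by rw [Finset.mem_range] at hi; omega
  have h1 : (Finset.range (m + 1)).erase i =
      Finset.range i ∪ Finset.Ico (i + 1) (m + 1) := by
    ext j; simp only [Finset.mem_erase, Finset.mem_range, Finset.mem_union, Finset.mem_Ico]; omega
  rw [h1, Finset.prod_union (by
    rw [Finset.disjoint_left]; intro j; simp only [Finset.mem_range, Finset.mem_Ico]; omega)]
  congr 1
  · rw [← Finset.prod_range_add_one_eq_factorial, ← Finset.prod_range_reflect]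
    push_cast
    apply Finset.prod_congr rfl
    intro j hj
    rw [Finset.mem_range] at hj
    rw [show i - 1 - j = i - (j + 1) by omega, Nat.cast_sub (by omega)]
    push_cast
    rw [show (i : ℝ) - (i - (j + 1)) = j + 1 by ring, abs_of_pos (by positivity)]
  · rw [Finset.prod_Ico_eq_prod_range, ← Finset.prod_range_add_one_eq_factorial,
      show m + 1 - (i + 1) = m - i by omega]
    push_cast
    apply Finset.prod_congr rfl
    intro j _
    rw [show (i : ℝ) - (i + 1 + j) = -(j + 1) by ring, abs_neg, abs_of_pos (by positivity)]

lemma sum_inv_factorial_mul (m : ℕ) :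
    ∑ i ∈ Finset.range (m + 1), ((i.factorial : ℝ) * (m - i).factorial)⁻¹
      = 2 ^ m / m.factorial := by
  rw [eq_div_iff (by positivity), Finset.sum_mul]
  have h := Nat.sum_range_choose m
  have h2 : (∑ i ∈ Finset.range (m + 1), (m.choose i : ℝ)) = 2 ^ m := by exact_mod_cast h
  rw [← h2]
  apply Finset.sum_congr rfl
  intro i hi
  rw [Finset.mem_range] at hi
  rw [Nat.cast_choose ℝ (by omega : i ≤ m)]
  field_simp

/-- The total size of the Lagrange basis in the next lemma. The base 24 is `8 * 3`, from `(m + 1)^m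
/ m! ≤ e^(m + 1)` and `e ≤ 3`. -/
lemma pow_div_factorial_le (m : ℕ) :
    (4 * ((m : ℝ) + 1)) ^ m * (2 ^ m / m.factorial) ≤ 3 * 24 ^ m := by
  have h1 : ((m : ℝ) + 1) ^ m / m.factorial ≤ Real.exp (m + 1) :=
    Real.pow_div_factorial_le_exp _ (by positivity) _
  have h2 : Real.exp ((m : ℝ) + 1) ≤ 3 ^ (m + 1) := by
    have : Real.exp ((m : ℝ) + 1) = Real.exp 1 ^ (m + 1) := by
      rw [← Real.exp_nat_mul]; push_cast; ring_nf
    rw [this]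
    gcongr
    linarith [Real.exp_one_lt_d9]
  calc _ = 8 ^ m * (((m : ℝ) + 1) ^ m / m.factorial) := by
        rw [mul_pow, show (8 : ℝ) = 4 * 2 by norm_num, mul_pow]; ring
    _ ≤ 8 ^ m * 3 ^ (m + 1) := by gcongr; exact h1.trans h2
    _ = _ := by rw [show (24 : ℝ) = 8 * 3 by norm_num, mul_pow]; ring

/-- A Remez-type inequality. Interpolate at `m + 1` nodes of `E` with spacing at least `h`: each
factor in a basis numerator is at most `2 d`, the denominators are at least `h ^ m * i! * (m - i)!`,
and the reciprocals of the factorial products sum to `2 ^ m / m!`. -/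
lemma polynomial_bound_of_bound_on_set {E : Set ℝ} {c d B : ℝ} (hd : 0 < d)
    (hE : E ⊆ Icc (c - d) (c + d)) (hvol : ENNReal.ofReal d < volume E) (m : ℕ)
    (p : Polynomial ℂ) (hp : p.degree < ((m + 1 : ℕ) : WithBot ℕ))
    (hB : ∀ x ∈ E, ‖p.eval (x : ℂ)‖ ≤ B)
    {z : ℂ} (hz : ‖z - c‖ ≤ d) : ‖p.eval z‖ ≤ B * (3 * 24 ^ m) := by
  -- The largest convenient spacing: the `m` intervals of length `2 h` in `exists_separated` have
  -- total length below `d`, hence below the measure of `E`.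
  set h := d / (2 * (m + 1)) with hh
  have hh0 : 0 < h := by positivity
  obtain ⟨x, hxE, hsep⟩ := exists_separated_sequence hh0 m (lt_of_le_of_lt
    (ENNReal.ofReal_le_ofReal (by
      rw [hh, show (m : ℝ) * (2 * (d / (2 * (m + 1)))) = d * (m / (m + 1)) by field_simp]
      exact mul_le_of_le_one_right hd.le (by rw [div_le_one (by positivity)]; linarith))) hvol)
  have hB0 : 0 ≤ B := (norm_nonneg _).trans (hB (x 0) (hxE 0 (by simp)))
  have hinj : Set.InjOn (fun i => (x i : ℂ)) (Finset.range (m + 1)) := by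
    intro i hi j hj hij
    simp only [Complex.ofReal_inj] at hij
    have := hsep i hi j hj
    rw [hij, sub_self, abs_zero] at this
    have h3 : |(i : ℝ) - j| ≤ 0 := by
      by_contra hc
      push Not at hc
      nlinarith
    have := abs_nonpos_iff.mp h3
    exact_mod_cast sub_eq_zero.mp this
  rw [Lagrange.eq_interpolate (f := p) hinj (by rwa [Finset.card_range]),
    Lagrange.interpolate_apply, Polynomial.eval_finsetSum]
  have hterm : ∀ i ∈ Finset.range (m + 1),
      ‖Polynomial.eval z (Polynomial.C (Polynomial.eval (x i : ℂ) p) *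
        Lagrange.basis (Finset.range (m + 1)) (fun i => (x i : ℂ)) i)‖
      ≤ B * ((4 * ((m : ℝ) + 1)) ^ m * ((i.factorial : ℝ) * (m - i).factorial)⁻¹) := by
    intro i hi
    rw [Polynomial.eval_mul, Polynomial.eval_C, norm_mul]
    apply mul_le_mul (hB _ (hxE i hi)) _ (norm_nonneg _) hB0
    rw [Lagrange.basis, Polynomial.eval_prod, norm_prod]
    have hcard : ((Finset.range (m + 1)).erase i).card = m := by
      rw [Finset.card_erase_of_mem hi, Finset.card_range]; rfl
    calc _ ≤ ∏ j ∈ (Finset.range (m + 1)).erase i, ((4 * ((m : ℝ) + 1)) * |(i : ℝ) - j|⁻¹) := by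
          apply Finset.prod_le_prod (fun _ _ => norm_nonneg _)
          intro j hj
          have hji := Finset.ne_of_mem_erase hj
          have hj' := Finset.mem_of_mem_erase hj
          have hpos : 0 < |(i : ℝ) - j| := by
            rw [abs_pos, sub_ne_zero]; exact_mod_cast hji.symm
          simp only [Lagrange.basisDivisor, Polynomial.eval_mul, Polynomial.eval_C,
            Polynomial.eval_sub, Polynomial.eval_X]
          rw [norm_mul, norm_inv, ← Complex.ofReal_sub, Complex.norm_real, Real.norm_eq_abs]
          have h1 : ‖z - x j‖ ≤ 2 * d := by
            have h2 := hE (hxE j hj')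
            have h3 : ‖(c : ℂ) - x j‖ ≤ d := by
              rw [← Complex.ofReal_sub, Complex.norm_real, Real.norm_eq_abs, abs_le]
              constructor <;> linarith [h2.1, h2.2]
            calc ‖z - x j‖ = ‖(z - c) + (c - x j)‖ := by ring_nf
              _ ≤ _ := (norm_add_le _ _).trans (by linarith)
          calc |x i - x j|⁻¹ * ‖z - x j‖ ≤ (|(i : ℝ) - j| * h)⁻¹ * (2 * d) := by
                gcongr
                exact hsep i hi j hj'
            _ = _ := by rw [hh]; field_simp; ring
      _ = _ := by
          rw [Finset.prod_mul_distrib, Finset.prod_const, hcard, Finset.prod_inv_distrib,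
            prod_abs_sub_erase hi]
  refine (norm_sum_le_of_le _ hterm).trans ?_
  rw [← Finset.mul_sum, ← Finset.mul_sum, sum_inv_factorial_mul]
  exact mul_le_mul_of_nonneg_left (pow_div_factorial_le m) hB0

/-- If a holomorphic function is `O(1/ε)` on a disc and `O(ε)` on a set of real points which fills
more than half of a much smaller real interval, then it is `O(√ε)` on the smaller disc. -/
lemma bound_on_ball_of_bound_on_set {E : Set ℝ} {c R A B ε : ℝ} (hR : 0 < R)
    (hε : 0 < ε) (hε1 : ε ≤ 1) {f : ℂ → ℂ}
    (hf : DifferentiableOn ℂ f (Metric.ball (c : ℂ) R))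
    (hA : ∀ z ∈ Metric.ball (c : ℂ) R, ‖f z‖ ≤ A / ε)
    (hE : E ⊆ Icc (c - R / (2 * 24 ^ 4)) (c + R / (2 * 24 ^ 4)))
    (hvol : ENNReal.ofReal (R / (2 * 24 ^ 4)) < volume E)
    (hB : ∀ x ∈ E, ‖f x‖ ≤ B * ε) {z : ℂ} (hz : ‖z - c‖ ≤ R / (2 * 24 ^ 4)) :
    ‖f z‖ ≤ (3 * B + 8 * 24 ^ 3 * A) * √ε := by
  set d := R / (2 * 24 ^ 4) with hd
  have hd0 : 0 < d := by positivity
  have hdR : d ≤ R / 4 := by rw [hd]; apply div_le_div_of_nonneg_left hR.le <;> norm_num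
  have hA0 : 0 ≤ A := by
    have := (norm_nonneg _).trans (hA c (Metric.mem_ball_self hR))
    by_contra hc
    push Not at hc
    exact absurd this (not_le.mpr (div_neg_of_neg_of_pos hc hε))
  -- The degree `m` balances two losses: `24 ^ m` is `ε ^ (-1/2)` up to a factor 24. Interpolation
  -- then turns `B ε` into order `√ε`. The radius makes the Taylor remainder at most `2 (A / ε) 24 ^
  -- (-4 (m + 1))`, and after amplification by `24 ^ m` it is still of order `ε ^ (3/2) / ε = √ε`.
  obtain ⟨m, hm1, hm2⟩ := exists_nat_pow_near (x := (√ε)⁻¹) (y := (24 : ℝ))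
    (by rw [one_le_inv₀ (by positivity)]; exact Real.sqrt_le_one.mpr hε1) (by norm_num)
  have hs0 : 0 < √ε := by positivity
  have hss : √ε * √ε = ε := Real.mul_self_sqrt hε.le
  set p : Polynomial ℂ := ∑ j ∈ Finset.range (m + 1),
    Polynomial.C ((j.factorial : ℂ)⁻¹ * iteratedDeriv j f c) * (Polynomial.X - Polynomial.C (c : ℂ)) ^ j
    with hp
  have hpe : ∀ w, p.eval w =
      ∑ j ∈ Finset.range (m + 1), ((j.factorial : ℂ)⁻¹ * iteratedDeriv j f c) * (w - c) ^ j := by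
    intro w; simp [hp, Polynomial.eval_finsetSum]
  have hpd : p.degree < ((m + 1 : ℕ) : WithBot ℕ) := by
    refine lt_of_le_of_lt (Polynomial.degree_sum_le _ _) ?_
    rw [Finset.sup_lt_iff (WithBot.bot_lt_coe _)]
    intro j hj
    refine lt_of_le_of_lt (Polynomial.degree_mul_le _ _) ?_
    refine lt_of_le_of_lt (add_le_add Polynomial.degree_C_le (Polynomial.degree_pow_le _ _)) ?_
    rw [Polynomial.degree_X_sub_C]
    simp only [nsmul_eq_mul, mul_one, zero_add]
    exact_mod_cast Finset.mem_range.mp hj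
  set q : ℝ := (24 ^ 4)⁻¹ with hq
  have hrem : ∀ w : ℂ, ‖w - c‖ ≤ d → ‖f w - p.eval w‖ ≤ 2 * (A / ε) * q ^ (m + 1) := by
    intro w hw
    rw [hpe]
    refine (taylor_remainder_bound hR hf hA (m + 1) (hw.trans hdR)).trans ?_
    have : 2 * ‖w - c‖ / R ≤ q := by
      rw [div_le_iff₀ hR, hq]
      calc 2 * ‖w - c‖ ≤ 2 * d := by linarith
        _ = _ := by rw [hd]; field_simp
    gcongr
  have hEd : ∀ x ∈ E, ‖((x : ℂ)) - c‖ ≤ d := by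
    intro x hx
    rw [← Complex.ofReal_sub, Complex.norm_real, Real.norm_eq_abs, abs_le]
    have := hE hx
    constructor <;> linarith [this.1, this.2]
  have hpB : ∀ x ∈ E, ‖p.eval (x : ℂ)‖ ≤ B * ε + 2 * (A / ε) * q ^ (m + 1) := by
    intro x hx
    calc ‖p.eval (x : ℂ)‖ = ‖f x - (f x - p.eval (x : ℂ))‖ := by ring_nf
      _ ≤ _ := (norm_sub_le _ _).trans (add_le_add (hB x hx) (hrem x (hEd x hx)))
  have hmain := polynomial_bound_of_bound_on_set hd0 hE hvol m p hpd hpB hz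
  have hfz : ‖f z‖ ≤ (B * ε + 2 * (A / ε) * q ^ (m + 1)) * (3 * 24 ^ m)
      + 2 * (A / ε) * q ^ (m + 1) := by
    calc ‖f z‖ = ‖p.eval z + (f z - p.eval z)‖ := by ring_nf
      _ ≤ _ := (norm_add_le _ _).trans (add_le_add hmain (hrem z hz))
  have hB0 : 0 ≤ B := by
    obtain ⟨x, hx⟩ : E.Nonempty := by
      rw [nonempty_iff_ne_empty]; rintro rfl; simp at hvol
    have := (norm_nonneg _).trans (hB x hx)
    exact nonneg_of_mul_nonneg_left this hε
  -- comparison of the powers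
  set t : ℝ := 24 ^ m with ht
  have ht1 : 1 ≤ t := one_le_pow₀ (by norm_num)
  have htε : t * √ε ≤ 1 := by
    rwa [← le_div_iff₀ hs0, one_div]
  have htε' : 1 ≤ 24 * t * √ε := by
    rw [← div_le_iff₀ hs0, one_div]
    refine hm2.le.trans (le_of_eq ?_); rw [ht, pow_succ]; ring
  have hqm : q ^ (m + 1) ≤ (t ^ 4)⁻¹ := by
    rw [hq, inv_pow, ht]
    apply inv_anti₀ (by positivity)
    rw [← pow_mul, ← pow_mul]
    exact pow_le_pow_right₀ (by norm_num) (by omega)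
  have hq4 : (t ^ 4)⁻¹ * t ≤ 24 ^ 3 * (√ε * ε) := by
    rw [show (t ^ 4)⁻¹ * t = (t ^ 3)⁻¹ by field_simp, inv_le_iff_one_le_mul₀ (by positivity)]
    calc (1 : ℝ) ≤ (24 * t * √ε) ^ 3 := one_le_pow₀ htε'
      _ = 24 ^ 3 * (√ε * (√ε * √ε)) * t ^ 3 := by ring
      _ = _ := by rw [hss]
  calc ‖f z‖ ≤ B * ε * (3 * t) + 2 * (A / ε) * q ^ (m + 1) * (3 * t + 1) := by
        refine hfz.trans (le_of_eq ?_); ring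
    _ ≤ B * ε * (3 * t) + 2 * (A / ε) * (t ^ 4)⁻¹ * (4 * t) := by
        gcongr; linarith
    _ = 3 * B * √ε * (t * √ε) + 8 * (A / ε) * ((t ^ 4)⁻¹ * t) := by
        nth_rw 1 [← hss]; ring
    _ ≤ 3 * B * √ε * 1 + 8 * (A / ε) * (24 ^ 3 * (√ε * ε)) := by gcongr
    _ = _ := by field_simp

/-- A family of holomorphic functions which is `O(1/ε)` on a disc and converges at rate `O(ε)` at
each real point, without any uniformity, converges uniformly at rate `O(√ε)` on a smaller disc. -/
lemma exists_holomorphic_limit {f : ℝ → ℂ → ℂ} {φ : ℝ → ℂ} {c R ε₀ A : ℝ} (hR : 0 < R)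
    (hε₀ : 0 < ε₀) (hε₀1 : ε₀ ≤ 1)
    (hf : ∀ ε ∈ Ioo 0 ε₀, DifferentiableOn ℂ (f ε) (Metric.ball (c : ℂ) R))
    (hA : ∀ ε ∈ Ioo 0 ε₀, ∀ z ∈ Metric.ball (c : ℂ) R, ‖f ε z‖ ≤ A / ε)
    (hφ : ∀ x ∈ Ioo (c - R) (c + R),
      (fun ε : ℝ => f ε x - φ x) =O[𝓝[>] 0] fun ε : ℝ => ε) :
    ∃ r > 0, r ≤ R ∧ ∃ ε₁ > 0, ε₁ ≤ ε₀ ∧ ∃ B : ℝ, 0 ≤ B ∧ ∃ H : ℂ → ℂ,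
      DifferentiableOn ℂ H (Metric.ball (c : ℂ) r) ∧
      (∀ x : ℝ, (x : ℂ) ∈ Metric.ball (c : ℂ) r → H x = φ x) ∧
      ∀ ε ∈ Ioo 0 ε₁, ∀ z ∈ Metric.ball (c : ℂ) r, ‖f ε z - H z‖ ≤ B * √ε := by
  set d := R / (2 * 24 ^ 4) with hd
  have hd0 : 0 < d := by positivity
  have hdR : d < R := by rw [hd]; apply div_lt_self hR; norm_num
  have hA0 : 0 ≤ A := by
    have := (norm_nonneg _).trans (hA (ε₀ / 2) ⟨by linarith, by linarith⟩ c (Metric.mem_ball_self hR))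
    by_contra hc
    push Not at hc
    exact absurd this (not_le.mpr (div_neg_of_neg_of_pos hc (by linarith)))
  -- Points at which the pointwise estimate holds with constant `n` on the range `ε < 1 / (n + 1)`.
  -- These sets increase and exhaust the interval.
  set E : ℕ → Set ℝ := fun n => {x | x ∈ Icc (c - d) (c + d) ∧
    ∀ ε : ℝ, 0 < ε → ε * (n + 1) < 1 → ε < ε₀ → ‖f ε x - φ x‖ ≤ n * ε} with hE
  have hEmono : Monotone E := by
    intro m n hmn x hx
    have hmn' : (m : ℝ) ≤ n := by exact_mod_cast hmn
    refine ⟨hx.1, fun ε h1 h2 h3 => (hx.2 ε h1 (lt_of_le_of_lt ?_ h2) h3).trans ?_⟩ <;> gcongr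
  have hEunion : Icc (c - d) (c + d) ⊆ ⋃ n, E n := by
    intro x hx
    obtain ⟨K, hK⟩ := (hφ x ⟨by linarith [hx.1], by linarith [hx.2]⟩).bound
    obtain ⟨δ, hδ, hδ'⟩ := mem_nhdsGT_iff_exists_Ioo_subset.mp hK
    obtain ⟨n, hn⟩ := exists_nat_ge (max K (1 / δ))
    refine mem_iUnion.mpr ⟨n, hx, fun ε h1 h2 h3 => ?_⟩
    have h4 : ε < δ := by
      have : 1 / δ ≤ n := (le_max_right _ _).trans hn
      rw [div_le_iff₀ hδ] at this
      by_contra hc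
      push Not at hc
      have : (n : ℝ) * δ ≤ n * ε := by gcongr
      nlinarith
    have := hδ' ⟨h1, h4⟩
    simp only [mem_ofPred_eq] at this
    rw [Real.norm_eq_abs, abs_of_pos h1] at this
    refine this.trans ?_
    gcongr
    exact (le_max_left _ _).trans hn
  -- The interval has length `2 d`, so continuity of measure from below yields one `E N` of measure
  -- above `d`. Continuity along increasing unions holds without measurability of the `E n`.
  obtain ⟨N, hN⟩ : ∃ N, ENNReal.ofReal d < volume (E N) := by
    rw [← lt_iSup_iff, ← hEmono.measure_iUnion]
    refine lt_of_lt_of_le ?_ (measure_mono hEunion)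
    rw [Real.volume_Icc]
    exact (ENNReal.ofReal_lt_ofReal_iff (by linarith)).mpr (by linarith)
  set ε₁ := min ε₀ (1 / ((N : ℝ) + 1)) with hε₁
  have hε₁0 : 0 < ε₁ := lt_min hε₀ (by positivity)
  have hEb : ∀ x ∈ E N, ∀ ε ∈ Ioo 0 ε₁, ‖f ε x - φ x‖ ≤ N * ε := by
    intro x hx ε hε
    refine hx.2 ε hε.1 ?_ (hε.2.trans_le (min_le_left _ _))
    have := hε.2.trans_le (min_le_right _ _)
    rwa [lt_div_iff₀ (by positivity)] at this
  set C : ℝ := 3 * (2 * N) + 8 * 24 ^ 3 * (3 * A) with hC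
  have hC0 : 0 ≤ C := by positivity
  -- The unknown limit is avoided by comparing two members of the family. Parameters within a factor
  -- 2 keep the difference bounded by `3 A / ε` on the big disc, while on `E N` it is at most `2 N
  -- ε`.
  have hstep : ∀ ε ∈ Ioo 0 ε₁, ∀ ε' ∈ Ioc 0 ε, ε ≤ 2 * ε' → ∀ z : ℂ, ‖z - c‖ ≤ d →
      ‖f ε z - f ε' z‖ ≤ C * √ε := by
    intro ε hε ε' hε' h2 z hz
    have hεm : ε ∈ Ioo 0 ε₀ := ⟨hε.1, hε.2.trans_le (min_le_left _ _)⟩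
    have hεm' : ε' ∈ Ioo 0 ε₀ := ⟨hε'.1, hε'.2.trans_lt hεm.2⟩
    refine bound_on_ball_of_bound_on_set (f := fun z => f ε z - f ε' z) hR hε.1
      (hεm.2.le.trans hε₀1) ((hf ε hεm).sub (hf ε' hεm')) ?_ (fun x hx => hx.1) hN ?_ hz
    · intro w hw
      refine (norm_sub_le _ _).trans ((add_le_add (hA ε hεm w hw) (hA ε' hεm' w hw)).trans ?_)
      have : A / ε' ≤ 2 * A / ε := by
        rw [div_le_div_iff₀ hε'.1 hε.1]
        nlinarith
      calc A / ε + A / ε' ≤ A / ε + 2 * A / ε := by gcongr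
        _ = _ := by ring
    · intro x hx
      have h3 := hEb x hx ε hε
      have h4 := hEb x hx ε' ⟨hε'.1, hε'.2.trans_lt hε.2⟩
      calc ‖f ε x - f ε' x‖ = ‖(f ε x - φ x) - (f ε' x - φ x)‖ := by ring_nf
        _ ≤ N * ε + N * ε' := (norm_sub_le _ _).trans (add_le_add h3 h4)
        _ ≤ N * ε + N * ε := by gcongr; exact hε'.2
        _ = _ := by ring
  -- Repeated halving of `ε`. The constant `4 C` reproduces itself because `√(ε / 2) ≤ (3 / 4) √ε`
  -- and `1 + 4 * (3 / 4) = 4`.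
  have hall : ∀ k : ℕ, ∀ ε ∈ Ioo 0 ε₁, ∀ ε' ∈ Ioc 0 ε, ε ≤ 2 ^ k * ε' → ∀ z : ℂ, ‖z - c‖ ≤ d →
      ‖f ε z - f ε' z‖ ≤ 4 * C * √ε := by
    intro k
    induction k with
    | zero =>
      intro ε hε ε' hε' h z _
      have : ε = ε' := le_antisymm (by simpa using h) hε'.2
      rw [this, sub_self, norm_zero]; positivity
    | succ k ih =>
      intro ε hε ε' hε' h z hz
      by_cases h2 : ε ≤ 2 * ε'
      · refine (hstep ε hε ε' hε' h2 z hz).trans ?_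
        gcongr
        linarith
      · push Not at h2
        have h5 : ε / 2 ∈ Ioo 0 ε₁ := ⟨by linarith [hε.1], by linarith [hε.1, hε.2]⟩
        have h3 := hstep ε hε (ε / 2) ⟨h5.1, by linarith [hε.1]⟩ (by linarith) z hz
        have h4 := ih (ε / 2) h5 ε' ⟨hε'.1, by linarith⟩ (by rw [pow_succ] at h; linarith) z hz
        have h6 : √(ε / 2) ≤ 3 / 4 * √ε := by
          rw [Real.sqrt_le_left (by positivity), mul_pow, Real.sq_sqrt hε.1.le]
          linarith [hε.1]
        calc ‖f ε z - f ε' z‖ = ‖(f ε z - f (ε / 2) z) + (f (ε / 2) z - f ε' z)‖ := by ring_nf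
          _ ≤ C * √ε + 4 * C * √(ε / 2) := (norm_add_le _ _).trans (add_le_add h3 h4)
          _ ≤ C * √ε + 4 * C * (3 / 4 * √ε) := by gcongr
          _ = _ := by ring
  have hcau : ∀ ε ∈ Ioo 0 ε₁, ∀ ε' ∈ Ioc 0 ε, ∀ z : ℂ, ‖z - c‖ ≤ d →
      ‖f ε z - f ε' z‖ ≤ 4 * C * √ε := by
    intro ε hε ε' hε' z hz
    obtain ⟨k, hk⟩ := pow_unbounded_of_one_lt (ε / ε') (by norm_num : (1 : ℝ) < 2)
    exact hall k ε hε ε' hε' (by rw [div_lt_iff₀ hε'.1] at hk; exact hk.le) z hz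
  set s : ℕ → ℝ := fun n => ε₁ / ((n : ℝ) + 2) with hs
  have hsm : ∀ n, s n ∈ Ioo 0 ε₁ := fun n =>
    ⟨by positivity, div_lt_self hε₁0 (by linarith [(Nat.cast_nonneg n : (0 : ℝ) ≤ n)])⟩
  have hsanti : ∀ m n, m ≤ n → s n ≤ s m := by
    intro m n hmn
    have hmn' : (m : ℝ) ≤ n := by exact_mod_cast hmn
    simp only [hs]; gcongr
  have hs0 : Tendsto s atTop (𝓝 0) :=
    Tendsto.div_atTop tendsto_const_nhds
      (tendsto_atTop_add_const_right _ _ tendsto_natCast_atTop_atTop)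
  have hb0 : Tendsto (fun n => 4 * C * √(s n)) atTop (𝓝 0) := by
    have := ((Real.continuous_sqrt.tendsto 0).comp hs0).const_mul (4 * C)
    simpa using this
  have hcauchy : ∀ z : ℂ, ‖z - c‖ ≤ d → ∃ w, Tendsto (fun n => f (s n) z) atTop (𝓝 w) := by
    intro z hz
    apply cauchySeq_tendsto_of_complete
    refine cauchySeq_of_le_tendsto_0 (fun n => 4 * C * √(s n) + 4 * C * √(s n)) ?_
      (by simpa using hb0.add hb0)
    intro n m N' hn hm
    rw [dist_eq_norm]
    calc ‖f (s n) z - f (s m) z‖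
        = ‖(f (s N') z - f (s m) z) - (f (s N') z - f (s n) z)‖ := by ring_nf
      _ ≤ _ := (norm_sub_le _ _).trans (add_le_add
          (hcau _ (hsm N') _ ⟨(hsm m).1, hsanti _ _ hm⟩ z hz)
          (hcau _ (hsm N') _ ⟨(hsm n).1, hsanti _ _ hn⟩ z hz))
  choose! H hH using hcauchy
  have hlim : ∀ ε ∈ Ioo 0 ε₁, ∀ z : ℂ, ‖z - c‖ ≤ d → ‖f ε z - H z‖ ≤ 4 * C * √ε := by
    intro ε hε z hz
    refine le_of_tendsto (tendsto_const_nhds.sub (hH z hz)).norm ?_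
    filter_upwards [hs0.eventually (Iio_mem_nhds hε.1)] with n hn
    exact hcau ε hε (s n) ⟨(hsm n).1, le_of_lt hn⟩ z hz
  have hmem : ∀ z ∈ Metric.ball (c : ℂ) d, ‖z - c‖ ≤ d := fun z hz => (mem_ball_iff_norm.mp hz).le
  refine ⟨d, hd0, hdR.le, ε₁, hε₁0, min_le_left _ _, 4 * C, by positivity, H, ?_, ?_,
    fun ε hε z hz => hlim ε hε z (hmem z hz)⟩
  · have hu : TendstoUniformlyOn (fun n => f (s n)) H atTop (Metric.ball (c : ℂ) d) := by
      rw [Metric.tendstoUniformlyOn_iff]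
      intro η hη
      filter_upwards [hb0.eventually (Iio_mem_nhds hη)] with n hn z hz
      rw [dist_comm, dist_eq_norm]
      exact (hlim _ (hsm n) z (hmem z hz)).trans_lt hn
    refine hu.tendstoLocallyUniformlyOn.differentiableOn (Eventually.of_forall fun n => ?_)
      Metric.isOpen_ball
    exact (hf _ ⟨(hsm n).1, (hsm n).2.trans_le (min_le_left _ _)⟩).mono
      (Metric.ball_subset_ball hdR.le)
  · intro x hx
    have hx' := hmem _ hx
    refine tendsto_nhds_unique (hH x hx') ?_
    have hxR : x ∈ Ioo (c - R) (c + R) := by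
      rw [← Complex.ofReal_sub, Complex.norm_real, Real.norm_eq_abs, abs_le] at hx'
      constructor <;> linarith
    have h1 : Tendsto (fun ε : ℝ => f ε x - φ x) (𝓝[>] 0) (𝓝 0) :=
      (hφ x hxR).trans_tendsto (tendsto_id.mono_left nhdsWithin_le_nhds)
    have h2 : Tendsto s atTop (𝓝[>] 0) :=
      tendsto_nhdsWithin_iff.mpr ⟨hs0, Eventually.of_forall fun n => (hsm n).1⟩
    simpa using (h1.comp h2).add_const (φ x)

/-- Bounded holomorphic functions with an expansion to second order at each real point, without any
uniformity, have this expansion uniformly on a complex disc. -/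
lemma exists_holomorphic_expansion {L : ℝ → ℂ → ℂ} {φ₀ φ₁ φ₂ : ℝ → ℝ} {c R ε₀ A : ℝ} (hR : 0 < R)
    (hε₀ : 0 < ε₀) (hε₀1 : ε₀ ≤ 1)
    (hL : ∀ ε ∈ Ioo 0 ε₀, DifferentiableOn ℂ (L ε) (Metric.ball (c : ℂ) R))
    (hA : ∀ ε ∈ Ioo 0 ε₀, ∀ z ∈ Metric.ball (c : ℂ) R, ‖L ε z‖ ≤ A)
    (hφ : ∀ x ∈ Ioo (c - R) (c + R),
      (fun ε : ℝ => L ε x - ((φ₀ x + φ₁ x * ε + φ₂ x * ε ^ 2 : ℝ) : ℂ)) =O[𝓝[>] 0]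
        fun ε : ℝ => ε ^ 3) :
    ∃ r > 0, r ≤ R ∧ ∃ ε₁ > 0, ε₁ ≤ ε₀ ∧ ∃ B : ℝ, 0 ≤ B ∧ ∃ H₀ H₁ : ℂ → ℂ,
      DifferentiableOn ℂ H₀ (Metric.ball (c : ℂ) r) ∧
      DifferentiableOn ℂ H₁ (Metric.ball (c : ℂ) r) ∧
      (∀ x : ℝ, (x : ℂ) ∈ Metric.ball (c : ℂ) r → H₀ x = φ₀ x) ∧
      (∀ x : ℝ, (x : ℂ) ∈ Metric.ball (c : ℂ) r → H₁ x = φ₁ x) ∧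
      ∀ ε ∈ Ioo 0 ε₁, ∀ z ∈ Metric.ball (c : ℂ) r, ‖L ε z - H₀ z - ε * H₁ z‖ ≤ B * ε ^ 2 := by

  have hpow : ∀ m n : ℕ, m ≤ n →
      (fun ε : ℝ => ε ^ n) =O[𝓝[>] 0] fun ε : ℝ => ε ^ m := fun m n hmn => by
    refine IsBigO.of_bound 1 ?_
    filter_upwards [Ioo_mem_nhdsGT one_pos] with ε hε
    rw [one_mul, norm_pow, norm_pow, Real.norm_eq_abs, abs_of_pos hε.1]
    exact pow_le_pow_of_le_one hε.1.le hε.2.le hmn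
  have hmono : ∀ {r : ℝ}, r ≤ R → ∀ x : ℝ, x ∈ Ioo (c - r) (c + r) → x ∈ Ioo (c - R) (c + R) :=
    fun h x hx => ⟨by linarith [hx.1], by linarith [hx.2]⟩
  have hball : ∀ {r : ℝ} (x : ℝ), x ∈ Ioo (c - r) (c + r) → (x : ℂ) ∈ Metric.ball (c : ℂ) r := by
    intro r x hx
    rw [mem_ball_iff_norm, ← Complex.ofReal_sub, Complex.norm_real, Real.norm_eq_abs, abs_lt]
    constructor <;> linarith [hx.1, hx.2]
  have hsq1 : ∀ ε : ℝ, ε < ε₀ → √ε ≤ 1 := fun ε h => Real.sqrt_le_one.mpr (h.le.trans hε₀1)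
  have hdiv : ∀ (g : ℝ → ℂ) (n : ℕ), g =O[𝓝[>] 0] (fun ε : ℝ => ε ^ (n + 1)) →
      (fun ε : ℝ => g ε / ε) =O[𝓝[>] 0] (fun ε : ℝ => ε ^ n) := by
    intro g n hg
    have h1 : (fun ε : ℝ => ((ε : ℂ))⁻¹) =O[𝓝[>] 0] (fun ε : ℝ => ε⁻¹) := by
      refine IsBigO.of_bound 1 (Eventually.of_forall fun ε => ?_)
      simp
    refine ((hg.mul h1).congr_left fun ε => ?_).trans ?_
    · rw [div_eq_mul_inv]
    · refine IsBigO.of_bound 1 ?_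
      filter_upwards [self_mem_nhdsWithin] with ε hε
      rw [pow_succ, mul_assoc, mul_inv_cancel₀ (ne_of_gt hε)]; simp
  have hA0 : 0 ≤ A := (norm_nonneg _).trans
    (hA (ε₀ / 2) ⟨by linarith, by linarith⟩ c (Metric.mem_ball_self hR))
  -- zeroth order
  obtain ⟨r₀, hr₀, hr₀R, δ₀, hδ₀, hδ₀le, B₀, hB₀, H₀, hH₀d, hH₀, hH₀b⟩ :=
    exists_holomorphic_limit (f := L) (φ := fun x => φ₀ x) (A := A) hR hε₀ hε₀1 hL
    (fun ε hε z hz => (hA ε hε z hz).trans (by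
      rw [le_div_iff₀ hε.1]; nlinarith [hε.1, hε.2])) (by
    intro x hx
    have h1 := (hφ x hx).trans (hpow 1 3 (by norm_num))
    have h2 : (fun ε : ℝ => ((φ₁ x * ε + φ₂ x * ε ^ 2 : ℝ) : ℂ)) =O[𝓝[>] 0] fun ε : ℝ => ε ^ 1 := by
      rw [Complex.isBigO_ofReal_left]
      exact ((hpow 1 1 le_rfl).const_mul_left (φ₁ x) |>.congr_left (by simp)).add
        ((hpow 1 2 (by norm_num)).const_mul_left _)
    refine ((h1.add h2).congr_left fun ε => ?_).trans (by simpa using isBigO_refl _ _)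
    push_cast; ring)
  -- first order
  obtain ⟨r₁, hr₁, hr₁R, δ₁, hδ₁, hδ₁le, B₁, hB₁, H₁, hH₁d, hH₁, hH₁b⟩ :=
    exists_holomorphic_limit (f := fun ε z => (L ε z - H₀ z) / ε) (φ := fun x => φ₁ x) (A := B₀)
    hr₀ hδ₀ (hδ₀le.trans hε₀1)
    (fun ε hε => (((hL ε ⟨hε.1, hε.2.trans_le hδ₀le⟩).mono (Metric.ball_subset_ball hr₀R)).sub
      hH₀d).div_const _)
    (fun ε hε z hz => by
      rw [norm_div, Complex.norm_real, Real.norm_eq_abs, abs_of_pos hε.1]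
      apply div_le_div_of_nonneg_right _ hε.1.le
      refine (hH₀b ε hε z hz).trans (mul_le_of_le_one_right hB₀ (hsq1 ε (hε.2.trans_le hδ₀le))))
    (by
    intro x hx
    have h1 := (hφ x (hmono hr₀R x hx)).trans (hpow 2 3 (by norm_num))
    have h2 : (fun ε : ℝ => ((φ₂ x * ε ^ 2 : ℝ) : ℂ)) =O[𝓝[>] 0] fun ε : ℝ => ε ^ 2 := by
      rw [Complex.isBigO_ofReal_left]
      exact (hpow 2 2 le_rfl).const_mul_left _
    refine (((hdiv _ 1 (h1.add h2))).congr' ?_ (by simp))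
    filter_upwards [self_mem_nhdsWithin] with ε hε
    have : (ε : ℂ) ≠ 0 := by exact_mod_cast (ne_of_gt hε)
    rw [hH₀ x (hball x hx)]
    push_cast; field_simp; ring)
  have hδ₁' : δ₁ ≤ ε₀ := hδ₁le.trans hδ₀le
  -- second order
  obtain ⟨r₂, hr₂, hr₂R, δ₂, hδ₂, hδ₂le, B₂, hB₂, H₂, hH₂d, hH₂, hH₂b⟩ :=
    exists_holomorphic_limit (f := fun ε z => ((L ε z - H₀ z) / ε - H₁ z) / ε)
    (φ := fun x => φ₂ x) (A := B₁) hr₁ hδ₁ (hδ₁'.trans hε₀1)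
    (fun ε hε => ((((hL ε ⟨hε.1, hε.2.trans_le hδ₁'⟩).mono
      (Metric.ball_subset_ball (hr₁R.trans hr₀R))).sub
      (hH₀d.mono (Metric.ball_subset_ball hr₁R))).div_const _).sub hH₁d |>.div_const _)
    (fun ε hε z hz => by
      rw [norm_div, Complex.norm_real, Real.norm_eq_abs, abs_of_pos hε.1]
      apply div_le_div_of_nonneg_right _ hε.1.le
      refine (hH₁b ε hε z hz).trans (mul_le_of_le_one_right hB₁ (hsq1 ε (hε.2.trans_le hδ₁'))))
    (by
    intro x hx
    have h1 := (hφ x (hmono (hr₁R.trans hr₀R) x hx))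
    refine ((hdiv _ 1 (hdiv _ 2 h1))).congr' ?_ (by simp)
    filter_upwards [self_mem_nhdsWithin] with ε hε
    have : (ε : ℂ) ≠ 0 := by exact_mod_cast (ne_of_gt hε)
    have hx' := hball x hx
    rw [hH₁ x hx', hH₀ x (Metric.ball_subset_ball hr₁R hx')]
    push_cast; field_simp; ring)
  have hδ₂' : δ₂ ≤ ε₀ := hδ₂le.trans hδ₁'
  -- boundedness of the remainder
  have hhalf : δ₂ / 2 ∈ Ioo 0 δ₂ := ⟨by linarith, by linarith⟩
  set K : ℝ := B₂ + B₁ / (δ₂ / 2) with hK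
  -- Comparison with the quotient at the single parameter `δ₂ / 2` bounds the limit `H₂` itself,
  -- which turns convergence of the second quotient into a remainder `O(ε²)`.
  have hH₂bd : ∀ z ∈ Metric.ball (c : ℂ) r₂, ‖H₂ z‖ ≤ K := by
    intro z hz
    have h1 := hH₂b _ hhalf z hz
    have h2 : ‖((L (δ₂ / 2) z - H₀ z) / ((δ₂ / 2 : ℝ) : ℂ) - H₁ z) / ((δ₂ / 2 : ℝ) : ℂ)‖
        ≤ B₁ / (δ₂ / 2) := by
      rw [norm_div, Complex.norm_real, Real.norm_eq_abs, abs_of_pos hhalf.1]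
      apply div_le_div_of_nonneg_right _ hhalf.1.le
      exact (hH₁b _ ⟨hhalf.1, hhalf.2.trans_le hδ₂le⟩ z (Metric.ball_subset_ball hr₂R hz)).trans
        (mul_le_of_le_one_right hB₁ (hsq1 _ (hhalf.2.trans_le hδ₂')))
    have h3 : B₂ * √(δ₂ / 2) ≤ B₂ := mul_le_of_le_one_right hB₂ (hsq1 _ (hhalf.2.trans_le hδ₂'))
    calc ‖H₂ z‖ = ‖((L (δ₂ / 2) z - H₀ z) / ((δ₂ / 2 : ℝ) : ℂ) - H₁ z) / ((δ₂ / 2 : ℝ) : ℂ) -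
          (((L (δ₂ / 2) z - H₀ z) / ((δ₂ / 2 : ℝ) : ℂ) - H₁ z) / ((δ₂ / 2 : ℝ) : ℂ) - H₂ z)‖ := by
          ring_nf
      _ ≤ B₁ / (δ₂ / 2) + B₂ := (norm_sub_le _ _).trans (add_le_add h2 (h1.trans h3))
      _ = K := by rw [hK]; ring
  have hK0 : 0 ≤ K := by positivity
  refine ⟨r₂, hr₂, hr₂R.trans (hr₁R.trans hr₀R), δ₂, hδ₂, hδ₂', B₂ + K, by positivity, H₀, H₁,
    hH₀d.mono (Metric.ball_subset_ball (hr₂R.trans hr₁R)),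
    hH₁d.mono (Metric.ball_subset_ball hr₂R),
    fun x hx => hH₀ x (Metric.ball_subset_ball (hr₂R.trans hr₁R) hx),
    fun x hx => hH₁ x (Metric.ball_subset_ball hr₂R hx), fun ε hε z hz => ?_⟩
  have h1 := hH₂b ε hε z hz
  have h3 : B₂ * √ε ≤ B₂ := mul_le_of_le_one_right hB₂ (hsq1 _ (hε.2.trans_le hδ₂'))
  have hne : (ε : ℂ) ≠ 0 := by exact_mod_cast hε.1.ne'
  calc ‖L ε z - H₀ z - ε * H₁ z‖
      = ‖(ε : ℂ) ^ 2 * ((((L ε z - H₀ z) / ε - H₁ z) / ε - H₂ z) + H₂ z)‖ := by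
        congr 1; field_simp; ring
    _ = ε ^ 2 * ‖(((L ε z - H₀ z) / ε - H₁ z) / ε - H₂ z) + H₂ z‖ := by
        rw [norm_mul, norm_pow, Complex.norm_real, Real.norm_eq_abs, abs_of_pos hε.1]
    _ ≤ ε ^ 2 * (B₂ + K) := by
        gcongr
        exact (norm_add_le _ _).trans (add_le_add (h1.trans h3) (hH₂bd z hz))
    _ = _ := by ring

/-! ### Holomorphic functions which are real on the real axis -/

lemma differentiableOn_iteratedDeriv {f : ℂ → ℂ} {s : Set ℂ} (hs : IsOpen s)
    (hf : DifferentiableOn ℂ f s) (n : ℕ) : DifferentiableOn ℂ (iteratedDeriv n f) s := by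
  induction n with
  | zero => simpa using hf
  | succ n ih => rw [iteratedDeriv_succ]; exact ih.deriv hs

/-- Along the real axis the complex derivative is the real derivative of a real-valued function,
hence is again real; induct on the order. -/
lemma iteratedDeriv_eq_of_real {f : ℂ → ℂ} {g : ℝ → ℝ} {s : Set ℂ} (hs : IsOpen s)
    (hf : DifferentiableOn ℂ f s) (hfg : ∀ x : ℝ, (x : ℂ) ∈ s → f x = g x) (n : ℕ) :
    ∀ x : ℝ, (x : ℂ) ∈ s → iteratedDeriv n f x = (iteratedDeriv n g x : ℝ) := by
  induction n with
  | zero => simpa using hfg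
  | succ n ih =>
    intro x hx
    have hd : HasDerivAt (iteratedDeriv n f) (iteratedDeriv (n + 1) f x) (x : ℂ) := by
      rw [iteratedDeriv_succ]
      exact ((differentiableOn_iteratedDeriv hs hf n).differentiableAt (hs.mem_nhds hx)).hasDerivAt
    have hev : ∀ᶠ y : ℝ in 𝓝 x, (y : ℂ) ∈ s :=
      Complex.continuous_ofReal.continuousAt.eventually (hs.mem_nhds hx)
    have h1 : HasDerivAt (fun y : ℝ => iteratedDeriv n f y) (iteratedDeriv (n + 1) f x) x :=
      hd.comp_ofReal
    have h2 : HasDerivAt (iteratedDeriv n g) (iteratedDeriv (n + 1) f x).re x := by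
      refine hd.real_of_complex.congr_of_eventuallyEq ?_
      filter_upwards [hev] with y hy
      rw [ih y hy, Complex.ofReal_re]
    have h3 : HasDerivAt (fun y : ℝ => iteratedDeriv n f y)
        (((iteratedDeriv (n + 1) f x).re : ℝ) : ℂ) x := by
      refine h2.ofReal_comp.congr_of_eventuallyEq ?_
      filter_upwards [hev] with y hy
      rw [ih y hy]
    rw [iteratedDeriv_succ (f := g), h2.deriv]
    exact h1.unique h3

lemma contDiffAt_of_real {f : ℂ → ℂ} {g : ℝ → ℝ} {s : Set ℂ} (hs : IsOpen s)
    (hf : DifferentiableOn ℂ f s) (hfg : ∀ x : ℝ, (x : ℂ) ∈ s → f x = g x) (n : ℕ)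
    {x : ℝ} (hx : (x : ℂ) ∈ s) : ContDiffAt ℝ n g x := by
  have h1 : ContDiffAt ℂ n f (x : ℂ) := (hf.contDiffOn hs).contDiffAt (hs.mem_nhds hx)
  have h2 : ContDiffAt ℝ n (fun y : ℝ => (f y).re) x := h1.real_of_complex
  refine h2.congr_of_eventuallyEq ?_
  filter_upwards [Complex.continuous_ofReal.continuousAt.eventually (hs.mem_nhds hx)] with y hy
  rw [hfg y hy, Complex.ofReal_re]

/-- If `Re f(x + iy) ≤ f(x)` near a real point then the leading coefficient of `f` beyond first
order is of order two and positive. -/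
lemma iteratedDeriv_two_pos {f : ℂ → ℂ} {g : ℝ → ℝ} {c r : ℝ} (hr : 0 < r)
    (hf : DifferentiableOn ℂ f (Metric.ball (c : ℂ) r))
    (hfg : ∀ x : ℝ, (x : ℂ) ∈ Metric.ball (c : ℂ) r → f x = g x)
    (hre : ∀ z ∈ Metric.ball (c : ℂ) r, (f z).re ≤ (f z.re).re)
    (hconv : StrictConvexOn ℝ (Ioo (c - r) (c + r)) g) : 0 < iteratedDeriv 2 g c := by
  have hc : (c : ℂ) ∈ Metric.ball (c : ℂ) r := Metric.mem_ball_self hr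
  have hball : ∀ x : ℝ, x ∈ Ioo (c - r) (c + r) → (x : ℂ) ∈ Metric.ball (c : ℂ) r := by
    intro x hx
    rw [mem_ball_iff_norm, ← Complex.ofReal_sub, Complex.norm_real, Real.norm_eq_abs, abs_lt]
    constructor <;> linarith [hx.1, hx.2]
  have hcoef : ∀ j, iteratedDeriv j f c = (iteratedDeriv j g c : ℝ) := fun j =>
    iteratedDeriv_eq_of_real Metric.isOpen_ball hf hfg j c hc
  -- Otherwise the Taylor series makes `g` affine, against strict convexity at the midpoint of two
  -- symmetric points.
  have hex : ∃ m, 2 ≤ m ∧ iteratedDeriv m g c ≠ 0 := by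
    by_contra! hcon
    have haff : ∀ x ∈ Ioo (c - r) (c + r), g x = g c + iteratedDeriv 1 g c * (x - c) := by
      intro x hx
      have h1 := Complex.hasSum_taylorSeries_on_ball hf (hball x hx)
      have h2 := hasSum_sum_of_ne_finset_zero (L := SummationFilter.unconditional ℕ)
        (f := fun n : ℕ => (n.factorial : ℂ)⁻¹ • ((x : ℂ) - c) ^ n • iteratedDeriv n f c)
        (s := Finset.range 2) (fun j hj => by
          rw [Finset.mem_range, not_lt] at hj
          rw [hcoef, hcon j hj]; simp)
      have h3 := h1.unique h2
      simp only [Finset.sum_range_succ, Finset.sum_range_zero, hcoef, hfg x (hball x hx)] at h3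
      simp only [Nat.factorial, smul_eq_mul, iteratedDeriv_zero] at h3
      norm_num at h3
      have h4 : (g x : ℂ) = ((g c + (x - c) * deriv g c : ℝ) : ℂ) := by
        rw [h3]; push_cast; ring
      rw [iteratedDeriv_one, Complex.ofReal_inj.mp h4]; ring
    have hx : c - r / 2 ∈ Ioo (c - r) (c + r) := ⟨by linarith, by linarith⟩
    have hy : c + r / 2 ∈ Ioo (c - r) (c + r) := ⟨by linarith, by linarith⟩
    have := hconv.2 hx hy (by linarith) (by norm_num : (0 : ℝ) < 1 / 2)
      (by norm_num : (0 : ℝ) < 1 / 2) (by norm_num)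
    simp only [smul_eq_mul] at this
    rw [haff _ hx, haff _ hy, show (1 / 2 * (c - r / 2) + 1 / 2 * (c + r / 2) : ℝ) = c by ring] at this
    linarith
  set m := Nat.find hex with hm
  obtain ⟨hm2, hmne⟩ := Nat.find_spec hex
  have hmin : ∀ j, 2 ≤ j → j < m → iteratedDeriv j g c = 0 := by
    intro j h2 hj
    by_contra hne
    exact Nat.find_min hex hj ⟨h2, hne⟩
  rw [← hm] at hm2 hmne
  set a : ℝ := iteratedDeriv m g c / m.factorial with ha
  have ha0 : a ≠ 0 := div_ne_zero hmne (by positivity)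
  -- Taylor polynomial
  have hbd : ∃ A, ∀ z ∈ Metric.ball (c : ℂ) (r / 2), ‖f z‖ ≤ A := by
    obtain ⟨A, hA⟩ := (isCompact_closedBall (c : ℂ) (r / 2)).exists_bound_of_continuousOn
      (hf.continuousOn.mono (Metric.closedBall_subset_ball (by linarith)))
    exact ⟨A, fun z hz => hA z (Metric.ball_subset_closedBall hz)⟩
  obtain ⟨A, hA⟩ := hbd
  set K : ℝ := 2 * A * (2 / (r / 2)) ^ (m + 1) with hK
  have hT : ∀ w : ℂ, ‖w‖ ≤ r / 8 →
      ‖f (c + w) - (g c + (iteratedDeriv 1 g c : ℝ) * w + a * w ^ m)‖ ≤ K * ‖w‖ ^ (m + 1) := by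
    intro w hw
    have h1 := taylor_remainder_bound (by linarith : 0 < r / 2)
      (hf.mono (Metric.ball_subset_ball (by linarith))) hA (m + 1) (z := c + w)
      (by rw [add_sub_cancel_left]; linarith)
    rw [add_sub_cancel_left] at h1
    have h2 : ∑ j ∈ Finset.range (m + 1), ((j.factorial : ℂ)⁻¹ * iteratedDeriv j f c) * w ^ j
        = g c + (iteratedDeriv 1 g c : ℝ) * w + a * w ^ m := by
      rw [Finset.sum_range_succ]
      congr 1
      · rw [← Finset.sum_subset (Finset.range_subset_range.mpr hm2)]
        · simp only [Finset.sum_range_succ, Finset.sum_range_zero, hcoef]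
          simp
        · intro j hj hj2
          rw [Finset.mem_range] at hj
          rw [Finset.mem_range, not_lt] at hj2
          rw [hcoef, hmin j hj2 hj]; simp
      · rw [hcoef, ha]; push_cast; ring
    rw [h2] at h1
    refine h1.trans (le_of_eq ?_)
    rw [hK, mul_div_right_comm, mul_pow (2 / (r / 2))]; ring
  -- Compare `f` at `c + w` and at its real part, with `w = ρ e^{iθ}`. The constant and linear terms
  -- have equal real parts, so after division by `ρ ^ m` the leading terms are compared as `ρ → 0`.
  have hdir : ∀ θ : ℝ, a * Real.cos (m * θ) ≤ a * Real.cos θ ^ m := by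
    intro θ
    have key : ∀ ρ ∈ Ioo 0 (r / 8), a * Real.cos (m * θ) - a * Real.cos θ ^ m ≤ 2 * K * ρ := by
      intro ρ hρ
      have hA0 : 0 ≤ A := (norm_nonneg _).trans (hA c (Metric.mem_ball_self (by linarith)))
      have hK0 : 0 ≤ K := by rw [hK]; positivity
      obtain ⟨w, hwn, hwre, hwm⟩ : ∃ w : ℂ, ‖w‖ = ρ ∧ w.re = ρ * Real.cos θ ∧
          (w ^ m).re = ρ ^ m * Real.cos (m * θ) := by
        refine ⟨ρ * Complex.exp (θ * Complex.I), ?_, ?_, ?_⟩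
        · rw [norm_mul, Complex.norm_exp_ofReal_mul_I, Complex.norm_real, Real.norm_eq_abs,
            abs_of_pos hρ.1, mul_one]
        · rw [Complex.re_ofReal_mul, Complex.exp_ofReal_mul_I_re]
        · rw [mul_pow, ← Complex.exp_nat_mul, ← Complex.ofReal_pow, Complex.re_ofReal_mul,
            show (m : ℂ) * (θ * Complex.I) = ((m * θ : ℝ) : ℂ) * Complex.I by push_cast; ring,
            Complex.exp_ofReal_mul_I_re]
      have hn2 : ‖(w.re : ℂ)‖ ≤ ρ := by
        rw [Complex.norm_real, Real.norm_eq_abs]; exact (Complex.abs_re_le_norm w).trans hwn.le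
      have h1 := hT w (by rw [hwn]; exact hρ.2.le)
      have h2 := hT (w.re : ℂ) (hn2.trans hρ.2.le)
      have h3 := hre (c + w) (by rw [mem_ball_iff_norm, add_sub_cancel_left, hwn]; linarith [hρ.2])
      have h1' := (Complex.abs_re_le_norm _).trans h1
      have h2' := (Complex.abs_re_le_norm _).trans (h2.trans
        (show K * ‖(w.re : ℂ)‖ ^ (m + 1) ≤ K * ρ ^ (m + 1) by gcongr))
      rw [hwn] at h1'
      have e1 : (f (c + w) - (g c + (iteratedDeriv 1 g c : ℝ) * w + a * w ^ m)).re
          = (f (c + w)).re - (g c + iteratedDeriv 1 g c * w.re + a * (ρ ^ m * Real.cos (m * θ))) := by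
        rw [Complex.sub_re, Complex.add_re, Complex.add_re, Complex.re_ofReal_mul,
          Complex.re_ofReal_mul, hwm, Complex.ofReal_re]
      have e2 : (f (c + (w.re : ℂ)) - (g c + (iteratedDeriv 1 g c : ℝ) * (w.re : ℂ)
            + a * (w.re : ℂ) ^ m)).re
          = (f ((c + w).re : ℂ)).re - (g c + iteratedDeriv 1 g c * w.re
            + a * (ρ ^ m * Real.cos θ ^ m)) := by
        rw [← mul_pow, ← hwre]
        simp only [Complex.sub_re, Complex.add_re, Complex.re_ofReal_mul,
          ← Complex.ofReal_pow, Complex.ofReal_re, Complex.ofReal_add]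
      rw [e1] at h1'
      rw [e2] at h2'
      have h4 : ρ ^ m * (a * Real.cos (m * θ) - a * Real.cos θ ^ m) ≤ ρ ^ m * (2 * K * ρ) := by
        have := (abs_le.mp h1').1
        have := (abs_le.mp h2').2
        rw [pow_succ] at *
        nlinarith
      exact le_of_mul_le_mul_left h4 (pow_pos hρ.1 m)
    have hlim : Tendsto (fun ρ : ℝ => 2 * K * ρ) (𝓝[>] 0) (𝓝 0) := by
      have : Tendsto (fun ρ : ℝ => 2 * K * ρ) (𝓝 0) (𝓝 (2 * K * 0)) :=
        (continuous_const.mul continuous_id).tendsto 0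
      rw [mul_zero] at this
      exact this.mono_left nhdsWithin_le_nhds
    have := ge_of_tendsto hlim (b := a * Real.cos (m * θ) - a * Real.cos θ ^ m) (by
      filter_upwards [Ioo_mem_nhdsGT (show (0 : ℝ) < r / 8 by linarith)] with ρ hρ using key ρ hρ)
    linarith
  have hmpos : (0 : ℝ) < m := by positivity
  have hpi := Real.pi_pos
  rcases hm2.eq_or_lt with h2 | h3
  -- For `m = 2` the vertical direction gives `-a ≤ 0`. For `m ≥ 3` the angle `π / m` excludes `a <
  -- 0` and the angle `2π / m` excludes `a > 0`.
  · have h1 := hdir (Real.pi / 2)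
    rw [← h2] at h1
    rw [show ((2 : ℕ) : ℝ) * (Real.pi / 2) = Real.pi by push_cast; ring, Real.cos_pi,
      Real.cos_pi_div_two] at h1
    have h0 : 0 < a := lt_of_le_of_ne (by nlinarith) ha0.symm
    rw [ha, ← h2] at h0
    exact (div_pos_iff_of_pos_right (by positivity)).mp h0
  · exfalso
    have h3' : (3 : ℝ) ≤ m := by exact_mod_cast h3
    rcases lt_or_gt_of_ne ha0 with hneg | hpos
    · have h1 := hdir (Real.pi / m)
      rw [mul_div_cancel₀ _ hmpos.ne', Real.cos_pi] at h1
      have hcos : 0 < Real.cos (Real.pi / m) := by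
        apply Real.cos_pos_of_mem_Ioo
        constructor
        · have : 0 < Real.pi / m := by positivity
          linarith
        · exact div_lt_div_of_pos_left hpi (by norm_num) (by linarith)
      have := pow_pos hcos m
      nlinarith
    · have h1 := hdir (2 * Real.pi / m)
      rw [mul_div_cancel₀ _ hmpos.ne', Real.cos_two_pi] at h1
      have hlt : |Real.cos (2 * Real.pi / m)| < 1 := by
        have hlt1 : 2 * Real.pi / m < Real.pi := by rw [div_lt_iff₀ hmpos]; nlinarith
        have hpos1 : 0 < 2 * Real.pi / m := by positivity
        rw [abs_lt]
        constructor
        · rw [← Real.cos_pi]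
          exact Real.cos_lt_cos_of_nonneg_of_le_pi hpos1.le le_rfl hlt1
        · rw [← Real.cos_zero]
          exact Real.cos_lt_cos_of_nonneg_of_le_pi le_rfl hlt1.le hpos1
      have h5 : Real.cos (2 * Real.pi / m) ^ m < 1 := by
        refine (le_abs_self _).trans_lt ?_
        rw [abs_pow]
        exact pow_lt_one₀ (abs_nonneg _) hlt (by omega)
      nlinarith

/-- A primitive of `f' / f` on the disc, normalised to the real logarithm at the centre. Its
derivative is real on the real axis, so its imaginary part stays zero there. -/
lemma exists_log_of_real {f : ℂ → ℂ} {g : ℝ → ℝ} {c R : ℝ} (hR : 0 < R)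
    (hf : DifferentiableOn ℂ f (Metric.ball (c : ℂ) R))
    (hne : ∀ z ∈ Metric.ball (c : ℂ) R, f z ≠ 0)
    (hfg : ∀ x : ℝ, (x : ℂ) ∈ Metric.ball (c : ℂ) R → f x = g x) (hpos : 0 < g c) :
    ∃ l : ℂ → ℂ, DifferentiableOn ℂ l (Metric.ball (c : ℂ) R) ∧
      (∀ z ∈ Metric.ball (c : ℂ) R, Complex.exp (l z) = f z) ∧
      ∀ x : ℝ, (x : ℂ) ∈ Metric.ball (c : ℂ) R → l x = (Real.log (g x) : ℝ) := by
  set s := Metric.ball (c : ℂ) R with hs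
  have hso : IsOpen s := Metric.isOpen_ball
  have hsc : IsPreconnected s := (convex_ball (c : ℂ) R).isPreconnected
  have hcs : (c : ℂ) ∈ s := Metric.mem_ball_self hR
  obtain ⟨l, hlc, hl⟩ := (((hf.deriv hso).div hf hne).isExactOn_ball).with_val_at
    (c : ℂ) ((Real.log (g c) : ℝ) : ℂ)
  have hexp : ∀ z ∈ s, Complex.exp (l z) = f z := by
    have hd : ∀ z ∈ s, HasDerivAt (fun z => f z * Complex.exp (-l z)) 0 z := by
      intro z hz
      have h1 := (hf.differentiableAt (hso.mem_nhds hz)).hasDerivAt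
      have h2 := h1.mul (hl z hz).neg.cexp
      convert! h2 using 1
      simp only [Pi.div_apply]
      field_simp [hne z hz]
      ring
    intro z hz
    have h1 : f z * Complex.exp (-l z) = f c * Complex.exp (-l c) :=
      hso.is_const_of_deriv_eq_zero hsc
        (fun w hw => (hd w hw).differentiableAt.differentiableWithinAt)
        (fun w hw => (hd w hw).deriv) hz hcs
    rw [hlc, hfg c hcs, ← Complex.ofReal_neg, ← Complex.ofReal_exp, Real.exp_neg,
      Real.exp_log hpos, ← Complex.ofReal_mul, mul_inv_cancel₀ hpos.ne', Complex.ofReal_one,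
      Complex.exp_neg, mul_inv_eq_one₀ (Complex.exp_ne_zero _)] at h1
    exact h1.symm
  refine ⟨l, fun z hz => (hl z hz).differentiableAt.differentiableWithinAt, hexp, ?_⟩
  have hmem : ∀ x : ℝ, (x : ℂ) ∈ s ↔ x ∈ Ioo (c - R) (c + R) := by
    intro x
    rw [hs, mem_ball_iff_norm, ← Complex.ofReal_sub, Complex.norm_real, Real.norm_eq_abs, abs_lt,
      mem_Ioo]
    constructor <;> intro h <;> constructor <;> linarith [h.1, h.2]
  have him : ∀ x : ℝ, (x : ℂ) ∈ s → (l x).im = 0 := by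
    have hd : ∀ x : ℝ, (x : ℂ) ∈ s → HasDerivAt (fun x : ℝ => (l x).im) 0 x := by
      intro x hx
      have h1 : HasDerivAt (fun y : ℝ => l y) (deriv f x / f x) x := (hl x hx).comp_ofReal
      have h2 := (Complex.imCLM.hasFDerivAt.comp_hasDerivAt x h1)
      convert! h2 using 1
      have h3 := iteratedDeriv_eq_of_real hso hf hfg 1 x hx
      rw [iteratedDeriv_one, iteratedDeriv_one] at h3
      rw [h3, hfg x hx, ← Complex.ofReal_div]
      simp
    intro x hx
    have h1 : (l x).im = (l c).im :=
      isOpen_Ioo.is_const_of_deriv_eq_zero (s := Ioo (c - R) (c + R)) isPreconnected_Ioo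
        (fun y hy => (hd y ((hmem y).mpr hy)).differentiableAt.differentiableWithinAt)
        (fun y hy => (hd y ((hmem y).mpr hy)).deriv) ((hmem x).mp hx)
        (f := fun x : ℝ => (l x).im) ((hmem c).mp hcs)
    rw [h1, hlc, Complex.ofReal_im]
  intro x hx
  have h1 : l x = ((l x).re : ℂ) := Complex.ext (by simp) (by simp [him x hx])
  have h2 := hexp x hx
  rw [hfg x hx, h1, ← Complex.ofReal_exp, Complex.ofReal_inj] at h2
  rw [← h2, Real.log_exp, ← h1]

/-! ### Uniformly bounded holomorphic logarithms of the moment generating function -/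

section

variable {Ω : Type*} [MeasurableSpace Ω] {P : Measure Ω} {Y : ℝ → Ω → ℝ}

lemma isOpen_limitInterior : IsOpen (limitInterior P Y) := isOpen_interior

lemma div_mem_interior_integrableExpSet {ε : ℝ} (hε : 0 < ε)
    (h : limitInterior P Y ⊆ lmgfDomain P Y ε) {x : ℝ} (hx : x ∈ limitInterior P Y) :
    x / ε ∈ interior (integrableExpSet (Y ε) P) := by
  rw [mem_interior]
  refine ⟨(fun y => y * ε) ⁻¹' limitInterior P Y, ?_,
    isOpen_limitInterior.preimage (continuous_id.mul continuous_const), ?_⟩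
  · intro y hy
    have h2 : y * ε / ε ∈ integrableExpSet (Y ε) P := h hy
    rwa [mul_div_cancel_right₀ _ hε.ne'] at h2
  · simpa [div_mul_cancel₀ _ hε.ne'] using hx

lemma differentiableAt_scaledComplexMGF {ε : ℝ} (hε : 0 < ε)
    (h : limitInterior P Y ⊆ lmgfDomain P Y ε) {z : ℂ} (hz : z.re ∈ limitInterior P Y) :
    DifferentiableAt ℂ (scaledComplexMGF P Y ε) z := by
  have h1 : (z / (ε : ℂ)).re ∈ interior (integrableExpSet (Y ε) P) := by
    rw [Complex.div_ofReal_re]; exact div_mem_interior_integrableExpSet hε h hz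
  exact (hasDerivAt_complexMGF h1).differentiableAt.comp z
    (f := fun z : ℂ => z / (ε : ℂ)) (differentiableAt_id.div_const _)

lemma scaledComplexMGF_ofReal (ε x : ℝ) :
    scaledComplexMGF P Y ε x = (mgf (Y ε) P (x / ε) : ℝ) := by
  rw [scaledComplexMGF, ← Complex.ofReal_div, complexMGF_ofReal]

lemma norm_scaledComplexMGF_le (ε : ℝ) (z : ℂ) :
    ‖scaledComplexMGF P Y ε z‖ ≤ mgf (Y ε) P (z.re / ε) := by
  refine norm_complexMGF_le_mgf.trans (le_of_eq ?_)
  rw [Complex.div_ofReal_re]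

lemma mgf_le_add {Z : Ω → ℝ} {a b x : ℝ} (ha : a ∈ integrableExpSet Z P)
    (hb : b ∈ integrableExpSet Z P) (hx : x ∈ Icc a b) : mgf Z P x ≤ mgf Z P a + mgf Z P b := by
  rw [mgf, mgf, mgf, ← integral_add ha hb]
  refine integral_mono (convex_integrableExpSet.ordConnected.out ha hb hx) (ha.add hb) ?_
  intro y
  simp only
  rcases le_total 0 (Z y) with h | h
  · have : Real.exp (x * Z y) ≤ Real.exp (b * Z y) := by gcongr; exact hx.2
    have := Real.exp_pos (a * Z y)
    linarith
  · have : Real.exp (x * Z y) ≤ Real.exp (a * Z y) := by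
      apply Real.exp_le_exp.mpr; nlinarith [hx.1]
    have := Real.exp_pos (b * Z y)
    linarith

variable {Λ₀ Λ₁ Λ₂ : ℝ → ℝ} {ReΛ₀ : ℂ → ℝ}

lemma Admissible.tendsto_lmgf (hA : Admissible P Y Λ₀ Λ₁ Λ₂ ReΛ₀) {u : ℝ}
    (hu : u ∈ limitInterior P Y) :
    Tendsto (fun ε => lmgf P Y ε u) (𝓝[>] 0) (𝓝 (Λ₀ u)) := by
  have h1 : Tendsto (fun ε : ℝ => ε ^ 3) (𝓝[>] 0) (𝓝 0) := by
    have : Tendsto (fun ε : ℝ => ε ^ 3) (𝓝 0) (𝓝 (0 ^ 3)) := (continuous_pow 3).tendsto 0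
    rw [zero_pow (by norm_num)] at this
    exact this.mono_left nhdsWithin_le_nhds
  have h2 := (hA.expansion u hu).trans_tendsto h1
  have h3 : Tendsto (fun ε : ℝ => Λ₀ u + Λ₁ u * ε + Λ₂ u * ε ^ 2) (𝓝[>] 0) (𝓝 (Λ₀ u)) := by
    have : Tendsto (fun ε : ℝ => Λ₀ u + Λ₁ u * ε + Λ₂ u * ε ^ 2) (𝓝 0)
        (𝓝 (Λ₀ u + Λ₁ u * 0 + Λ₂ u * 0 ^ 2)) := by
      apply Continuous.tendsto; fun_prop
    simp only [mul_zero, add_zero, zero_pow (two_ne_zero)] at this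
    exact this.mono_left nhdsWithin_le_nhds
  simpa using h2.add h3

variable [IsProbabilityMeasure P]

lemma mgf_eq_exp_lmgf {ε x : ℝ} (hε : 0 < ε) (hx : x ∈ lmgfDomain P Y ε) :
    mgf (Y ε) P (x / ε) = Real.exp (lmgf P Y ε x / ε) := by
  rw [lmgf, mul_div_cancel_left₀ _ hε.ne', exp_cgf hx]

/-- Near a point of `𝒟₀ᵒ \ {0}`, for small `ε`, the function `Λ_ε` extends to a holomorphic
function on a complex disc, bounded uniformly in `ε`. -/
theorem Admissible.exists_local_log (hA : Admissible P Y Λ₀ Λ₁ Λ₂ ReΛ₀) {u : ℝ}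
    (hu : u ∈ limitInterior P Y) (hu0 : u ≠ 0) :
    ∃ R > 0, ∃ ε₀ > 0, ε₀ ≤ 1 ∧ ∃ A : ℝ, ∃ L : ℝ → ℂ → ℂ,
      Ioo (u - R) (u + R) ⊆ limitInterior P Y ∧
      ∀ ε ∈ Ioo 0 ε₀, DifferentiableOn ℂ (L ε) (Metric.ball (u : ℂ) R) ∧
        (∀ z ∈ Metric.ball (u : ℂ) R, ‖L ε z‖ ≤ A) ∧
        (∀ z ∈ Metric.ball (u : ℂ) R, Complex.exp (L ε z / ε) = scaledComplexMGF P Y ε z) ∧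
        ∀ x : ℝ, (x : ℂ) ∈ Metric.ball (u : ℂ) R → L ε x = (lmgf P Y ε x : ℝ) := by
  obtain ⟨R₀, hR₀, hR₀'⟩ := Metric.isOpen_iff.mp
    (isOpen_limitInterior (P := P) (Y := Y)) u hu
  -- The disc of radius `2 R` must project into `𝒟₀ᵒ` and miss the imaginary axis, where the tail
  -- expansion gives nothing. The spare factor 2 is used by Borel-Carathéodory.
  obtain ⟨R, hR, hR1, hR2⟩ : ∃ R > 0, 2 * R < R₀ ∧ 2 * R < |u| := by
    refine ⟨min R₀ |u| / 4, by positivity, ?_, ?_⟩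
    · linarith [min_le_left R₀ |u|, lt_min hR₀ (abs_pos.mpr hu0)]
    · linarith [min_le_right R₀ |u|, lt_min hR₀ (abs_pos.mpr hu0)]
  have hreD : ∀ x : ℝ, |x - u| ≤ 2 * R → x ∈ limitInterior P Y := by
    intro x hx
    apply hR₀'
    rw [Metric.mem_ball, Real.dist_eq]; linarith
  have hre0 : ∀ x : ℝ, |x - u| ≤ 2 * R → x ≠ 0 := by
    rintro x hx rfl
    rw [zero_sub, abs_neg] at hx; linarith
  have hre : ∀ z ∈ Metric.closedBall (u : ℂ) (2 * R), |z.re - u| ≤ 2 * R := by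
    intro z hz
    rw [mem_closedBall_iff_norm] at hz
    have := (Complex.abs_re_le_norm (z - u)).trans hz
    rwa [Complex.sub_re, Complex.ofReal_re] at this
  obtain ⟨ε₂, hε₂, hdom, -⟩ := hA.smooth
  -- nonvanishing on the closed ball
  have hnv : ∀ᶠ ε in 𝓝[>] (0 : ℝ), ∀ z ∈ Metric.closedBall (u : ℂ) (2 * R),
      scaledComplexMGF P Y ε z ≠ 0 := by
    have h1 := (isCompact_closedBall (u : ℂ) (2 * R)).mem_prod_nhdsSet_of_forall
      (l := 𝓝[>] (0 : ℝ)) (s := {q : ℝ × ℂ | scaledComplexMGF P Y q.1 q.2 ≠ 0})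
      (fun z hz => (hA.tail_expansion z (hreD _ (hre z hz)) (hre0 _ (hre z hz))).1)
    obtain ⟨s, hs, t, ht, hst⟩ := mem_prod_iff.mp h1
    filter_upwards [hs] with ε hε z hz
    exact hst (mk_mem_prod hε (subset_of_mem_nhdsSet ht hz))
  have ha : u - 2 * R ∈ limitInterior P Y := hreD _ (by
    rw [abs_le]; constructor <;> linarith)
  have hb : u + 2 * R ∈ limitInterior P Y := hreD _ (by
    rw [abs_le]; constructor <;> linarith)
  set C : ℝ := max (Λ₀ (u - 2 * R)) (Λ₀ (u + 2 * R)) + 1 with hC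
  have hae := (hA.tendsto_lmgf ha).eventually (Iio_mem_nhds (show Λ₀ (u - 2 * R) < C by
    rw [hC]; linarith [le_max_left (Λ₀ (u - 2 * R)) (Λ₀ (u + 2 * R))]))
  have hbe := (hA.tendsto_lmgf hb).eventually (Iio_mem_nhds (show Λ₀ (u + 2 * R) < C by
    rw [hC]; linarith [le_max_right (Λ₀ (u - 2 * R)) (Λ₀ (u + 2 * R))]))
  have hue := (hA.tendsto_lmgf hu).abs.eventually (Iio_mem_nhds (show |Λ₀ u| < |Λ₀ u| + 1 by
    linarith))
  obtain ⟨δ, hδ, hδ'⟩ := mem_nhdsGT_iff_exists_Ioo_subset.mp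
    (hnv.and (hae.and (hbe.and hue)))
  set ε₀ := min (min δ ε₂) 1 with hε₀
  have hε₀0 : 0 < ε₀ := lt_min (lt_min hδ hε₂) one_pos
  have hprop : ∀ ε ∈ Ioo 0 ε₀, ∃ L : ℂ → ℂ, DifferentiableOn ℂ L (Metric.ball (u : ℂ) (2 * R)) ∧
      (∀ z ∈ Metric.ball (u : ℂ) (2 * R),
        Complex.exp (L z / ε) = scaledComplexMGF P Y ε z) ∧
      ∀ x : ℝ, (x : ℂ) ∈ Metric.ball (u : ℂ) (2 * R) → L x = (lmgf P Y ε x : ℝ) := by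
    intro ε hε
    have hεδ : ε ∈ Ioo 0 δ := ⟨hε.1, hε.2.trans_le ((min_le_left _ _).trans (min_le_left _ _))⟩
    have hε2 : ε ∈ Ioo 0 ε₂ := ⟨hε.1, hε.2.trans_le ((min_le_left _ _).trans (min_le_right _ _))⟩
    obtain ⟨l, hld, hle, hlr⟩ := exists_log_of_real (f := scaledComplexMGF P Y ε)
      (g := fun x => mgf (Y ε) P (x / ε)) (c := u) (R := 2 * R) (by linarith)
      (fun z hz => (differentiableAt_scaledComplexMGF hε.1 (hdom ε hε2)
        (hreD _ (hre z (Metric.ball_subset_closedBall hz)))).differentiableWithinAt)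
      (fun z hz => (hδ' hεδ).1 z (Metric.ball_subset_closedBall hz))
      (fun x _ => scaledComplexMGF_ofReal ε x)
      (mgf_pos (hdom ε hε2 hu))
    have hne : (ε : ℂ) ≠ 0 := by exact_mod_cast hε.1.ne'
    refine ⟨fun z => ε * l z, hld.const_mul _, fun z hz => ?_, fun x hx => ?_⟩
    · rw [mul_div_cancel_left₀ _ hne, hle z hz]
    · simp only
      rw [hlr x hx, lmgf, cgf]; push_cast; rfl
  choose! L hLd hLe hLr using hprop
  refine ⟨R, hR, ε₀, hε₀0, min_le_right _ _, 2 * (|C| + 2) + 3 * (|Λ₀ u| + 1), L, ?_, ?_⟩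
  · intro x hx
    apply hreD
    rw [abs_le]; constructor <;> linarith [hx.1, hx.2]
  intro ε hε
  have hεδ : ε ∈ Ioo 0 δ := ⟨hε.1, hε.2.trans_le ((min_le_left _ _).trans (min_le_left _ _))⟩
  have hε2 : ε ∈ Ioo 0 ε₂ := ⟨hε.1, hε.2.trans_le ((min_le_left _ _).trans (min_le_right _ _))⟩
  have hε1 : ε ≤ 1 := hε.2.le.trans (min_le_right _ _)
  have hsub : Metric.ball (u : ℂ) R ⊆ Metric.ball (u : ℂ) (2 * R) :=
    Metric.ball_subset_ball (by linarith)
  refine ⟨(hLd ε hε).mono hsub, ?_, fun z hz => hLe ε hε z (hsub hz),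
    fun x hx => hLr ε hε x (hsub hx)⟩
  -- Only the real part is controlled directly: the modulus of the expectation is at most the sum of
  -- its values at the two real endpoints. The factor 2 from the sum is absorbed by `exp (1 / ε) ≥
  -- 2`, at the price of one unit in the exponent.
  have hupper : ∀ z ∈ Metric.ball (u : ℂ) (2 * R), (L ε z).re ≤ |C| + 2 := by
    intro z hz
    have hzr := hre z (Metric.ball_subset_closedBall hz)
    have h1 : Real.exp ((L ε z).re / ε) ≤
        mgf (Y ε) P ((u - 2 * R) / ε) + mgf (Y ε) P ((u + 2 * R) / ε) := by
      have h2 := norm_scaledComplexMGF_le (P := P) (Y := Y) ε z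
      rw [← hLe ε hε z hz, Complex.norm_exp, Complex.div_ofReal_re] at h2
      refine h2.trans (mgf_le_add (hdom ε hε2 ha) (hdom ε hε2 hb) ?_)
      rw [abs_le] at hzr
      constructor
      · apply div_le_div_of_nonneg_right _ hε.1.le; linarith
      · apply div_le_div_of_nonneg_right _ hε.1.le; linarith
    rw [mgf_eq_exp_lmgf hε.1 (hdom ε hε2 ha), mgf_eq_exp_lmgf hε.1 (hdom ε hε2 hb)] at h1
    have h3 : Real.exp (lmgf P Y ε (u - 2 * R) / ε) ≤ Real.exp (|C| / ε) := by
      apply Real.exp_le_exp.mpr (div_le_div_of_nonneg_right _ hε.1.le)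
      exact (le_of_lt (hδ' hεδ).2.1).trans (le_abs_self C)
    have h4 : Real.exp (lmgf P Y ε (u + 2 * R) / ε) ≤ Real.exp (|C| / ε) := by
      apply Real.exp_le_exp.mpr (div_le_div_of_nonneg_right _ hε.1.le)
      exact (le_of_lt (hδ' hεδ).2.2.1).trans (le_abs_self C)
    have h5 : 2 ≤ Real.exp (1 / ε) := by
      have : 1 ≤ 1 / ε := by rwa [le_div_iff₀ hε.1, one_mul]
      linarith [Real.add_one_le_exp (1 / ε)]
    have h6 : Real.exp ((L ε z).re / ε) ≤ Real.exp ((|C| + 1) / ε) := by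
      rw [add_div, Real.exp_add]
      nlinarith [Real.exp_pos (|C| / ε)]
    rw [Real.exp_le_exp, div_le_div_iff_of_pos_right hε.1] at h6
    linarith
  intro z hz
  have hshift : ∀ w ∈ Metric.ball (0 : ℂ) (2 * R), (u : ℂ) + w ∈ Metric.ball (u : ℂ) (2 * R) := by
    intro w hw
    rw [mem_ball_iff_norm, add_sub_cancel_left]
    exact mem_ball_zero_iff.mp hw
  have hzn : ‖z - u‖ < R := mem_ball_iff_norm.mp hz
  have h1 := Complex.borelCaratheodory (M := |C| + 2) (R := 2 * R) (z := z - u)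
    (f := fun w => L ε (u + w)) (by positivity)
    ((hLd ε hε).comp (by fun_prop) hshift) (fun w hw => hupper _ (hshift w hw)) (by linarith)
    (by rw [mem_ball_zero_iff]; linarith)
  simp only [add_sub_cancel, add_zero] at h1
  have h2 : ‖L ε u‖ ≤ |Λ₀ u| + 1 := by
    rw [hLr ε hε u (Metric.mem_ball_self (by linarith)), Complex.norm_real, Real.norm_eq_abs]
    exact le_of_lt (hδ' hεδ).2.2.2
  have h0 := norm_nonneg (z - u)
  have hden : 0 < 2 * R - ‖z - u‖ := by linarith
  have h3 : 2 * (|C| + 2) * ‖z - u‖ / (2 * R - ‖z - u‖) ≤ 2 * (|C| + 2) := by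
    rw [div_le_iff₀ hden]
    have : 0 ≤ |C| := abs_nonneg C
    nlinarith
  have h4 : ‖L ε u‖ * (2 * R + ‖z - u‖) / (2 * R - ‖z - u‖) ≤ 3 * ‖L ε u‖ := by
    rw [div_le_iff₀ hden]
    nlinarith [norm_nonneg (L ε u)]
  linarith

end

/-! ### Saddlepoint and rate function -/

/-- If `f'` stayed below `k`, finiteness of the conjugate at `k + δ` would bound `D` above. Near its
supremum `f'` would lie between `f' x₀` and `k`, contradicting steepness. Keeping `f'` abstract
allows use of the lemma after the reflection `x ↦ -x`. -/
lemma exists_le_deriv_of_steep {D : Set ℝ} {f f' : ℝ → ℝ} {x₀ k δ C : ℝ} (hD : IsOpen D)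
    (hx₀ : x₀ ∈ D) (hδ : 0 < δ) (hmono : ∀ x ∈ D, x₀ < x → f' x₀ ≤ f' x)
    (hslope : ∀ x ∈ D, x₀ < x → f x ≤ f x₀ + f' x * (x - x₀))
    (hsteep : ∀ b ∉ D, ∀ u : ℕ → ℝ, (∀ n, u n ∈ D) → Tendsto u atTop (𝓝 b) →
      Tendsto (fun n => |f' (u n)|) atTop atTop)
    (hC : ∀ x ∈ D, x * (k + δ) - f x ≤ C) : ∃ x ∈ D, k ≤ f' x := by
  by_contra! hcon
  have hbdd : BddAbove D := by
    refine ⟨max x₀ ((C + f x₀ - k * x₀) / δ), fun x hx => ?_⟩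
    rcases le_or_gt x x₀ with h | h
    · exact h.trans (le_max_left _ _)
    · refine le_trans ?_ (le_max_right _ _)
      rw [le_div_iff₀ hδ]
      have h1 := hslope x hx h
      have h2 := hC x hx
      nlinarith [hcon x hx]
  have hne : D.Nonempty := ⟨x₀, hx₀⟩
  have hbD : sSup D ∉ D := by
    intro hb
    obtain ⟨η, hη, hη'⟩ := Metric.isOpen_iff.mp hD _ hb
    have : sSup D + η / 2 ∈ D := hη' (by
      rw [Metric.mem_ball, Real.dist_eq, add_sub_cancel_left, abs_of_pos (by linarith)]; linarith)
    linarith [le_csSup hbdd this]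
  have hlt : x₀ < sSup D := lt_of_le_of_ne (le_csSup hbdd hx₀) (fun h => hbD (h ▸ hx₀))
  obtain ⟨u, -, hu, huD⟩ := exists_seq_tendsto_sSup hne hbdd
  have h1 := hsteep _ hbD u huD hu
  have h2 := (tendsto_atTop.mp h1 (max |f' x₀| |k| + 1)).and (hu.eventually (Ioi_mem_nhds hlt))
  obtain ⟨n, hn, hn'⟩ := h2.exists
  have h3 := hmono _ (huD n) hn'
  have h4 := hcon _ (huD n)
  have : |f' (u n)| ≤ max |f' x₀| |k| := abs_le_max_abs_abs h3 h4.le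
  linarith

section

variable {D : Set ℝ} {f : ℝ → ℝ} {k u : ℝ}

lemma tangent_lt (hD : IsOpen D) (hconv : StrictConvexOn ℝ D f) (hdiff : DifferentiableOn ℝ f D)
    (hu : u ∈ D) {x : ℝ} (hx : x ∈ D) (hxu : x ≠ u) : f u + deriv f u * (x - u) < f x := by
  have hd : ∀ y ∈ D, DifferentiableAt ℝ f y := fun y hy => hdiff.differentiableAt (hD.mem_nhds hy)
  rcases lt_or_gt_of_ne hxu with h | h
  · have := hconv.slope_lt_deriv hx hu h (hd u hu)
    rw [slope_def_field, div_lt_iff₀ (by linarith)] at this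
    linarith
  · have := hconv.deriv_lt_slope hu hx h (hd u hu)
    rw [slope_def_field, lt_div_iff₀ (by linarith)] at this
    linarith

/-- Finiteness of the conjugate at `k + η / 2` and `k - η / 2` yields points where the derivative is
at least, respectively at most, `k`. Darboux's property of derivatives supplies a solution between
them, and strict monotonicity makes it unique. -/
theorem existsUnique_isSaddle (hD : IsOpen D) (hne : D.Nonempty) (hconv : StrictConvexOn ℝ D f)
    (hdiff : DifferentiableOn ℝ f D)
    (hsteep : ∀ b ∈ frontier D, ∀ u : ℕ → ℝ, (∀ n, u n ∈ D) → Tendsto u atTop (𝓝 b) →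
      Tendsto (fun n => |deriv f (u n)|) atTop atTop)
    (hk : k ∈ interior (rateDomain D f)) : ∃! u, IsSaddle D f k u := by
  have hd : ∀ y ∈ D, DifferentiableAt ℝ f y := fun y hy => hdiff.differentiableAt (hD.mem_nhds hy)
  have hmono := hconv.strictMonoOn_deriv hd
  have hsteep' : ∀ b ∉ D, ∀ u : ℕ → ℝ, (∀ n, u n ∈ D) → Tendsto u atTop (𝓝 b) →
      Tendsto (fun n => |deriv f (u n)|) atTop atTop := fun b hb v hv hvb =>
    hsteep b ⟨mem_closure_of_tendsto hvb (Eventually.of_forall hv), by rwa [hD.interior_eq]⟩ v hv hvb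
  have htan : ∀ x ∈ D, ∀ y ∈ D, f y + deriv f y * (x - y) ≤ f x := by
    intro x hx y hy
    rcases eq_or_ne x y with rfl | h
    · simp
    · exact (tangent_lt hD hconv hdiff hy hx h).le
  obtain ⟨η, hη, hη'⟩ := Metric.mem_nhds_iff.mp (mem_interior_iff_mem_nhds.mp hk)
  obtain ⟨x₀, hx₀⟩ := hne
  have hval : ∀ k' ∈ rateDomain D f, ∃ C, ∀ x ∈ D, x * k' - f x ≤ C := by
    rintro k' ⟨C, hC⟩
    exact ⟨C, fun x hx => hC ⟨x, hx, rfl⟩⟩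
  obtain ⟨C₁, hC₁⟩ := hval (k + η / 2) (hη' (by
    rw [Metric.mem_ball, Real.dist_eq, add_sub_cancel_left, abs_of_pos (by linarith)]; linarith))
  obtain ⟨C₂, hC₂⟩ := hval (k - η / 2) (hη' (by
    rw [Metric.mem_ball, Real.dist_eq, sub_sub_cancel_left, abs_neg, abs_of_pos (by linarith)]
    linarith))
  obtain ⟨b, hb, hkb⟩ := exists_le_deriv_of_steep (f := f) (f' := deriv f) (k := k) hD hx₀
    (half_pos hη) (fun x hx h => (hmono hx₀ hx h).le)
    (fun x hx _ => by linarith [htan x₀ hx₀ x hx]) hsteep' hC₁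
  obtain ⟨a, ha, hka⟩ := exists_le_deriv_of_steep (D := Neg.neg ⁻¹' D) (f := fun x => f (-x))
    (f' := fun x => -deriv f (-x)) (k := -k) (x₀ := -x₀) (C := C₂)
    (hD.preimage continuous_neg) (by simpa using hx₀) (half_pos hη)
    (fun x hx h => by
      simp only [neg_neg, neg_le_neg_iff]
      exact (hmono hx hx₀ (by linarith)).le)
    (fun x hx h => by
      simp only [neg_neg]
      linarith [htan x₀ hx₀ (-x) hx])
    (fun b hb v hv hvb => by
      simpa using hsteep' (-b) hb (fun n => -v n) hv hvb.neg)
    (fun x hx => by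
      linarith [hC₂ (-x) hx])
  have hoc : OrdConnected (deriv f '' D) := hconv.1.ordConnected.image_deriv hd
  obtain ⟨u, hu, huk⟩ := hoc.out ⟨-a, ha, rfl⟩ ⟨b, hb, rfl⟩ ⟨by linarith, hkb⟩
  exact ⟨u, ⟨hu, huk⟩, fun v hv => hmono.injOn hv.1 hu (hv.2.trans huk.symm)⟩

lemma rate_eq (hD : IsOpen D) (hconv : StrictConvexOn ℝ D f) (hdiff : DifferentiableOn ℝ f D)
    (hu : IsSaddle D f k u) : rate D f k = u * k - f u := by
  refine IsGreatest.csSup_eq ⟨⟨u, hu.1, rfl⟩, ?_⟩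
  rintro _ ⟨x, hx, rfl⟩
  simp only
  rcases eq_or_ne x u with rfl | h
  · rfl
  · have := tangent_lt hD hconv hdiff hu.1 hx h
    rw [hu.2] at this
    linarith

end

/-! ### Uniform expansion and regularity at the saddlepoint -/

section

variable {Ω : Type*} [MeasurableSpace Ω] {P : Measure Ω} {Y : ℝ → Ω → ℝ}
  {Λ₀ Λ₁ Λ₂ : ℝ → ℝ} {ReΛ₀ : ℂ → ℝ} [IsProbabilityMeasure P]

lemma Admissible.apply_zero (hA : Admissible P Y Λ₀ Λ₁ Λ₂ ReΛ₀) : Λ₀ 0 = 0 := by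
  have h := hA.tendsto_lmgf hA.zero_mem
  have h2 : (fun ε => lmgf P Y ε 0) = fun _ => 0 := by
    ext ε; simp [lmgf]
  rw [h2] at h
  exact tendsto_nhds_unique h tendsto_const_nhds

/-- At a nonzero saddlepoint the function `Λ_ε` extends holomorphically, with a uniform expansion
to second order. -/
theorem Admissible.exists_uniform_expansion (hA : Admissible P Y Λ₀ Λ₁ Λ₂ ReΛ₀) {u : ℝ}
    (hu : u ∈ limitInterior P Y) (hu0 : u ≠ 0) :
    ∃ r > 0, ∃ ε₁ > 0, ∃ B : ℝ, 0 ≤ B ∧ ∃ L : ℝ → ℂ → ℂ, ∃ H₀ H₁ : ℂ → ℂ,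
      Ioo (u - r) (u + r) ⊆ limitInterior P Y ∧
      DifferentiableOn ℂ H₀ (Metric.ball (u : ℂ) r) ∧
      DifferentiableOn ℂ H₁ (Metric.ball (u : ℂ) r) ∧
      (∀ x : ℝ, (x : ℂ) ∈ Metric.ball (u : ℂ) r → H₀ x = Λ₀ x) ∧
      (∀ x : ℝ, (x : ℂ) ∈ Metric.ball (u : ℂ) r → H₁ x = Λ₁ x) ∧
      ∀ ε ∈ Ioo 0 ε₁, DifferentiableOn ℂ (L ε) (Metric.ball (u : ℂ) r) ∧
        (∀ z ∈ Metric.ball (u : ℂ) r, Complex.exp (L ε z / ε) = scaledComplexMGF P Y ε z) ∧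
        (∀ x : ℝ, (x : ℂ) ∈ Metric.ball (u : ℂ) r → L ε x = (lmgf P Y ε x : ℝ)) ∧
        ∀ z ∈ Metric.ball (u : ℂ) r, ‖L ε z - H₀ z - ε * H₁ z‖ ≤ B * ε ^ 2 := by
  obtain ⟨R, hR, ε₀, hε₀, hε₀1, A, L, hsub, hL⟩ := hA.exists_local_log hu hu0
  have hmem : ∀ x ∈ Ioo (u - R) (u + R), (x : ℂ) ∈ Metric.ball (u : ℂ) R := by
    intro x hx
    rw [mem_ball_iff_norm, ← Complex.ofReal_sub, Complex.norm_real, Real.norm_eq_abs, abs_lt]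
    constructor <;> linarith [hx.1, hx.2]
  obtain ⟨r, hr, hrR, ε₁, hε₁, hε₁0, B, hB, H₀, H₁, hd₀, hd₁, hH₀, hH₁, hLB⟩ :=
    exists_holomorphic_expansion (L := L) (φ₀ := Λ₀) (φ₁ := Λ₁) (φ₂ := Λ₂) hR hε₀ hε₀1
    (fun ε hε => (hL ε hε).1) (fun ε hε => (hL ε hε).2.1) (by
      intro x hx
      refine ((Complex.isBigO_ofReal_left.mpr (hA.expansion x (hsub hx)))).congr' ?_
        EventuallyEq.rfl
      filter_upwards [Ioo_mem_nhdsGT hε₀] with ε hε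
      rw [(hL ε hε).2.2.2 x (hmem x hx)]
      push_cast; ring)
  have hball := Metric.ball_subset_ball (x := (u : ℂ)) hrR
  refine ⟨r, hr, ε₁, hε₁, B, hB, L, H₀, H₁,
    (Ioo_subset_Ioo (by linarith) (by linarith)).trans hsub, hd₀, hd₁, hH₀, hH₁, fun ε hε => ?_⟩
  have h := hL ε ⟨hε.1, hε.2.trans_le hε₁0⟩
  exact ⟨h.1.mono hball, fun z hz => h.2.2.1 z (hball hz), fun x hx => h.2.2.2 x (hball hx),
    hLB ε hε⟩

/-- Smoothness is inherited from the holomorphic limits `H₀` and `H₁`. For the curvature,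
`iteratedDeriv_two_pos` needs `Re H₀(z) ≤ H₀(Re z)`, the limit of the corresponding inequality for
the moment generating functions. -/
theorem Admissible.regularity (hA : Admissible P Y Λ₀ Λ₁ Λ₂ ReΛ₀) {u : ℝ}
    (hu : u ∈ limitInterior P Y) (hu0 : u ≠ 0) :
    ContDiffAt ℝ 4 Λ₀ u ∧ ContDiffAt ℝ 2 Λ₁ u ∧ 0 < iteratedDeriv 2 Λ₀ u := by
  obtain ⟨r, hr, ε₁, hε₁, B, hB, L, H₀, H₁, hsub, hd₀, hd₁, hH₀, hH₁, hL⟩ :=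
    hA.exists_uniform_expansion hu hu0
  have huc : (u : ℂ) ∈ Metric.ball (u : ℂ) r := Metric.mem_ball_self hr
  refine ⟨by exact_mod_cast contDiffAt_of_real Metric.isOpen_ball hd₀ hH₀ 4 huc,
    by exact_mod_cast contDiffAt_of_real Metric.isOpen_ball hd₁ hH₁ 2 huc, ?_⟩
  refine iteratedDeriv_two_pos hr hd₀ hH₀ ?_
    (hA.strictConvex.subset hsub (convex_Ioo _ _))
  intro z hz
  have hzr : ((z.re : ℝ) : ℂ) ∈ Metric.ball (u : ℂ) r := by
    rw [mem_ball_iff_norm] at hz ⊢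
    refine lt_of_le_of_lt ?_ hz
    rw [← Complex.ofReal_sub, Complex.norm_real, Real.norm_eq_abs]
    have := Complex.abs_re_le_norm (z - u)
    rwa [Complex.sub_re, Complex.ofReal_re] at this
  have hlim : ∀ w ∈ Metric.ball (u : ℂ) r, Tendsto (fun ε : ℝ => L ε w) (𝓝[>] 0) (𝓝 (H₀ w)) := by
    intro w hw
    rw [tendsto_iff_norm_sub_tendsto_zero]
    have h0 : Tendsto (fun ε : ℝ => ε * ‖H₁ w‖ + B * ε ^ 2) (𝓝[>] 0) (𝓝 0) := by
      have : Tendsto (fun ε : ℝ => ε * ‖H₁ w‖ + B * ε ^ 2) (𝓝 0)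
          (𝓝 (0 * ‖H₁ w‖ + B * 0 ^ 2)) := by
        apply Continuous.tendsto; fun_prop
      simp only [zero_mul, ne_eq, OfNat.ofNat_ne_zero, not_false_eq_true, zero_pow, mul_zero,
        add_zero] at this
      exact this.mono_left nhdsWithin_le_nhds
    refine tendsto_of_tendsto_of_tendsto_of_le_of_le' tendsto_const_nhds h0
      (Eventually.of_forall fun _ => norm_nonneg _) ?_
    filter_upwards [Ioo_mem_nhdsGT hε₁] with ε hε
    have h1 := (hL ε hε).2.2.2 w hw
    calc ‖L ε w - H₀ w‖ = ‖ε * H₁ w + (L ε w - H₀ w - ε * H₁ w)‖ := by ring_nf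
      _ ≤ ‖(ε : ℂ) * H₁ w‖ + B * ε ^ 2 := (norm_add_le _ _).trans (by gcongr)
      _ = _ := by rw [norm_mul, Complex.norm_real, Real.norm_eq_abs, abs_of_pos hε.1]
  refine le_of_tendsto_of_tendsto ((Complex.continuous_re.tendsto _).comp (hlim z hz))
    ((Complex.continuous_re.tendsto _).comp (hlim _ hzr)) ?_
  obtain ⟨ε₂, hε₂, hdom, -⟩ := hA.smooth
  filter_upwards [Ioo_mem_nhdsGT hε₁, Ioo_mem_nhdsGT hε₂] with ε hε hε2
  have h1 := norm_scaledComplexMGF_le (P := P) (Y := Y) ε z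
  have hzD : z.re ∈ limitInterior P Y := hsub (by
    rw [mem_ball_iff_norm, ← Complex.ofReal_sub, Complex.norm_real, Real.norm_eq_abs, abs_lt] at hzr
    exact ⟨by linarith [hzr.1], by linarith [hzr.2]⟩)
  rw [← (hL ε hε).2.1 z hz, mgf_eq_exp_lmgf hε.1 (hdom ε hε2 hzD), Complex.norm_exp,
    Complex.div_ofReal_re, Real.exp_le_exp, div_le_div_iff_of_pos_right hε.1] at h1
  simp only [Function.comp]
  rw [(hL ε hε).2.2.1 z.re hzr, Complex.ofReal_re]
  exact h1

end

/-! ### Black-Scholes prices for small total variance -/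

lemma gaussianPDFReal_zero_one (x : ℝ) :
    gaussianPDFReal 0 1 x = (√(2 * Real.pi))⁻¹ * Real.exp (-x ^ 2 / 2) := by
  simp [gaussianPDFReal]

lemma hasDerivAt_normalCdf (x : ℝ) : HasDerivAt normalCdf (gaussianPDFReal 0 1 x) x := by
  have hint : Integrable (gaussianPDFReal 0 1) := integrable_gaussianPDFReal 0 1
  have hcont : Continuous (gaussianPDFReal 0 1) := by
    have : gaussianPDFReal 0 1 = fun x => (√(2 * Real.pi))⁻¹ * Real.exp (-x ^ 2 / 2) :=
      funext gaussianPDFReal_zero_one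
    rw [this]; fun_prop
  have h1 : ∀ y, normalCdf y = ∫ z in Iic y, gaussianPDFReal 0 1 z := by
    intro y
    rw [normalCdf, cdf_eq_real, Measure.real, gaussianReal_apply_eq_integral 0 one_ne_zero,
      ENNReal.toReal_ofReal]
    exact integral_nonneg fun z => gaussianPDFReal_nonneg 0 1 z
  have h2 : normalCdf = fun y => normalCdf 0 + ∫ z in (0 : ℝ)..y, gaussianPDFReal 0 1 z := by
    ext y
    rw [h1 y, h1 0, ← intervalIntegral.integral_Iic_sub_Iic hint.integrableOn hint.integrableOn]
    ring
  rw [h2]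
  exact (intervalIntegral.integral_hasDerivAt_right (hcont.intervalIntegrable _ _)
    hcont.stronglyMeasurable.stronglyMeasurableAtFilter hcont.continuousAt).const_add _

lemma normalCdf_neg (x : ℝ) : normalCdf (-x) = 1 - normalCdf x := by
  have hd : ∀ y, HasDerivAt (fun y => normalCdf y + normalCdf (-y)) 0 y := by
    intro y
    have h1 := (hasDerivAt_normalCdf (-y)).scomp y (hasDerivAt_neg y)
    convert! (hasDerivAt_normalCdf y).add h1 using 1
    simp [gaussianPDFReal_zero_one]
  have hconst := is_const_of_deriv_eq_zero (fun y => (hd y).differentiableAt) (fun y => (hd y).deriv)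
  have hlim : Tendsto (fun y => normalCdf y + normalCdf (-y)) atTop (𝓝 (1 + 0)) :=
    (tendsto_cdf_atTop _).add ((tendsto_cdf_atBot _).comp tendsto_neg_atTop_atBot)
  have h2 : Tendsto (fun y => normalCdf y + normalCdf (-y)) atTop
      (𝓝 (normalCdf x + normalCdf (-x))) :=
    tendsto_const_nhds.congr fun y => hconst x y
  have := tendsto_nhds_unique hlim h2
  linarith

lemma bsPut_eq (θ k σ : ℝ) : bsPut θ k σ = bsCall θ k σ + Real.exp k - 1 := by
  rw [bsPut, bsCall, normalCdf_neg, normalCdf_neg]; ring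

/-- The Black-Scholes price of the out-of-the-money option as a function of the total standard
deviation `s`. -/
noncomputable def bsOtm (k s : ℝ) : ℝ :=
  if 0 < k then normalCdf (-k / s + s / 2) - Real.exp k * normalCdf (-k / s - s / 2)
  else Real.exp k * normalCdf (-(-k / s - s / 2)) - normalCdf (-(-k / s + s / 2))

lemma bsCall_eq_bsOtm {k : ℝ} (hk : 0 < k) (θ σ : ℝ) : bsCall θ k σ = bsOtm k (σ * √θ) := by
  rw [bsOtm, if_pos hk]; rfl

lemma bsPut_eq_bsOtm {k : ℝ} (hk : k < 0) (θ σ : ℝ) : bsPut θ k σ = bsOtm k (σ * √θ) := by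
  rw [bsOtm, if_neg hk.not_gt]; rfl

/-- The exponent `-d₊² / 2` of the Gaussian density. -/
noncomputable def bsExponent (k s : ℝ) : ℝ := -k ^ 2 / (2 * s ^ 2) + k / 2 - s ^ 2 / 8

/-- With `φ` the Gaussian density, `φ(d₊) = e^k φ(d₋)`, so the `k / s²` terms cancel and one
Gaussian density remains. Call and put differ by a constant in `s`, so one computation serves both
signs of `k`. -/
lemma hasDerivAt_bsOtm (k : ℝ) {s : ℝ} (hs : 0 < s) :
    HasDerivAt (bsOtm k) ((√(2 * Real.pi))⁻¹ * Real.exp (bsExponent k s)) s := by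
  have hp : HasDerivAt (fun s : ℝ => -k / s + s / 2) (k / s ^ 2 + 1 / 2) s := by
    have h1 := ((hasDerivAt_inv hs.ne').const_mul (-k)).add ((hasDerivAt_id s).div_const 2)
    convert! h1 using 1
    field_simp
  have hm : HasDerivAt (fun s : ℝ => -k / s - s / 2) (k / s ^ 2 - 1 / 2) s := by
    have h1 := ((hasDerivAt_inv hs.ne').const_mul (-k)).sub ((hasDerivAt_id s).div_const 2)
    convert! h1 using 1
    field_simp
  have e1 : gaussianPDFReal 0 1 (-k / s + s / 2)
      = (√(2 * Real.pi))⁻¹ * Real.exp (bsExponent k s) := by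
    rw [gaussianPDFReal_zero_one, bsExponent]
    congr 2
    field_simp; ring
  have e2 : Real.exp k * gaussianPDFReal 0 1 (-k / s - s / 2)
      = (√(2 * Real.pi))⁻¹ * Real.exp (bsExponent k s) := by
    rw [gaussianPDFReal_zero_one, bsExponent, mul_left_comm, ← Real.exp_add]
    congr 2
    field_simp; ring
  have hcall : HasDerivAt (fun s => normalCdf (-k / s + s / 2)
      - Real.exp k * normalCdf (-k / s - s / 2))
      ((√(2 * Real.pi))⁻¹ * Real.exp (bsExponent k s)) s := by
    have h1 := ((hasDerivAt_normalCdf _).comp s hp).sub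
      (((hasDerivAt_normalCdf _).comp s hm).const_mul (Real.exp k))
    convert! h1 using 1
    rw [← mul_assoc, e1, e2]; ring
  have h2 : bsOtm k = fun s => (normalCdf (-k / s + s / 2)
      - Real.exp k * normalCdf (-k / s - s / 2)) + if 0 < k then 0 else Real.exp k - 1 := by
    ext s
    rw [bsOtm]
    split_ifs
    · ring
    · rw [normalCdf_neg, normalCdf_neg]; ring
  rw [h2]
  exact hcall.add_const _

lemma tendsto_bsOtm {k : ℝ} (hk : k ≠ 0) : Tendsto (bsOtm k) (𝓝[>] 0) (𝓝 0) := by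
  have hid : Tendsto (fun s : ℝ => s / 2) (𝓝[>] 0) (𝓝 0) := by
    have : Tendsto (fun s : ℝ => s / 2) (𝓝 0) (𝓝 (0 / 2)) := by
      apply Continuous.tendsto; fun_prop
    rw [zero_div] at this
    exact this.mono_left nhdsWithin_le_nhds
  rcases lt_or_gt_of_ne hk with h | h
  · have h1 : Tendsto (fun s : ℝ => -(-k / s)) (𝓝[>] 0) atBot := by
      have h0 : Tendsto (fun s : ℝ => -k * s⁻¹) (𝓝[>] 0) atTop :=
        tendsto_inv_nhdsGT_zero.const_mul_atTop (by linarith)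
      exact (tendsto_neg_atTop_atBot.comp h0).congr fun s => by simp [div_eq_mul_inv]
    have h2 : Tendsto (fun s : ℝ => -(-k / s - s / 2)) (𝓝[>] 0) atBot := by
      convert! h1.atBot_add hid using 2; ring
    have h3 : Tendsto (fun s : ℝ => -(-k / s + s / 2)) (𝓝[>] 0) atBot := by
      convert! h1.atBot_add hid.neg using 2; ring
    have := (((tendsto_cdf_atBot (gaussianReal 0 1)).comp h2).const_mul (Real.exp k)).sub
      ((tendsto_cdf_atBot (gaussianReal 0 1)).comp h3)
    simp only [mul_zero, sub_zero] at this
    refine this.congr fun s => ?_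
    rw [bsOtm, if_neg h.not_gt]; rfl
  · have h1 : Tendsto (fun s : ℝ => -k / s) (𝓝[>] 0) atBot := by
      simp only [div_eq_mul_inv]
      exact tendsto_inv_nhdsGT_zero.const_mul_atTop_of_neg (by linarith)
    have h2 : Tendsto (fun s : ℝ => -k / s - s / 2) (𝓝[>] 0) atBot := by
      exact (h1.atBot_add hid.neg).congr fun s => by ring
    have h3 : Tendsto (fun s : ℝ => -k / s + s / 2) (𝓝[>] 0) atBot := by
      exact h1.atBot_add hid
    have := ((tendsto_cdf_atBot (gaussianReal 0 1)).comp h3).sub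
      (((tendsto_cdf_atBot (gaussianReal 0 1)).comp h2).const_mul (Real.exp k))
    simp only [mul_zero, sub_zero] at this
    refine this.congr fun s => ?_
    rw [bsOtm, if_pos h]; rfl

lemma strictMonoOn_bsOtm (k : ℝ) : StrictMonoOn (bsOtm k) (Ioi 0) := by
  apply strictMonoOn_of_deriv_pos (convex_Ioi 0)
  · exact fun s hs => (hasDerivAt_bsOtm k hs).continuousAt.continuousWithinAt
  · intro s hs
    rw [interior_Ioi] at hs
    rw [(hasDerivAt_bsOtm k hs).deriv]
    positivity

lemma nonneg_of_deriv_nonneg_of_tendsto {f f' : ℝ → ℝ} {s₀ : ℝ}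
    (hd : ∀ s ∈ Ioo 0 s₀, HasDerivAt f (f' s) s) (hf' : ∀ s ∈ Ioo 0 s₀, 0 ≤ f' s)
    (hlim : Tendsto f (𝓝[>] 0) (𝓝 0)) {s : ℝ} (hs : s ∈ Ioo 0 s₀) : 0 ≤ f s := by
  have hmono : MonotoneOn f (Ioo 0 s₀) := by
    apply monotoneOn_of_deriv_nonneg (convex_Ioo _ _)
    · exact fun x hx => (hd x hx).continuousAt.continuousWithinAt
    · rw [interior_Ioo]
      exact fun x hx => (hd x hx).differentiableAt.differentiableWithinAt
    · rw [interior_Ioo]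
      intro x hx
      rw [(hd x hx).deriv]; exact hf' x hx
  refine le_of_tendsto hlim ?_
  filter_upwards [Ioo_mem_nhdsGT hs.1] with x hx
  exact hmono ⟨hx.1, hx.2.trans hs.2⟩ hs hx.2.le

lemma abs_log_sub_le {y : ℝ} (hy : 1 / 2 ≤ y) : |Real.log y - (y - 1)| ≤ 2 * (y - 1) ^ 2 := by
  have h1 := Real.log_le_sub_one_of_pos (show 0 < y by linarith)
  have h2 := Real.one_sub_inv_le_log_of_pos (show 0 < y by linarith)
  have h3 : y - 1 - 2 * (y - 1) ^ 2 ≤ 1 - y⁻¹ := by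
    have : 1 - y⁻¹ - (y - 1 - 2 * (y - 1) ^ 2) = (y - 1) ^ 2 * (2 * y - 1) / y := by
      field_simp; ring
    have h4 : 0 ≤ (y - 1) ^ 2 * (2 * y - 1) / y := by
      apply div_nonneg (mul_nonneg (sq_nonneg _) (by linarith)) (by linarith)
    linarith
  rw [abs_le]
  constructor
  · linarith
  · have := sq_nonneg (y - 1)
    linarith

/-- Comparison function for the price: leading order times a polynomial correction. -/
noncomputable def bsCompare (k c s : ℝ) : ℝ :=
  (√(2 * Real.pi))⁻¹ * Real.exp (bsExponent k s) * (s ^ 3 / k ^ 2) * (1 - 3 * s ^ 2 / k ^ 2 + c * s ^ 4)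

/-- The coefficient `-3 / k²` is chosen so that the derivative agrees with that of `bsOtm` up to
relative order `s⁴`. The sign of the discrepancy for small `s` is then decided by `c`. -/
lemma hasDerivAt_bsCompare {k : ℝ} (hk : k ≠ 0) (c : ℝ) {s : ℝ} (hs : 0 < s) :
    HasDerivAt (bsCompare k c) ((√(2 * Real.pi))⁻¹ * Real.exp (bsExponent k s) *
      (1 + s ^ 4 * (c - (1 / (4 * k ^ 2) + 15 / k ^ 4) +
        s ^ 2 * (3 / (4 * k ^ 4) + 7 * c / k ^ 2 - c * s ^ 2 / (4 * k ^ 2))))) s := by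
  have hq : HasDerivAt (bsExponent k) (k ^ 2 / s ^ 3 - s / 4) s := by
    have h1 : HasDerivAt (fun s : ℝ => (s ^ 2)⁻¹) (-(2 * s) / (s ^ 2) ^ 2) s := by
      have := (hasDerivAt_pow 2 s).inv (by positivity)
      convert! this using 1; simp
    have h2 := ((h1.const_mul (-k ^ 2 / 2)).add_const (k / 2)).sub
      ((hasDerivAt_pow 2 s).div_const 8)
    have h3 : bsExponent k = fun s : ℝ => -k ^ 2 / 2 * (s ^ 2)⁻¹ + k / 2 - s ^ 2 / 8 := by
      ext x; rw [bsExponent, div_mul_eq_div_div]; ring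
    rw [h3]
    convert! h2 using 1
    field_simp; ring
  have hpoly : HasDerivAt (fun s : ℝ => 1 - 3 * s ^ 2 / k ^ 2 + c * s ^ 4)
      (-(3 * (2 * s) / k ^ 2) + c * (4 * s ^ 3)) s := by
    have := ((((hasDerivAt_pow 2 s).const_mul 3).div_const (k ^ 2)).const_sub 1).add
      ((hasDerivAt_pow 4 s).const_mul c)
    convert! this using 1; simp
  have h := ((hq.exp.const_mul (√(2 * Real.pi))⁻¹).mul
    ((hasDerivAt_pow 3 s).div_const (k ^ 2))).mul hpoly
  convert! h using 1
  simp only [Pi.mul_apply]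
  field_simp
  ring

lemma tendsto_bsCompare (k c : ℝ) : Tendsto (bsCompare k c) (𝓝[>] 0) (𝓝 0) := by
  have h1 : Tendsto (fun s : ℝ => |(√(2 * Real.pi))⁻¹ * Real.exp (k / 2) * (s ^ 3 / k ^ 2) *
      (1 - 3 * s ^ 2 / k ^ 2 + c * s ^ 4)|) (𝓝[>] 0) (𝓝 0) := by
    have : Tendsto (fun s : ℝ => |(√(2 * Real.pi))⁻¹ * Real.exp (k / 2) * (s ^ 3 / k ^ 2) *
      (1 - 3 * s ^ 2 / k ^ 2 + c * s ^ 4)|) (𝓝 0)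
      (𝓝 |(√(2 * Real.pi))⁻¹ * Real.exp (k / 2) * (0 ^ 3 / k ^ 2) *
      (1 - 3 * 0 ^ 2 / k ^ 2 + c * 0 ^ 4)|) := by
      apply Continuous.tendsto; fun_prop
    simp only [ne_eq, OfNat.ofNat_ne_zero, not_false_eq_true, zero_pow, zero_div, mul_zero,
      zero_mul, abs_zero] at this
    exact this.mono_left nhdsWithin_le_nhds
  refine squeeze_zero_norm (fun s => ?_) h1
  rw [Real.norm_eq_abs, bsCompare]
  simp only [abs_mul, abs_of_pos (Real.exp_pos _)]
  gcongr
  rw [bsExponent]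
  have h2 : -k ^ 2 / (2 * s ^ 2) ≤ 0 := by
    rw [neg_div]; simp only [Left.neg_nonpos_iff]; positivity
  have h3 := sq_nonneg s
  linarith

/-- The logarithm of the out-of-the-money Black-Scholes price for small total variance. -/
theorem log_bsOtm_expansion {k : ℝ} (hk : k ≠ 0) :
    ∃ s₀ > 0, ∃ C : ℝ, ∀ s ∈ Ioo 0 s₀, 0 < bsOtm k s ∧
      |Real.log (bsOtm k s) - (bsExponent k s + 3 * Real.log s - Real.log (k ^ 2 * √(2 * Real.pi))
        - 3 * s ^ 2 / k ^ 2)| ≤ C * s ^ 4 := by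
  have hk2 : 0 < k ^ 2 := by positivity
  -- One more than the critical value of `c`: with `c = K` the comparison function grows faster than
  -- the price, with `c = -K` more slowly. Both vanish at `0`, so they enclose the price.
  set K : ℝ := 1 / (4 * k ^ 2) + 15 / k ^ 4 + 1 with hK
  have hK0 : 0 < K := by positivity
  have hsmall : ∀ c : ℝ, ∀ᶠ s in 𝓝[>] (0 : ℝ),
      |s ^ 2 * (3 / (4 * k ^ 4) + 7 * c / k ^ 2 - c * s ^ 2 / (4 * k ^ 2))| < 1 := by
    intro c
    have : Tendsto (fun s : ℝ =>
        |s ^ 2 * (3 / (4 * k ^ 4) + 7 * c / k ^ 2 - c * s ^ 2 / (4 * k ^ 2))|) (𝓝 0)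
        (𝓝 |0 ^ 2 * (3 / (4 * k ^ 4) + 7 * c / k ^ 2 - c * 0 ^ 2 / (4 * k ^ 2))|) := by
      apply Continuous.tendsto; fun_prop
    simp only [ne_eq, OfNat.ofNat_ne_zero, not_false_eq_true, zero_pow, zero_mul, abs_zero] at this
    exact (this.mono_left nhdsWithin_le_nhds).eventually (Iio_mem_nhds one_pos)
  have hsmall2 : ∀ᶠ s in 𝓝[>] (0 : ℝ), 3 * s ^ 2 / k ^ 2 + K * s ^ 4 < 1 / 2 := by
    have : Tendsto (fun s : ℝ => 3 * s ^ 2 / k ^ 2 + K * s ^ 4) (𝓝 0)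
        (𝓝 (3 * 0 ^ 2 / k ^ 2 + K * 0 ^ 4)) := by
      apply Continuous.tendsto; fun_prop
    simp only [ne_eq, OfNat.ofNat_ne_zero, not_false_eq_true, zero_pow, mul_zero, zero_div,
      add_zero] at this
    exact (this.mono_left nhdsWithin_le_nhds).eventually (Iio_mem_nhds (by norm_num))
  obtain ⟨s₀, hs₀, hs₀'⟩ := mem_nhdsGT_iff_exists_Ioo_subset.mp
    ((hsmall K).and ((hsmall (-K)).and (hsmall2.and (Ioo_mem_nhdsGT one_pos))))
  refine ⟨s₀, hs₀, K + 2 * (3 / k ^ 2 + K) ^ 2, fun s hs => ?_⟩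
  have hup : bsOtm k s ≤ bsCompare k K s := by
    have := nonneg_of_deriv_nonneg_of_tendsto (s₀ := s₀)
      (fun x hx => (hasDerivAt_bsCompare hk K hx.1).sub (hasDerivAt_bsOtm k hx.1)) (fun x hx => by
        have h1 := (abs_lt.mp (hs₀' hx).1).1
        rw [show ∀ a b : ℝ, a * b - a = a * (b - 1) by intros; ring]
        apply mul_nonneg (by positivity)
        rw [add_sub_cancel_left]
        apply mul_nonneg (pow_nonneg hx.1.le 4)
        rw [hK] at h1 ⊢; linarith)
      (by have := (tendsto_bsCompare k K).sub (tendsto_bsOtm hk); rwa [sub_zero] at this) hs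
    simp only [Pi.sub_apply] at this
    linarith
  have hlow : bsCompare k (-K) s ≤ bsOtm k s := by
    have := nonneg_of_deriv_nonneg_of_tendsto (s₀ := s₀)
      (fun x hx => (hasDerivAt_bsOtm k hx.1).sub (hasDerivAt_bsCompare hk (-K) hx.1)) (fun x hx => by
        have h1 := (abs_lt.mp (hs₀' hx).2.1).2
        rw [show ∀ a b : ℝ, a - a * b = a * (1 - b) by intros; ring]
        apply mul_nonneg (by positivity)
        rw [sub_add_cancel_left, ← mul_neg]
        apply mul_nonneg (pow_nonneg hx.1.le 4)
        have h5 : 0 < 1 / (4 * k ^ 2) + 15 / k ^ 4 := by positivity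
        rw [hK] at h1 ⊢; linarith)
      (by have := (tendsto_bsOtm hk).sub (tendsto_bsCompare k (-K)); rwa [sub_zero] at this) hs
    simp only [Pi.sub_apply] at this
    linarith
  obtain ⟨-, -, hh, hs1⟩ := hs₀' hs
  have hh : 3 * s ^ 2 / k ^ 2 + K * s ^ 4 < 1 / 2 := hh
  have hs1 : s < 1 := hs1.2
  set b : ℝ := (√(2 * Real.pi))⁻¹ * Real.exp (bsExponent k s) * (s ^ 3 / k ^ 2) with hb
  have hs0 : 0 < s := hs.1
  have hb0 : 0 < b := by positivity
  have hs4 : 0 ≤ K * s ^ 4 := by positivity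
  have hs2 : 0 ≤ 3 * s ^ 2 / k ^ 2 := by positivity
  set y : ℝ := bsOtm k s / b with hy
  have hyl : 1 - 3 * s ^ 2 / k ^ 2 - K * s ^ 4 ≤ y := by
    rw [hy, le_div_iff₀ hb0]
    refine le_trans (le_of_eq ?_) hlow
    rw [bsCompare]; ring
  have hyu : y ≤ 1 - 3 * s ^ 2 / k ^ 2 + K * s ^ 4 := by
    rw [hy, div_le_iff₀ hb0]
    refine hup.trans (le_of_eq ?_)
    rw [bsCompare]; ring
  have hB : bsOtm k s = b * y := by rw [hy]; field_simp
  have hy0 : 1 / 2 ≤ y := by linarith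
  refine ⟨by rw [hB]; positivity, ?_⟩
  have hlogb : Real.log b = bsExponent k s + 3 * Real.log s - Real.log (k ^ 2 * √(2 * Real.pi)) := by
    have : b = Real.exp (bsExponent k s) * s ^ 3 / (k ^ 2 * √(2 * Real.pi)) := by
      rw [hb]; field_simp
    rw [this, Real.log_div (by positivity) (by positivity), Real.log_mul (by positivity)
      (by positivity), Real.log_exp, Real.log_pow]
    norm_num
  rw [hB, Real.log_mul hb0.ne' (by linarith), hlogb]
  have h1 := abs_log_sub_le hy0
  have h2 : (y - 1) ^ 2 ≤ (3 / k ^ 2 + K) ^ 2 * s ^ 4 := by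
    have h3 : |y - 1| ≤ (3 / k ^ 2 + K) * s ^ 2 := by
      have h4 : s ^ 4 ≤ s ^ 2 := pow_le_pow_of_le_one hs0.le hs1.le (by norm_num)
      have h5 : 3 * s ^ 2 / k ^ 2 + K * s ^ 4 ≤ (3 / k ^ 2 + K) * s ^ 2 := by
        have h7 := mul_le_mul_of_nonneg_left h4 hK0.le
        have h8 : (3 / k ^ 2 + K) * s ^ 2 = 3 * s ^ 2 / k ^ 2 + K * s ^ 2 := by ring
        rw [h8]; linarith
      rw [abs_le]; constructor <;> linarith
    calc (y - 1) ^ 2 = |y - 1| ^ 2 := (sq_abs _).symm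
      _ ≤ ((3 / k ^ 2 + K) * s ^ 2) ^ 2 := by gcongr
      _ = _ := by ring
  have h6 : |y - 1 + 3 * s ^ 2 / k ^ 2| ≤ K * s ^ 4 := by
    rw [abs_le]; constructor <;> linarith
  calc _ = |(Real.log y - (y - 1)) + (y - 1 + 3 * s ^ 2 / k ^ 2)| := by congr 1; ring
    _ ≤ 2 * ((3 / k ^ 2 + K) ^ 2 * s ^ 4) + K * s ^ 4 :=
        (abs_add_le _ _).trans (add_le_add
          (h1.trans (mul_le_mul_of_nonneg_left h2 zero_le_two)) h6)
    _ = _ := by ring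

/-! ### From price asymptotics to implied volatility -/

lemma isBigO_pow_of_eq_mul {f g : ℝ → ℝ} {n : ℕ} (hg : ContinuousAt g 0)
    (h : ∀ᶠ ε in 𝓝[>] (0 : ℝ), f ε = g ε * ε ^ n) : f =O[𝓝[>] 0] fun ε => ε ^ n := by
  have h1 : (fun ε => g ε * ε ^ n) =O[𝓝[>] 0] fun ε : ℝ => (1 : ℝ) * ε ^ n :=
    ((hg.tendsto.mono_left nhdsWithin_le_nhds).isBigO_one ℝ).mul (isBigO_refl _ _)
  exact (h1.congr' (h.mono fun _ hx => hx.symm) (Eventually.of_forall fun _ => one_mul _))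

/-- The expansion of `log bsOtm` as a function of `ε` and of the variance `w`. -/
noncomputable def logBsApprox (k τ ε w : ℝ) : ℝ :=
  -k ^ 2 / (2 * τ * ε * w) + k / 2 + 3 / 2 * (Real.log ε + Real.log (τ * w))
    - Real.log (k ^ 2 * √(2 * Real.pi)) - (1 / 8 + 3 / k ^ 2) * τ * ε * w

lemma logBsApprox_eq {k τ ε w : ℝ} (hτ : 0 < τ) (hε : 0 < ε) (hw : 0 < w) :
    logBsApprox k τ ε w = bsExponent k (√(ε * τ * w)) + 3 * Real.log (√(ε * τ * w))
      - Real.log (k ^ 2 * √(2 * Real.pi)) - 3 * √(ε * τ * w) ^ 2 / k ^ 2 := by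
  have h0 : 0 < ε * τ * w := by positivity
  rw [logBsApprox, bsExponent, Real.sq_sqrt h0.le, Real.log_sqrt h0.le, mul_assoc ε τ w,
    Real.log_mul hε.ne' (by positivity)]
  have : -k ^ 2 / (2 * τ * ε * w) = -k ^ 2 / (2 * (ε * (τ * w))) := by congr 1; ring
  rw [this]; ring

/-- The term `-k² / (2 τ ε w)` increases in `w` at rate at least `2 c / ε` on the interval, the
worst point being `2 w₀`. Half of this pays for the decreasing linear term; the logarithm only
helps. The growth `1 / ε` is what turns `O(ε²)` in the log-price into `O(ε³)` in the variance. -/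
lemma logBsApprox_sub_le {k τ : ℝ} (hk : k ≠ 0) (hτ : 0 < τ) {w₀ : ℝ} (hw₀ : 0 < w₀) :
    ∃ c > 0, ∃ δ > 0, ∀ ε ∈ Ioo 0 δ, ∀ w ∈ Icc (w₀ / 2) (2 * w₀), ∀ w' ∈ Icc (w₀ / 2) (2 * w₀),
      w ≤ w' → c * (w' - w) / ε ≤ logBsApprox k τ ε w' - logBsApprox k τ ε w := by
  have hk2 : 0 < k ^ 2 := by positivity
  set c := k ^ 2 / (16 * τ * w₀ ^ 2) with hc
  have hc0 : 0 < c := by positivity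
  set d := (1 / 8 + 3 / k ^ 2) * τ with hd
  have hd0 : 0 < d := by positivity
  refine ⟨c, hc0, min 1 (c / d), lt_min one_pos (by positivity), ?_⟩
  intro ε hε w hw w' hw' hww
  have hε0 := hε.1
  have hw0 : 0 < w := by linarith [hw.1]
  have hw0' : 0 < w' := by linarith [hw'.1]
  have h1 : Real.log (τ * w) ≤ Real.log (τ * w') := Real.log_le_log (by positivity) (by gcongr)
  have h2 : 2 * c * (w' - w) / ε ≤ -k ^ 2 / (2 * τ * ε * w') - -k ^ 2 / (2 * τ * ε * w) := by
    have e : -k ^ 2 / (2 * τ * ε * w') - -k ^ 2 / (2 * τ * ε * w)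
        = k ^ 2 / (2 * τ * (w * w')) * ((w' - w) / ε) := by field_simp; ring
    rw [e, mul_div_assoc]
    have h3 : 2 * c ≤ k ^ 2 / (2 * τ * (w * w')) := by
      rw [hc, show 2 * (k ^ 2 / (16 * τ * w₀ ^ 2)) = k ^ 2 / (2 * τ * (2 * w₀ * (2 * w₀))) by
        field_simp; ring]
      have := hw.2
      have := hw'.2
      gcongr
    have h4 : 0 ≤ (w' - w) / ε := div_nonneg (by linarith) hε0.le
    gcongr
  have h5 : d * ε * (w' - w) ≤ c * (w' - w) / ε := by
    rw [le_div_iff₀ hε0]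
    have h6 : d * ε ≤ c := by
      have := hε.2.le.trans (min_le_right _ _)
      rwa [le_div_iff₀ hd0, mul_comm] at this
    have h7 : ε ≤ 1 := hε.2.le.trans (min_le_left _ _)
    have h8 : d * ε * ε ≤ c := by nlinarith
    nlinarith
  have e : logBsApprox k τ ε w' - logBsApprox k τ ε w =
      (-k ^ 2 / (2 * τ * ε * w') - -k ^ 2 / (2 * τ * ε * w))
        + 3 / 2 * (Real.log (τ * w') - Real.log (τ * w)) - d * ε * (w' - w) := by
    rw [logBsApprox, logBsApprox, hd]; ring
  rw [e]
  have : 2 * c * (w' - w) / ε = c * (w' - w) / ε + c * (w' - w) / ε := by ring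
  linarith

/-- Along the polynomial with the implied volatility coefficients, the Black-Scholes expansion
matches a given expansion of the logarithm of the price. -/
lemma logBsApprox_polynomial {k τ I q₁ q₂ w₀ w₁ w₂ : ℝ} (hk : k ≠ 0) (hτ : 0 < τ) (hw₀ : 0 < w₀)
    (hI : I = k ^ 2 / (2 * τ * w₀))
    (h₁ : w₁ = 2 * τ * w₀ ^ 2 / k ^ 2 *
      (q₁ - k / 2 - 3 / 2 * Real.log (τ * w₀) + Real.log (k ^ 2 * √(2 * Real.pi))))
    (h₂ : w₂ = w₁ ^ 2 / w₀ + 2 * τ * w₀ ^ 2 / k ^ 2 *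
      (q₂ + (1 / 8 + 3 / k ^ 2) * τ * w₀ - 3 / 2 * (w₁ / w₀))) :
    (fun ε => logBsApprox k τ ε (w₀ + w₁ * ε + w₂ * ε ^ 2)
      - (-I / ε + 3 / 2 * Real.log ε + q₁ + q₂ * ε)) =O[𝓝[>] 0] fun ε => ε ^ 2 := by
  set w : ℝ → ℝ := fun ε => w₀ + w₁ * ε + w₂ * ε ^ 2 with hw
  have hwc : Continuous w := by fun_prop
  have hw00 : w 0 = w₀ := by simp [hw]
  have hwpos : ∀ᶠ ε in 𝓝[>] (0 : ℝ), w₀ / 2 < w ε := by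
    have : Tendsto w (𝓝 0) (𝓝 w₀) := by rw [← hw00]; exact hwc.tendsto 0
    exact (this.mono_left nhdsWithin_le_nhds).eventually (Ioi_mem_nhds (by linarith))
  -- The reciprocal of `w` must be expanded with error `ε³`, because the prefactor carries `1 / ε`.
  have hA : (fun ε => -k ^ 2 / (2 * τ * ε) * ((w ε)⁻¹ - w₀⁻¹ + w₁ * ε / w₀ ^ 2
      - (w₁ ^ 2 / w₀ ^ 3 - w₂ / w₀ ^ 2) * ε ^ 2)) =O[𝓝[>] 0] fun ε => ε ^ 2 := by
    refine isBigO_pow_of_eq_mul (g := fun ε => -k ^ 2 / (2 * τ) *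
      (2 * w₀ * w₁ * w₂ - w₁ ^ 3 - w₂ * (w₁ ^ 2 - w₂ * w₀) * ε) / (w ε * w₀ ^ 3)) ?_ ?_
    · have : w 0 * w₀ ^ 3 ≠ 0 := by rw [hw00]; positivity
      fun_prop (disch := exact this)
    · filter_upwards [hwpos, self_mem_nhdsWithin] with ε h1 h2
      have h3 : w ε ≠ 0 := by linarith
      have h4 : ε ≠ 0 := ne_of_gt h2
      have e : (w ε)⁻¹ - w₀⁻¹ + w₁ * ε / w₀ ^ 2 - (w₁ ^ 2 / w₀ ^ 3 - w₂ / w₀ ^ 2) * ε ^ 2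
          = ε ^ 3 * (2 * w₀ * w₁ * w₂ - w₁ ^ 3 - w₂ * (w₁ ^ 2 - w₂ * w₀) * ε) / (w ε * w₀ ^ 3) := by
        rw [eq_div_iff (by positivity)]
        field_simp
        simp only [hw]
        ring
      rw [e]
      field_simp
  have hB : (fun ε => 3 / 2 * (Real.log (w ε / w₀) - w₁ * ε / w₀)) =O[𝓝[>] 0]
      fun ε => ε ^ 2 := by
    have h1 : (fun ε => Real.log (w ε / w₀) - (w ε / w₀ - 1)) =O[𝓝[>] 0] fun ε => ε ^ 2 := by
      have h2 : (fun ε => 2 * (w ε / w₀ - 1) ^ 2) =O[𝓝[>] 0] fun ε => ε ^ 2 := by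
        refine isBigO_pow_of_eq_mul (g := fun ε => 2 * ((w₁ + w₂ * ε) / w₀) ^ 2) ?_ ?_
        · fun_prop
        · refine Eventually.of_forall fun ε => ?_
          simp only [hw]; field_simp; ring
      refine (IsBigO.of_bound 1 ?_).trans h2
      filter_upwards [hwpos] with ε h3
      rw [one_mul, Real.norm_eq_abs, Real.norm_eq_abs]
      refine (abs_log_sub_le ?_).trans (le_abs_self _)
      rw [le_div_iff₀ hw₀]; linarith
    have h2 : (fun ε => w ε / w₀ - 1 - w₁ * ε / w₀) =O[𝓝[>] 0] fun ε => ε ^ 2 := by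
      refine isBigO_pow_of_eq_mul (g := fun ε => w₂ / w₀) continuousAt_const ?_
      refine Eventually.of_forall fun ε => ?_
      simp only [hw]; field_simp; ring
    exact ((h1.add h2).congr_left fun ε => by ring).const_mul_left _
  have hC : (fun ε => (1 / 8 + 3 / k ^ 2) * τ * ε * (w ε - w₀)) =O[𝓝[>] 0] fun ε => ε ^ 2 := by
    refine isBigO_pow_of_eq_mul (g := fun ε => (1 / 8 + 3 / k ^ 2) * τ * (w₁ + w₂ * ε)) ?_ ?_
    · fun_prop
    · refine Eventually.of_forall fun ε => ?_
      simp only [hw]; ring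
  refine ((hA.add hB).sub hC).congr' ?_ EventuallyEq.rfl
  filter_upwards [hwpos, self_mem_nhdsWithin] with ε h1 h2
  have h3 : 0 < w ε := by linarith
  have h4 : 0 < ε := h2
  have e1 : Real.log (τ * w ε) = Real.log (τ * w₀) + Real.log (w ε / w₀) := by
    rw [← Real.log_mul (by positivity) (by positivity)]
    congr 1; field_simp
  have e2 : q₁ = k ^ 2 / (2 * τ * w₀ ^ 2) * w₁ + k / 2 + 3 / 2 * Real.log (τ * w₀)
      - Real.log (k ^ 2 * √(2 * Real.pi)) := by
    rw [h₁]; field_simp; ring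
  have e3 : q₂ = k ^ 2 / (2 * τ * w₀ ^ 2) * (w₂ - w₁ ^ 2 / w₀) - (1 / 8 + 3 / k ^ 2) * τ * w₀
      + 3 / 2 * (w₁ / w₀) := by
    rw [h₂]; field_simp; ring
  change _ = logBsApprox k τ ε (w ε) - _
  rw [logBsApprox, e1, e2, e3, hI]
  generalize w ε = W at h3
  have h5 : W ≠ 0 := h3.ne'
  field_simp
  ring

/-- If the logarithm of an out-of-the-money price has an expansion as in the large deviations
regime, then the implied volatility exists, is unique, and its square has an expansion. -/
theorem smileExpansion_bsOtm {k τ I q₁ q₂ w₀ w₁ w₂ : ℝ} {price : ℝ → ℝ} (hk : k ≠ 0) (hτ : 0 < τ)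
    (hw₀ : 0 < w₀) (hI : I = k ^ 2 / (2 * τ * w₀))
    (h₁ : w₁ = 2 * τ * w₀ ^ 2 / k ^ 2 *
      (q₁ - k / 2 - 3 / 2 * Real.log (τ * w₀) + Real.log (k ^ 2 * √(2 * Real.pi))))
    (h₂ : w₂ = w₁ ^ 2 / w₀ + 2 * τ * w₀ ^ 2 / k ^ 2 *
      (q₂ + (1 / 8 + 3 / k ^ 2) * τ * w₀ - 3 / 2 * (w₁ / w₀)))
    (hpos : ∀ᶠ ε in 𝓝[>] (0 : ℝ), 0 < price ε)
    (hlog : (fun ε => Real.log (price ε) - (-I / ε + 3 / 2 * Real.log ε + q₁ + q₂ * ε))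
      =O[𝓝[>] 0] fun ε => ε ^ 2) :
    SmileExpansion (fun ε σ => bsOtm k (σ * √(ε * τ))) price w₀ w₁ w₂ := by
  set w : ℝ → ℝ := fun ε => w₀ + w₁ * ε + w₂ * ε ^ 2 with hw
  obtain ⟨c, hc, δ, hδ, hcδ⟩ := logBsApprox_sub_le hk hτ hw₀
  obtain ⟨C₁, hC₁⟩ := (logBsApprox_polynomial hk hτ hw₀ hI h₁ h₂).bound
  obtain ⟨C₂, hC₂⟩ := hlog.bound
  obtain ⟨s₀, hs₀, C₃, hC₃⟩ := log_bsOtm_expansion hk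
  set C₄ := |C₃| * (τ * (2 * w₀)) ^ 2 with hC₄
  -- A shift of the variance by `K ε³` moves the log-price by at least `c K ε²`: the sum of the
  -- three error bounds, plus 1 for strict inequalities.
  set K := (|C₁| + |C₂| + C₄ + 1) / c with hK
  have hK0 : 0 < K := by positivity
  have hcont : ∀ K : ℝ, Tendsto (fun ε => w ε + K * ε ^ 3) (𝓝[>] 0) (𝓝 w₀) := by
    intro K
    have : Tendsto (fun ε => w ε + K * ε ^ 3) (𝓝 0) (𝓝 (w 0 + K * 0 ^ 3)) := by
      apply Continuous.tendsto; fun_prop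
    rw [show w 0 + K * 0 ^ 3 = w₀ by simp [hw]] at this
    exact this.mono_left nhdsWithin_le_nhds
  have hmem : ∀ K : ℝ, ∀ᶠ ε in 𝓝[>] (0 : ℝ), w ε + K * ε ^ 3 ∈ Icc (w₀ / 2) (2 * w₀) := fun K =>
    (hcont K).eventually (Icc_mem_nhds (by linarith) (by linarith))
  have hsmall : ∀ᶠ ε in 𝓝[>] (0 : ℝ), √(ε * τ * (2 * w₀)) < s₀ := by
    have : Tendsto (fun ε => √(ε * τ * (2 * w₀))) (𝓝 0) (𝓝 (√(0 * τ * (2 * w₀)))) := by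
      apply Continuous.tendsto; fun_prop
    rw [show √(0 * τ * (2 * w₀)) = 0 by simp] at this
    exact (this.mono_left nhdsWithin_le_nhds).eventually (Iio_mem_nhds hs₀)
  -- The enclosure of the price from which existence, uniqueness and the error bound all follow.
  have key : ∀ᶠ ε in 𝓝[>] (0 : ℝ), 0 < ε ∧ 0 < w ε - K * ε ^ 3 ∧ 0 < w ε + K * ε ^ 3 ∧
      bsOtm k (√(ε * τ * (w ε - K * ε ^ 3))) < price ε ∧
      price ε < bsOtm k (√(ε * τ * (w ε + K * ε ^ 3))) := by
    filter_upwards [hC₁, hC₂, hmem 0, hmem K, hmem (-K), hsmall, hpos, Ioo_mem_nhdsGT hδ] with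
      ε e1 e2 e3 e4 e5 e6 e7 e8
    have hε := e8.1
    rw [zero_mul, add_zero] at e3
    rw [neg_mul, ← sub_eq_add_neg] at e5
    rw [Real.norm_eq_abs, Real.norm_eq_abs, abs_of_pos (pow_pos hε 2)] at e1 e2
    have hKε : 0 < K * ε ^ 3 := by positivity
    have happrox : ∀ W ∈ Icc (w₀ / 2) (2 * w₀), 0 < bsOtm k (√(ε * τ * W)) ∧
        |Real.log (bsOtm k (√(ε * τ * W))) - logBsApprox k τ ε W| ≤ C₄ * ε ^ 2 := by
      intro W hW
      have hW0 : 0 < W := by linarith [hW.1]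
      have hs : √(ε * τ * W) ∈ Ioo 0 s₀ := by
        refine ⟨by positivity, lt_of_le_of_lt (Real.sqrt_le_sqrt ?_) e6⟩
        have := hW.2
        gcongr
      obtain ⟨h3, h4⟩ := hC₃ _ hs
      refine ⟨h3, ?_⟩
      rw [logBsApprox_eq hτ hε hW0]
      refine h4.trans ?_
      have h5 : √(ε * τ * W) ^ 4 = (ε * τ * W) ^ 2 := by
        rw [show 4 = 2 * 2 by norm_num, pow_mul, Real.sq_sqrt (by positivity)]
      rw [h5, hC₄]
      have := hW.2
      calc C₃ * (ε * τ * W) ^ 2 ≤ |C₃| * (ε * τ * (2 * w₀)) ^ 2 := by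
            gcongr; exact le_abs_self _
        _ = _ := by ring
    have hcK : c * (K * ε ^ 3) / ε = (|C₁| + |C₂| + C₄ + 1) * ε ^ 2 := by
      rw [hK]; field_simp
    obtain ⟨p1, a1⟩ := happrox _ e4
    obtain ⟨p2, a2⟩ := happrox _ e5
    have m1 := hcδ ε e8 _ e3 _ e4 (by linarith)
    have m2 := hcδ ε e8 _ e5 _ e3 (by linarith)
    rw [add_sub_cancel_left, hcK] at m1
    rw [sub_sub_cancel, hcK] at m2
    have hε2 : 0 < ε ^ 2 := by positivity
    have b1 : C₁ * ε ^ 2 ≤ |C₁| * ε ^ 2 := by gcongr; exact le_abs_self _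
    have b2 : C₂ * ε ^ 2 ≤ |C₂| * ε ^ 2 := by gcongr; exact le_abs_self _
    have a1' := abs_le.mp a1
    have a2' := abs_le.mp a2
    have e1' := abs_le.mp e1
    have e2' := abs_le.mp e2
    refine ⟨hε, by linarith [e5.1], by linarith [e4.1], ?_, ?_⟩
    · rw [← Real.log_lt_log_iff p2 e7]
      linarith [a2'.2, e1'.2, e2'.1]
    · rw [← Real.log_lt_log_iff e7 p1]
      linarith [a1'.1, e1'.1, e2'.2]
  have hbetween : ∀ ε σ, 0 < ε → 0 < w ε - K * ε ^ 3 → 0 < w ε + K * ε ^ 3 →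
      bsOtm k (√(ε * τ * (w ε - K * ε ^ 3))) < price ε →
      price ε < bsOtm k (√(ε * τ * (w ε + K * ε ^ 3))) → 0 < σ →
      price ε = bsOtm k (σ * √(ε * τ)) → |σ ^ 2 - w ε| ≤ K * ε ^ 3 := by
    intro ε σ hε h1 h2 h3 h4 hσ h5
    rw [h5] at h3 h4
    have hετ : 0 < ε * τ := by positivity
    have g1 := (strictMonoOn_bsOtm k).lt_iff_lt (show 0 < √(ε * τ * (w ε - K * ε ^ 3)) by positivity)
      (show 0 < σ * √(ε * τ) by positivity) |>.mp h3
    have g2 := (strictMonoOn_bsOtm k).lt_iff_lt (show 0 < σ * √(ε * τ) by positivity)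
      (show 0 < √(ε * τ * (w ε + K * ε ^ 3)) by positivity) |>.mp h4
    rw [Real.sqrt_lt' (by positivity), mul_pow, Real.sq_sqrt hετ.le] at g1
    rw [Real.lt_sqrt (by positivity), mul_pow, Real.sq_sqrt hετ.le] at g2
    have g1' : w ε - K * ε ^ 3 < σ ^ 2 := by
      rw [mul_comm] at g1; exact lt_of_mul_lt_mul_right g1 hετ.le
    have g2' : σ ^ 2 < w ε + K * ε ^ 3 := by
      rw [mul_comm (ε * τ)] at g2; exact lt_of_mul_lt_mul_right g2 hετ.le
    rw [abs_le]; constructor <;> linarith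
  refine ⟨?_, ?_⟩
  · filter_upwards [key] with ε ⟨hε, h1, h2, h3, h4⟩
    have hετ : 0 < √(ε * τ) := by positivity
    have hKε : 0 < K * ε ^ 3 := by positivity
    have hle : √(ε * τ * (w ε - K * ε ^ 3)) ≤ √(ε * τ * (w ε + K * ε ^ 3)) := by
      apply Real.sqrt_le_sqrt
      have : w ε - K * ε ^ 3 ≤ w ε + K * ε ^ 3 := by linarith
      gcongr
    have hs1 : 0 < √(ε * τ * (w ε - K * ε ^ 3)) := by positivity
    obtain ⟨s, hs, hsp⟩ := intermediate_value_Icc hle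
      (fun x hx => (hasDerivAt_bsOtm k (hs1.trans_le hx.1)).continuousAt.continuousWithinAt)
      ⟨h3.le, h4.le⟩
    have hs0 : 0 < s := hs1.trans_le hs.1
    refine ⟨s / √(ε * τ), ⟨by positivity, ?_⟩, ?_⟩
    · simp only
      rw [div_mul_cancel₀ _ hετ.ne', hsp]
    · rintro σ ⟨hσ, hσp⟩
      simp only at hσp
      rw [eq_div_iff hετ.ne']
      exact (strictMonoOn_bsOtm k).injOn (show 0 < σ * √(ε * τ) by positivity) hs0
        (by rw [← hσp, hsp])
  · intro σ hσ
    refine IsBigO.of_bound K ?_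
    filter_upwards [key, hσ] with ε ⟨hε, h1, h2, h3, h4⟩ ⟨h5, h6⟩
    rw [Real.norm_eq_abs, Real.norm_eq_abs, abs_of_pos (pow_pos hε 3)]
    exact hbetween ε (σ ε) hε h1 h2 h3 h4 h5 h6

/-! ### Fourier representation of option prices -/

lemma le_norm_add_mul_I_mul {m p q : ℝ} (hm : 0 ≤ m) (hm1 : m ≤ 1) (hp : m ≤ p ^ 2)
    (hq : m ≤ q ^ 2) (ξ : ℝ) :
    m * (1 + ξ ^ 2) ≤ ‖((p : ℂ) + ξ * Complex.I) * (q + ξ * Complex.I)‖ := by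
  have h : ∀ r : ℝ, m ≤ r ^ 2 → √(m * (1 + ξ ^ 2)) ≤ ‖(r : ℂ) + ξ * Complex.I‖ := by
    intro r hr
    rw [Complex.norm_add_mul_I]
    apply Real.sqrt_le_sqrt
    nlinarith [sq_nonneg ξ]
  rw [norm_mul]
  calc m * (1 + ξ ^ 2) = √(m * (1 + ξ ^ 2)) * √(m * (1 + ξ ^ 2)) :=
        (Real.mul_self_sqrt (by positivity)).symm
    _ ≤ _ := by gcongr <;> [exact h p hp; exact h q hq]

lemma add_mul_I_ne_zero {p : ℝ} (hp : p ≠ 0) (ξ : ℝ) : (p : ℂ) + ξ * Complex.I ≠ 0 := by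
  intro h
  have := congrArg Complex.re h
  simp at this
  exact hp this

lemma continuous_inv_mul {p q : ℝ} (hp : p ≠ 0) (hq : q ≠ 0) :
    Continuous fun ξ : ℝ => (((p : ℂ) + ξ * Complex.I) * (q + ξ * Complex.I))⁻¹ := by
  apply Continuous.inv₀ (by fun_prop)
  exact fun ξ => mul_ne_zero (add_mul_I_ne_zero hp ξ) (add_mul_I_ne_zero hq ξ)

lemma integrable_inv_mul {p q : ℝ} (hp : p ≠ 0) (hq : q ≠ 0) :
    Integrable fun ξ : ℝ => (((p : ℂ) + ξ * Complex.I) * (q + ξ * Complex.I))⁻¹ := by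
  set m := min 1 (min (p ^ 2) (q ^ 2)) with hm
  have hm0 : 0 < m := lt_min one_pos (lt_min (by positivity) (by positivity))
  refine Integrable.mono' (integrable_inv_one_add_sq.const_mul m⁻¹)
    (continuous_inv_mul hp hq).aestronglyMeasurable (Eventually.of_forall fun ξ => ?_)
  rw [norm_inv, ← mul_inv]
  apply inv_anti₀ (by positivity)
  exact le_norm_add_mul_I_mul hm0.le (min_le_left _ _) ((min_le_right _ _).trans (min_le_left _ _))
    ((min_le_right _ _).trans (min_le_right _ _)) ξ

open scoped FourierTransform in
-- The difference of exponentials vanishes on the negative half-line and is continuous at `0`. The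
-- jumps of the single exponentials cancel, so the transform decays quadratically and the inversion
-- theorem for integrable functions applies.
lemma fourier_inversion_exp_sub_exp {a b : ℝ} (ha : 0 < a) (hb : 0 < b) (w : ℝ) :
    ((Real.exp (-a * max w 0) - Real.exp (-b * max w 0) : ℝ) : ℂ) =
      (2 * Real.pi)⁻¹ * ∫ ξ : ℝ, ((b : ℂ) - a) *
        (((a : ℂ) + ξ * Complex.I) * (b + ξ * Complex.I))⁻¹ * Complex.exp (ξ * w * Complex.I) := by
  set h : ℝ → ℂ := fun w => ((Real.exp (-a * max w 0) - Real.exp (-b * max w 0) : ℝ) : ℂ) with hh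
  have hcont : Continuous h := by
    simp only [hh]; fun_prop
  have hind : h = (Ioi (0 : ℝ)).indicator
      fun w => Complex.exp (-(a : ℂ) * w) - Complex.exp (-(b : ℂ) * w) := by
    ext w
    by_cases hw : 0 < w
    · rw [indicator_of_mem (show w ∈ Ioi 0 from hw)]
      simp only [hh, max_eq_left hw.le]; push_cast; rfl
    · rw [indicator_of_notMem (show w ∉ Ioi 0 from hw)]
      simp only [hh, max_eq_right (not_lt.mp hw)]; simp
  have hint : Integrable h := by
    rw [hind, integrable_indicator_iff measurableSet_Ioi]
    exact (integrableOn_exp_mul_complex_Ioi (by simpa using ha) 0).sub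
      (integrableOn_exp_mul_complex_Ioi (by simpa using hb) 0)
  have hF : 𝓕 h = fun ξ : ℝ => ((b : ℂ) - a) * (((a : ℂ) + (2 * Real.pi * ξ : ℝ) * Complex.I) *
      (b + (2 * Real.pi * ξ : ℝ) * Complex.I))⁻¹ := by
    ext ξ
    rw [Real.fourier_real_eq_integral_exp_smul]
    have e1 : (fun v : ℝ => Complex.exp (((-2 * Real.pi * v * ξ : ℝ) : ℂ) * Complex.I) • h v)
        = (Ioi (0 : ℝ)).indicator fun v : ℝ =>
          Complex.exp (-((a : ℂ) + (2 * Real.pi * ξ : ℝ) * Complex.I) * v)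
          - Complex.exp (-((b : ℂ) + (2 * Real.pi * ξ : ℝ) * Complex.I) * v) := by
      ext v
      rw [hind]
      by_cases hv : v ∈ Ioi (0 : ℝ)
      · rw [indicator_of_mem hv, indicator_of_mem hv, smul_eq_mul, mul_sub, ← Complex.exp_add,
          ← Complex.exp_add]
        congr 2 <;> push_cast <;> ring
      · rw [indicator_of_notMem hv, indicator_of_notMem hv, smul_zero]
    rw [e1, integral_indicator measurableSet_Ioi, integral_sub
      (integrableOn_exp_mul_complex_Ioi (by simpa using ha) 0)
      (integrableOn_exp_mul_complex_Ioi (by simpa using hb) 0),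
      integral_exp_mul_complex_Ioi (by simpa using ha) 0,
      integral_exp_mul_complex_Ioi (by simpa using hb) 0]
    have h1 := add_mul_I_ne_zero ha.ne' (2 * Real.pi * ξ)
    have h2 := add_mul_I_ne_zero hb.ne' (2 * Real.pi * ξ)
    simp only [Complex.ofReal_zero, mul_zero, Complex.exp_zero]
    field_simp
    ring
  have hFint : Integrable (𝓕 h) := by
    rw [hF]
    exact ((integrable_inv_mul ha.ne' hb.ne').comp_mul_left' (by positivity)).const_mul _
  have hinv := congrFun (hcont.fourierInv_fourier_eq hint hFint) w
  rw [Real.fourierInv_eq', hF] at hinv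
  change h w = _
  rw [← hinv]
  have hsub := Measure.integral_comp_mul_left (fun ξ : ℝ => ((b : ℂ) - a) *
    (((a : ℂ) + ξ * Complex.I) * (b + ξ * Complex.I))⁻¹ * Complex.exp (ξ * w * Complex.I))
    (2 * Real.pi)
  rw [abs_of_pos (by positivity), Complex.real_smul] at hsub
  rw [← hsub]
  apply integral_congr_ae
  refine Eventually.of_forall fun ξ => ?_
  simp only [smul_eq_mul, RCLike.inner_apply, conj_trivial]
  rw [mul_comm]
  congr 2
  push_cast; ring

section

variable {Ω : Type*} [MeasurableSpace Ω] {P : Measure Ω}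

/-- Fubini: the exponential weight is integrable in `Ω`, `κ` is integrable in `ξ`, and the remaining
factor has modulus one. -/
lemma integral_exp_mul_eq_of_fourier [SFinite P] {Z : Ω → ℝ} (hZ : Measurable Z) {u ε k : ℝ}
    (hu : u / ε ∈ integrableExpSet Z P) {κ : ℝ → ℂ} (hκ : Integrable κ) {G : ℝ → ℝ}
    (hG : ∀ w, (G w : ℂ) = ∫ ξ : ℝ, κ ξ * Complex.exp (ξ * w * Complex.I)) :
    ((∫ x, Real.exp (u / ε * (Z x - k)) * G ((Z x - k) / ε) ∂P : ℝ) : ℂ) =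
      ∫ ξ : ℝ, κ ξ * (Complex.exp (-(u + ξ * Complex.I) * k / ε) *
        complexMGF Z P ((u + ξ * Complex.I) / ε)) := by
  have hint : Integrable (fun x => ((Real.exp (u / ε * (Z x - k)) : ℝ) : ℂ)) P := by
    apply Integrable.ofReal
    refine (Integrable.const_mul hu (Real.exp (-(u / ε * k)))).congr
      (Eventually.of_forall fun x => ?_)
    simp only
    rw [← Real.exp_add]; congr 1; ring
  have hprod : Integrable (Function.uncurry fun (x : Ω) (ξ : ℝ) =>
      Complex.exp (ξ * ((Z x - k) / ε : ℝ) * Complex.I) *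
        (((Real.exp (u / ε * (Z x - k)) : ℝ) : ℂ) * κ ξ)) (P.prod volume) := by
    refine (hint.mul_prod hκ).bdd_mul (c := 1) ?_ (Eventually.of_forall fun q => ?_)
    · apply Measurable.aestronglyMeasurable
      have h1 : Measurable fun q : Ω × ℝ => (Z q.1 - k) / ε := by fun_prop
      have h2 : Measurable fun q : Ω × ℝ => q.2 := measurable_snd
      fun_prop
    · rw [← Complex.ofReal_mul, Complex.norm_exp_ofReal_mul_I]
  rw [← integral_complex_ofReal]
  have e1 : ∀ x, ((Real.exp (u / ε * (Z x - k)) * G ((Z x - k) / ε) : ℝ) : ℂ) =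
      ∫ ξ : ℝ, Complex.exp (ξ * ((Z x - k) / ε : ℝ) * Complex.I) *
        (((Real.exp (u / ε * (Z x - k)) : ℝ) : ℂ) * κ ξ) := by
    intro x
    rw [Complex.ofReal_mul, hG, ← integral_const_mul]
    congr 1; ext ξ; ring
  simp_rw [e1]
  rw [integral_integral_swap hprod]
  congr 1
  ext ξ
  rw [complexMGF, ← integral_const_mul, ← integral_const_mul]
  congr 1
  ext x
  rw [Complex.ofReal_exp, mul_comm (Complex.exp ((u / ε * (Z x - k) : ℝ) : ℂ)), mul_left_comm,
    ← Complex.exp_add, ← Complex.exp_add]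
  congr 2
  push_cast; ring

/-- The Fourier kernel of out-of-the-money payoffs. -/
noncomputable def otmKernel (u ε ξ : ℝ) : ℂ :=
  (((u : ℂ) + ξ * Complex.I) * ((u - ε : ℝ) + ξ * Complex.I))⁻¹

/-- The integrand in the Fourier representation of the price. -/
noncomputable def priceIntegrand (P : Measure Ω) (Z : Ω → ℝ) (u ε k ξ : ℝ) : ℂ :=
  otmKernel u ε ξ * (Complex.exp (-(u + ξ * Complex.I) * k / ε) *
        complexMGF Z P ((u + ξ * Complex.I) / ε))

/-- With `w = (Z - k) / ε`, the payoff is `e^k e^{uw}` times the difference of exponentials with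
rates `u - ε` and `u`. Both rates must be positive, hence `ε < u`; their difference is the prefactor
`ε`. -/
theorem callPrice_eq [SFinite P] {Z : Ω → ℝ} (hZ : Measurable Z) {u ε k : ℝ} (hε : 0 < ε)
    (hεu : ε < u) (hu : u / ε ∈ integrableExpSet Z P) :
    (callPrice P Z k : ℂ) =
      (Real.exp k * (ε / (2 * Real.pi)) : ℝ) * ∫ ξ : ℝ, priceIntegrand P Z u ε k ξ := by
  have hu0 : 0 < u := hε.trans hεu
  have hker : Integrable (fun ξ => (ε / (2 * Real.pi) : ℝ) * otmKernel u ε ξ) :=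
    (integrable_inv_mul hu0.ne' (sub_pos.mpr hεu).ne').const_mul _
  have h1 := integral_exp_mul_eq_of_fourier hZ (k := k) hu hker
    (G := fun w => Real.exp (-(u - ε) * max w 0) - Real.exp (-u * max w 0)) (fun w => by
      rw [fourier_inversion_exp_sub_exp (sub_pos.mpr hεu) hu0, ← integral_const_mul]
      congr 1; ext ξ
      simp only [otmKernel]
      rw [mul_comm ((u : ℂ) + ξ * Complex.I)]
      push_cast; ring)
  have h2 : ∀ x, max (Real.exp (Z x) - Real.exp k) 0 = Real.exp k * (Real.exp (u / ε * (Z x - k)) *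
      (Real.exp (-(u - ε) * max ((Z x - k) / ε) 0) - Real.exp (-u * max ((Z x - k) / ε) 0))) := by
    intro x
    rcases le_total k (Z x) with h | h
    · rw [max_eq_left (by linarith [Real.exp_le_exp.mpr h]), max_eq_left (div_nonneg (by linarith)
        hε.le), mul_sub, mul_sub, ← Real.exp_add, ← Real.exp_add, ← Real.exp_add, ← Real.exp_add]
      congr 2 <;> field_simp <;> ring
    · rw [max_eq_right (by linarith [Real.exp_le_exp.mpr h]),
        max_eq_right (div_nonpos_of_nonpos_of_nonneg (by linarith) hε.le)]
      simp
  have h3 : callPrice P Z k = Real.exp k * ∫ x, Real.exp (u / ε * (Z x - k)) *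
      (Real.exp (-(u - ε) * max ((Z x - k) / ε) 0) - Real.exp (-u * max ((Z x - k) / ε) 0)) ∂P := by
    rw [callPrice, ← integral_const_mul]
    congr 1; ext x; exact h2 x
  rw [h3, Complex.ofReal_mul, h1, Complex.ofReal_mul, mul_assoc]
  congr 1
  rw [← integral_const_mul]
  congr 1; ext ξ
  rw [priceIntegrand]; ring

theorem putPrice_eq [SFinite P] {Z : Ω → ℝ} (hZ : Measurable Z) {u ε k : ℝ} (hε : 0 < ε)
    (hu0 : u < 0) (hu : u / ε ∈ integrableExpSet Z P) :
    (putPrice P Z k : ℂ) =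
      (Real.exp k * (ε / (2 * Real.pi)) : ℝ) * ∫ ξ : ℝ, priceIntegrand P Z u ε k ξ := by
  have hb : 0 < -(u - ε) := by linarith
  have hker : Integrable (fun ξ => (ε / (2 * Real.pi) : ℝ) * otmKernel u ε ξ) :=
    (integrable_inv_mul hu0.ne (by linarith : u - ε ≠ 0)).const_mul _
  have h1 := integral_exp_mul_eq_of_fourier hZ (k := k) hu hker
    (G := fun w => Real.exp (-(-u) * max (-w) 0) - Real.exp (-(-(u - ε)) * max (-w) 0))
    (fun w => by
      rw [fourier_inversion_exp_sub_exp (neg_pos.mpr hu0) hb, ← integral_const_mul,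
        -- The put uses `-w` and the rates `-u` and `ε - u`; substituting `-ξ` restores the kernel
        -- of the call.
        ← integral_neg_eq_self]
      congr 1; ext ξ
      simp only [otmKernel]
      have e : (((-u : ℝ) : ℂ) + ((-ξ : ℝ) : ℂ) * Complex.I) *
          (((-(u - ε) : ℝ) : ℂ) + ((-ξ : ℝ) : ℂ) * Complex.I) =
          ((u : ℂ) + ξ * Complex.I) * ((u - ε : ℝ) + ξ * Complex.I) := by
        push_cast; ring
      have e2 : ((-ξ : ℝ) : ℂ) * ((-w : ℝ) : ℂ) * Complex.I = ξ * w * Complex.I := by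
        push_cast; ring
      rw [e, e2]
      push_cast; ring)
  have h2 : ∀ x, max (Real.exp k - Real.exp (Z x)) 0 = Real.exp k * (Real.exp (u / ε * (Z x - k)) *
      (Real.exp (-(-u) * max (-((Z x - k) / ε)) 0)
        - Real.exp (-(-(u - ε)) * max (-((Z x - k) / ε)) 0))) := by
    intro x
    rcases le_total (Z x) k with h | h
    · rw [max_eq_left (by linarith [Real.exp_le_exp.mpr h]), max_eq_left (by
        rw [neg_nonneg]; exact div_nonpos_of_nonpos_of_nonneg (by linarith)
          hε.le), mul_sub, mul_sub, ← Real.exp_add, ← Real.exp_add, ← Real.exp_add, ← Real.exp_add]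
      congr 2 <;> field_simp <;> ring
    · rw [max_eq_right (by linarith [Real.exp_le_exp.mpr h]),
        max_eq_right (by rw [neg_nonpos]; exact div_nonneg (by linarith) hε.le)]
      simp
  have h3 : putPrice P Z k = Real.exp k * ∫ x, Real.exp (u / ε * (Z x - k)) *
      (Real.exp (-(-u) * max (-((Z x - k) / ε)) 0)
        - Real.exp (-(-(u - ε)) * max (-((Z x - k) / ε)) 0)) ∂P := by
    rw [putPrice, ← integral_const_mul]
    congr 1; ext x; exact h2 x
  rw [h3, Complex.ofReal_mul, h1, Complex.ofReal_mul, mul_assoc]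
  congr 1
  rw [← integral_const_mul]
  congr 1; ext ξ
  rw [priceIntegrand]; ring

end

/-! ### Laplace's method with a second-order term -/

lemma integrable_pow_mul_exp_neg_mul_sq {b : ℝ} (hb : 0 < b) (n : ℕ) :
    Integrable fun x : ℝ => x ^ n * Real.exp (-b * x ^ 2) := by
  have := integrable_rpow_mul_exp_neg_mul_sq hb (s := n) (by
    have : (0 : ℝ) ≤ n := n.cast_nonneg
    linarith)
  simpa using this

lemma integrable_pow_mul_one_add_sq_pow_mul_exp {b : ℝ} (hb : 0 < b) (N m : ℕ) :
    Integrable fun x : ℝ => x ^ m * (1 + x ^ 2) ^ N * Real.exp (-b * x ^ 2) := by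
  induction N generalizing m with
  | zero => simpa using integrable_pow_mul_exp_neg_mul_sq hb m
  | succ N ih =>
    refine ((ih m).add (ih (m + 2))).congr (Eventually.of_forall fun x => ?_)
    simp only [Pi.add_apply]; ring

lemma integral_pow_add_two_mul_exp_neg_mul_sq {b : ℝ} (hb : 0 < b) (n : ℕ) :
    ∫ x : ℝ, x ^ (n + 2) * Real.exp (-b * x ^ 2) =
      (n + 1) / (2 * b) * ∫ x : ℝ, x ^ n * Real.exp (-b * x ^ 2) := by
  have hd : ∀ x : ℝ, HasDerivAt (fun x : ℝ => x ^ (n + 1) * Real.exp (-b * x ^ 2))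
      ((n + 1) * (x ^ n * Real.exp (-b * x ^ 2)) -
        2 * b * (x ^ (n + 2) * Real.exp (-b * x ^ 2))) x := by
    intro x
    have h1 := hasDerivAt_pow (n + 1) x
    have h2 : HasDerivAt (fun x : ℝ => Real.exp (-b * x ^ 2))
        (Real.exp (-b * x ^ 2) * (-b * (2 * x))) x := by
      simpa using ((hasDerivAt_pow 2 x).const_mul (-b)).exp
    refine (h1.mul h2).congr_deriv ?_
    push_cast
    ring
  have h0 := integral_eq_zero_of_hasDerivAt_of_integrable hd
    (((integrable_pow_mul_exp_neg_mul_sq hb n).const_mul _).sub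
      ((integrable_pow_mul_exp_neg_mul_sq hb (n + 2)).const_mul _))
    (integrable_pow_mul_exp_neg_mul_sq hb (n + 1))
  rw [integral_sub ((integrable_pow_mul_exp_neg_mul_sq hb n).const_mul _)
      ((integrable_pow_mul_exp_neg_mul_sq hb (n + 2)).const_mul _), integral_const_mul,
      integral_const_mul] at h0
  rw [div_mul_eq_mul_div, eq_div_iff (by positivity)]
  linarith

/-- Second-order correction in the integrand of Laplace's method, in terms of `w = ξ² / ε`. -/
noncomputable def laplaceWeight (e₄ e₂ o₃ o₁ w : ℝ) : ℝ :=
  e₄ * w ^ 2 + e₂ * w - w * (o₃ * w + o₁) ^ 2 / 2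

lemma integral_laplaceWeight {a : ℝ} (ha : 0 < a) (e₄ e₂ o₃ o₁ ε : ℝ) :
    ∫ x : ℝ, (1 + ε * laplaceWeight e₄ e₂ o₃ o₁ (x ^ 2)) * Real.exp (-(a / 2) * x ^ 2) =
      √(2 * Real.pi / a) * (1 + ε * (3 * e₄ / a ^ 2 + e₂ / a - 15 * o₃ ^ 2 / (2 * a ^ 3)
        - 3 * o₃ * o₁ / a ^ 2 - o₁ ^ 2 / (2 * a))) := by
  have hb : 0 < a / 2 := by positivity
  have m0 : ∫ x : ℝ, x ^ 0 * Real.exp (-(a / 2) * x ^ 2) = √(2 * Real.pi / a) := by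
    simp only [pow_zero, one_mul]
    rw [integral_gaussian]
    congr 1; field_simp
  have m2 := integral_pow_add_two_mul_exp_neg_mul_sq hb 0
  have m4 := integral_pow_add_two_mul_exp_neg_mul_sq hb 2
  have m6 := integral_pow_add_two_mul_exp_neg_mul_sq hb 4
  have e : (fun x : ℝ => (1 + ε * laplaceWeight e₄ e₂ o₃ o₁ (x ^ 2)) * Real.exp (-(a / 2) * x ^ 2))
      = fun x : ℝ => x ^ 0 * Real.exp (-(a / 2) * x ^ 2)
        + ε * (e₂ - o₁ ^ 2 / 2) * (x ^ (0 + 2) * Real.exp (-(a / 2) * x ^ 2))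
        + ε * (e₄ - o₃ * o₁) * (x ^ (2 + 2) * Real.exp (-(a / 2) * x ^ 2))
        + ε * (-o₃ ^ 2 / 2) * (x ^ (4 + 2) * Real.exp (-(a / 2) * x ^ 2)) := by
    ext x; simp only [laplaceWeight]; ring
  have i := fun n => integrable_pow_mul_exp_neg_mul_sq hb n
  rw [e, integral_add, integral_add, integral_add, integral_const_mul, integral_const_mul,
    integral_const_mul, m6, m4, m2, m0]
  · norm_num
    field_simp
    ring
  · exact i _
  · exact (i _).const_mul _
  · exact (i _).add ((i _).const_mul _)
  · exact (i _).const_mul _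
  · exact ((i _).add ((i _).const_mul _)).add ((i _).const_mul _)
  · exact (i _).const_mul _

/-- The real part of `e^{X + iy}`. In Laplace's method `X` is of order `ε` and `y` of order `√ε`, so
every discarded term is of order `ε²`. -/
lemma abs_exp_mul_cos_sub_le (X y : ℝ) :
    |Real.exp X * Real.cos y - (1 + X - y ^ 2 / 2)| ≤
      (X ^ 2 + y ^ 4 + y ^ 2 * |X|) * Real.exp |X| := by
  have h1 : |Real.exp X - 1 - X| ≤ X ^ 2 * Real.exp |X| := by
    have h := Complex.norm_exp_sub_sum_le_norm_mul_exp X 2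
    rw [Complex.norm_real, Real.norm_eq_abs, sq_abs] at h
    have e : Complex.exp X - ∑ m ∈ Finset.range 2, (X : ℂ) ^ m / m.factorial =
        ((Real.exp X - 1 - X : ℝ) : ℂ) := by
      simp [Finset.sum_range_succ]; ring
    rwa [e, Complex.norm_real, Real.norm_eq_abs] at h
  have h2 : |Real.cos y - 1 + y ^ 2 / 2| ≤ y ^ 4 := by
    have l1 := Real.one_sub_sq_div_two_le_cos (x := y)
    have l2 : Real.cos y - 1 + y ^ 2 / 2 ≤ y ^ 4 := by
      rcases le_or_gt |y| 1 with h | h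
      · have := (abs_le.mp (Real.cos_bound h)).2
        have e : |y| ^ 4 = y ^ 4 := by
          rw [show (4 : ℕ) = 2 * 2 by rfl, pow_mul, pow_mul, sq_abs]
        rw [e] at this
        have : (0 : ℝ) ≤ y ^ 4 := by positivity
        linarith
      · have := Real.cos_le_one y
        have h3 : 1 ≤ y ^ 2 := by nlinarith [sq_abs y]
        nlinarith
    rw [abs_of_nonneg (by linarith)]; exact l2
  have h3 : 1 + |X| ≤ Real.exp |X| := by linarith [Real.add_one_le_exp |X|]
  have h4 : 1 ≤ Real.exp |X| := Real.one_le_exp (abs_nonneg X)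
  have hc := Real.abs_cos_le_one y
  calc |Real.exp X * Real.cos y - (1 + X - y ^ 2 / 2)|
      = |(Real.exp X - 1 - X) * Real.cos y + (1 + X) * (Real.cos y - 1 + y ^ 2 / 2)
          - y ^ 2 / 2 * X| := by congr 1; ring
    _ ≤ |Real.exp X - 1 - X| * |Real.cos y| + |1 + X| * |Real.cos y - 1 + y ^ 2 / 2|
          + y ^ 2 / 2 * |X| := by
        refine (abs_sub _ _).trans ?_
        gcongr
        · refine (abs_add_le _ _).trans ?_
          rw [abs_mul, abs_mul]
        · rw [abs_mul, abs_of_nonneg (by positivity : 0 ≤ y ^ 2 / 2)]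
    _ ≤ X ^ 2 * Real.exp |X| * 1 + Real.exp |X| * y ^ 4 + y ^ 2 * |X| * Real.exp |X| := by
        have h5 : |1 + X| ≤ Real.exp |X| := by
          refine (abs_add_le _ _).trans ?_
          rw [abs_one]; exact h3
        have h6 : y ^ 2 / 2 * |X| ≤ y ^ 2 * |X| * Real.exp |X| := by
          have h7 : 0 ≤ y ^ 2 * |X| := by positivity
          have h8 : y ^ 2 * |X| * 1 ≤ y ^ 2 * |X| * Real.exp |X| :=
            mul_le_mul_of_nonneg_left h4 h7
          linarith
        refine add_le_add (add_le_add ?_ ?_) h6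
        · gcongr
        · gcongr
    _ = _ := by ring

set_option maxHeartbeats 1000000 in
-- In the variable `w = ξ² / ε`, put `W = 1 + w`. Then `|X|` is at most a constant times `ε W²`, and
-- `y²` a constant times `ε W⁵`, so discarded terms are `ε²` times at most `W¹⁰`.
lemma laplace_pointwise {a C : ℝ} (ha : 0 < a) (hC : 0 ≤ C) (e₄ e₂ o₃ o₁ : ℝ) :
    ∃ ρ > 0, ∃ K, 0 ≤ K ∧ ∀ ε ∈ Ioo 0 ρ, ∀ ξ : ℝ, |ξ| < ρ → ∀ X y : ℝ,
      |ε * X - (e₄ * ξ ^ 4 + ε * e₂ * ξ ^ 2)| ≤ C * (ξ ^ 6 + ε * ξ ^ 4 + ε ^ 2 * ξ ^ 2) →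
      |ε * y - (o₃ * ξ ^ 3 + ε * o₁ * ξ)| ≤ C * (|ξ| ^ 5 + ε * |ξ| ^ 3 + ε ^ 2 * |ξ|) →
      |Real.exp X * Real.cos y - (1 + ε * laplaceWeight e₄ e₂ o₃ o₁ (ξ ^ 2 / ε))| ≤
        K * ε ^ 2 * (1 + ξ ^ 2 / ε) ^ 10 * Real.exp (a / 4 * (ξ ^ 2 / ε)) := by
  set A := |e₄| + |e₂| + 3 * C with hA
  set B := |o₃| + |o₁| + 3 * C with hB
  have hA0 : 0 ≤ A := by positivity
  have hB0 : 0 ≤ B := by positivity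
  -- This choice of `ρ` forces `|X| ≤ (a / 4) w`, so `e^{|X|}` consumes only half of the Gaussian
  -- decay `e^{-(a / 2) w}`.
  refine ⟨min 1 (a / (8 * (A + 1))), lt_min one_pos (by positivity),
    A ^ 2 + B ^ 4 + B ^ 2 * A + A + 3 * B ^ 2, by positivity, ?_⟩
  rintro ε ⟨hε, hερ⟩ ξ hξ X y hX hy
  have hε1 : ε ≤ 1 := (hερ.le.trans (min_le_left _ _))
  have hε2 : ε ≤ a / (8 * (A + 1)) := (hερ.le.trans (min_le_right _ _))
  have hξ1 : |ξ| ≤ 1 := (hξ.le.trans (min_le_left _ _))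
  have hξ2 : |ξ| ≤ a / (8 * (A + 1)) := (hξ.le.trans (min_le_right _ _))
  set w := ξ ^ 2 / ε with hw
  have hw0 : 0 ≤ w := by positivity
  have hξw : ξ ^ 2 = ε * w := by rw [hw]; field_simp
  have hsq : |ξ| ^ 2 = ε * w := by rw [sq_abs, hξw]
  have hεw1 : ε * w ≤ 1 := by rw [← hsq]; exact pow_le_one₀ (abs_nonneg _) hξ1
  have hεw2 : ε * w ≤ a / (8 * (A + 1)) := by
    rw [← hsq, sq]
    exact (mul_le_of_le_one_right (abs_nonneg _) hξ1).trans hξ2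
  -- the even part
  have hX' : |X - ε * (e₄ * w ^ 2 + e₂ * w)| ≤ C * ε ^ 2 * (w ^ 3 + w ^ 2 + w) := by
    have e : ε * X - (e₄ * ξ ^ 4 + ε * e₂ * ξ ^ 2) = ε * (X - ε * (e₄ * w ^ 2 + e₂ * w)) := by
      rw [show ξ ^ 4 = (ξ ^ 2) ^ 2 by ring, hξw]; ring
    have e' : C * (ξ ^ 6 + ε * ξ ^ 4 + ε ^ 2 * ξ ^ 2) = ε * (C * ε ^ 2 * (w ^ 3 + w ^ 2 + w)) := by
      rw [show ξ ^ 4 = (ξ ^ 2) ^ 2 by ring, show ξ ^ 6 = (ξ ^ 2) ^ 3 by ring, hξw]; ring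
    rw [e, e', abs_mul, abs_of_pos hε] at hX
    exact le_of_mul_le_mul_left hX hε
  have hXb : |X| ≤ w * (A * (ε * w + ε)) := by
    have h1 : |X| ≤ |X - ε * (e₄ * w ^ 2 + e₂ * w)| + |ε * (e₄ * w ^ 2 + e₂ * w)| := by
      have := abs_add_le (X - ε * (e₄ * w ^ 2 + e₂ * w)) (ε * (e₄ * w ^ 2 + e₂ * w))
      simpa using this
    have h2 : |ε * (e₄ * w ^ 2 + e₂ * w)| ≤ w * ((|e₄| + |e₂|) * (ε * w + ε)) := by
      rw [abs_mul, abs_of_pos hε]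
      have : |e₄ * w ^ 2 + e₂ * w| ≤ |e₄| * w ^ 2 + |e₂| * w := by
        refine (abs_add_le _ _).trans ?_
        rw [abs_mul, abs_mul, abs_of_nonneg hw0, abs_of_nonneg (by positivity : 0 ≤ w ^ 2)]
      have h3 : 0 ≤ |e₄| * w * ε := by positivity
      have h4 : 0 ≤ |e₂| * w ^ 2 * ε := by positivity
      have h5 := mul_le_mul_of_nonneg_left this hε.le
      linarith only [h3, h4, h5]
    have h3 : C * ε ^ 2 * (w ^ 3 + w ^ 2 + w) ≤ w * (3 * C * (ε * w + ε)) := by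
      have k1 : ε ^ 2 * (w ^ 2 + w + 1) ≤ 3 * (ε * w + ε) := by
        have k0 := mul_nonneg hε.le hw0
        have k2 := mul_le_mul_of_nonneg_left hεw1 k0
        have k3 := mul_le_mul_of_nonneg_left hε1 k0
        have k4 := mul_le_mul_of_nonneg_left hε1 hε.le
        linarith only [k0, k2, k3, k4, hε]
      calc C * ε ^ 2 * (w ^ 3 + w ^ 2 + w) = C * w * (ε ^ 2 * (w ^ 2 + w + 1)) := by ring
        _ ≤ C * w * (3 * (ε * w + ε)) := by gcongr
        _ = _ := by ring
    calc |X| ≤ w * (3 * C * (ε * w + ε)) + w * ((|e₄| + |e₂|) * (ε * w + ε)) := by linarith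
      _ = _ := by rw [hA]; ring
  have hXa : |X| ≤ a / 4 * w := by
    refine hXb.trans ?_
    have h1 : A * (ε * w + ε) ≤ a / 4 := by
      calc A * (ε * w + ε) ≤ (A + 1) * (a / (8 * (A + 1)) + a / (8 * (A + 1))) := by
            gcongr; linarith
        _ = a / 4 := by field_simp; norm_num
    rw [mul_comm (a / 4)]
    exact mul_le_mul_of_nonneg_left h1 hw0
  set W := 1 + w with hW
  have hW1 : 1 ≤ W := by linarith
  have hwW : w ≤ W := by linarith
  have hXW : |X| ≤ A * ε * W ^ 2 := by
    refine hXb.trans ?_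
    calc w * (A * (ε * w + ε)) = A * ε * (w * W) := by rw [hW]; ring
      _ ≤ A * ε * (W * W) := by gcongr
      _ = _ := by ring
  -- the odd part
  have hy' : |y - ξ * (o₃ * w + o₁)| ≤ 3 * C * ε * W ^ 2 * |ξ| := by
    have e : ε * y - (o₃ * ξ ^ 3 + ε * o₁ * ξ) = ε * (y - ξ * (o₃ * w + o₁)) := by
      rw [show ξ ^ 3 = ξ ^ 2 * ξ by ring, hξw]; ring
    have e' : C * (|ξ| ^ 5 + ε * |ξ| ^ 3 + ε ^ 2 * |ξ|)
        = ε * (C * ε * (w ^ 2 + w + 1) * |ξ|) := by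
      rw [show |ξ| ^ 5 = (|ξ| ^ 2) ^ 2 * |ξ| by ring, show |ξ| ^ 3 = |ξ| ^ 2 * |ξ| by ring, hsq]
      ring
    rw [e, e', abs_mul, abs_of_pos hε] at hy
    refine (le_of_mul_le_mul_left hy hε).trans ?_
    have : w ^ 2 + w + 1 ≤ 3 * W ^ 2 := by rw [hW]; linarith only [sq_nonneg w, hw0]
    calc C * ε * (w ^ 2 + w + 1) * |ξ| ≤ C * ε * (3 * W ^ 2) * |ξ| := by gcongr
      _ = _ := by ring
  set y₀ := ξ * (o₃ * w + o₁) with hy₀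
  have hy₀b : |y₀| ≤ B * W ^ 2 * |ξ| := by
    rw [hy₀, abs_mul, mul_comm]
    gcongr
    calc |o₃ * w + o₁| ≤ |o₃| * w + |o₁| := by
          refine (abs_add_le _ _).trans ?_
          rw [abs_mul, abs_of_nonneg hw0]
      _ ≤ |o₃| * W + |o₁| * W := by
          gcongr
          exact le_mul_of_one_le_right (abs_nonneg _) hW1
      _ = (|o₃| + |o₁|) * W := by ring
      _ ≤ B * W ^ 2 := by
          have : W ≤ W ^ 2 := le_self_pow₀ hW1 two_ne_zero
          gcongr
          rw [hB]; linarith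
  have hdB : |y - y₀| ≤ B * ε * W ^ 2 * |ξ| := by
    refine hy'.trans ?_
    gcongr
    rw [hB]; linarith [abs_nonneg o₃, abs_nonneg o₁]
  have hyb : |y| ≤ B * W ^ 2 * |ξ| := by
    have h1 : |y| ≤ |y - y₀| + |y₀| := by simpa using abs_add_le (y - y₀) y₀
    have h2 : |y₀| ≤ (|o₃| + |o₁|) * W ^ 2 * |ξ| := by
      rw [hy₀, abs_mul, mul_comm]
      gcongr
      calc |o₃ * w + o₁| ≤ |o₃| * w + |o₁| := by
            refine (abs_add_le _ _).trans ?_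
            rw [abs_mul, abs_of_nonneg hw0]
        _ ≤ |o₃| * W ^ 2 + |o₁| * W ^ 2 := by
            have : w ≤ W ^ 2 := hwW.trans (le_self_pow₀ hW1 two_ne_zero)
            gcongr
            exact le_mul_of_one_le_right (abs_nonneg _) (one_le_pow₀ hW1)
        _ = (|o₃| + |o₁|) * W ^ 2 := by ring
    have h3 : 3 * C * ε * W ^ 2 * |ξ| ≤ 3 * C * W ^ 2 * |ξ| := by
      have h4 : 3 * C * ε ≤ 3 * C := mul_le_of_le_one_right (by positivity) hε1
      gcongr
    rw [hB]; linarith only [h1, h2, h3, hy']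
  have hy2 : y ^ 2 ≤ B ^ 2 * ε * W ^ 5 := by
    calc y ^ 2 = |y| ^ 2 := (sq_abs y).symm
      _ ≤ (B * W ^ 2 * |ξ|) ^ 2 := by gcongr
      _ = B ^ 2 * W ^ 4 * (ε * w) := by rw [mul_pow, hsq]; ring
      _ ≤ B ^ 2 * W ^ 4 * (ε * W) := by gcongr
      _ = _ := by ring
  have hdiff : |y ^ 2 - y₀ ^ 2| ≤ 2 * B ^ 2 * ε ^ 2 * W ^ 5 := by
    calc |y ^ 2 - y₀ ^ 2| = |y - y₀| * |y + y₀| := by rw [← abs_mul]; congr 1; ring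
      _ ≤ (B * ε * W ^ 2 * |ξ|) * (B * W ^ 2 * |ξ| + B * W ^ 2 * |ξ|) := by
          gcongr
          exact (abs_add_le _ _).trans (add_le_add hyb hy₀b)
      _ = 2 * B ^ 2 * ε * W ^ 4 * |ξ| ^ 2 := by ring
      _ = 2 * B ^ 2 * ε ^ 2 * W ^ 4 * w := by rw [hsq]; ring
      _ ≤ 2 * B ^ 2 * ε ^ 2 * W ^ 4 * W := by gcongr
      _ = _ := by ring
  have hexp1 : 1 ≤ Real.exp (a / 4 * w) := Real.one_le_exp (by positivity)
  have hexp : Real.exp |X| ≤ Real.exp (a / 4 * w) := Real.exp_le_exp.mpr hXa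
  have hpw : ∀ n ≤ 10, W ^ n ≤ W ^ 10 := fun n hn => pow_le_pow_right₀ hW1 hn
  have hmain := abs_exp_mul_cos_sub_le X y
  have hrest : |(1 + X - y ^ 2 / 2) - (1 + ε * laplaceWeight e₄ e₂ o₃ o₁ w)| ≤
      (A + 3 * B ^ 2) * ε ^ 2 * W ^ 10 * Real.exp (a / 4 * w) := by
    have e : (1 + X - y ^ 2 / 2) - (1 + ε * laplaceWeight e₄ e₂ o₃ o₁ w) =
        (X - ε * (e₄ * w ^ 2 + e₂ * w)) - (y ^ 2 - y₀ ^ 2) / 2 := by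
      rw [laplaceWeight, hy₀, mul_pow, hξw]; ring
    rw [e]
    have h1 : w ^ 3 + w ^ 2 + w ≤ 3 * W ^ 10 := by
      have := hpw 3 (by norm_num)
      have := hpw 2 (by norm_num)
      have := hpw 1 (by norm_num)
      have : w ^ 3 ≤ W ^ 3 := by gcongr
      have : w ^ 2 ≤ W ^ 2 := by gcongr
      linarith [pow_one W]
    calc |(X - ε * (e₄ * w ^ 2 + e₂ * w)) - (y ^ 2 - y₀ ^ 2) / 2|
        ≤ |X - ε * (e₄ * w ^ 2 + e₂ * w)| + |(y ^ 2 - y₀ ^ 2) / 2| := abs_sub _ _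
      _ ≤ C * ε ^ 2 * (3 * W ^ 10) + 2 * B ^ 2 * ε ^ 2 * W ^ 10 / 2 := by
          rw [abs_div, abs_two]
          gcongr
          · exact hX'.trans (by gcongr)
          · exact hdiff.trans (by gcongr; norm_num)
      _ ≤ (A + 3 * B ^ 2) * ε ^ 2 * W ^ 10 * 1 := by
          have h2 : 3 * C + B ^ 2 ≤ A + 3 * B ^ 2 := by
            have := sq_nonneg B
            rw [hA]; linarith only [abs_nonneg e₄, abs_nonneg e₂, this]
          calc C * ε ^ 2 * (3 * W ^ 10) + 2 * B ^ 2 * ε ^ 2 * W ^ 10 / 2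
              = (3 * C + B ^ 2) * (ε ^ 2 * W ^ 10) := by ring
            _ ≤ (A + 3 * B ^ 2) * (ε ^ 2 * W ^ 10) := by gcongr
            _ = _ := by ring
      _ ≤ _ := by gcongr
  have hfirst : (X ^ 2 + y ^ 4 + y ^ 2 * |X|) * Real.exp |X| ≤
      (A ^ 2 + B ^ 4 + B ^ 2 * A) * ε ^ 2 * W ^ 10 * Real.exp (a / 4 * w) := by
    have t1 : X ^ 2 ≤ A ^ 2 * ε ^ 2 * W ^ 10 := by
      calc X ^ 2 = |X| ^ 2 := (sq_abs X).symm
        _ ≤ (A * ε * W ^ 2) ^ 2 := by gcongr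
        _ = A ^ 2 * ε ^ 2 * W ^ 4 := by ring
        _ ≤ _ := by gcongr; norm_num
    have t2 : y ^ 4 ≤ B ^ 4 * ε ^ 2 * W ^ 10 := by
      calc y ^ 4 = (y ^ 2) ^ 2 := by ring
        _ ≤ (B ^ 2 * ε * W ^ 5) ^ 2 := by gcongr
        _ = _ := by ring
    have t3 : y ^ 2 * |X| ≤ B ^ 2 * A * ε ^ 2 * W ^ 10 := by
      calc y ^ 2 * |X| ≤ (B ^ 2 * ε * W ^ 5) * (A * ε * W ^ 2) := by gcongr
        _ = B ^ 2 * A * ε ^ 2 * W ^ 7 := by ring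
        _ ≤ _ := by gcongr; norm_num
    have t : X ^ 2 + y ^ 4 + y ^ 2 * |X| ≤ (A ^ 2 + B ^ 4 + B ^ 2 * A) * ε ^ 2 * W ^ 10 := by
      linarith only [t1, t2, t3]
    calc _ ≤ (A ^ 2 + B ^ 4 + B ^ 2 * A) * ε ^ 2 * W ^ 10 * Real.exp |X| := by gcongr
      _ ≤ _ := by gcongr
  calc |Real.exp X * Real.cos y - (1 + ε * laplaceWeight e₄ e₂ o₃ o₁ w)|
      = |(Real.exp X * Real.cos y - (1 + X - y ^ 2 / 2)) +
          ((1 + X - y ^ 2 / 2) - (1 + ε * laplaceWeight e₄ e₂ o₃ o₁ w))| := by congr 1; ring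
    _ ≤ _ := abs_add_le _ _
    _ ≤ (A ^ 2 + B ^ 4 + B ^ 2 * A) * ε ^ 2 * W ^ 10 * Real.exp (a / 4 * w) +
        (A + 3 * B ^ 2) * ε ^ 2 * W ^ 10 * Real.exp (a / 4 * w) :=
        add_le_add (hmain.trans hfirst) hrest
    _ = _ := by ring

lemma abs_laplaceWeight_le (e₄ e₂ o₃ o₁ : ℝ) {w : ℝ} (hw : 0 ≤ w) :
    |laplaceWeight e₄ e₂ o₃ o₁ w| ≤ (|e₄| + |e₂| + (|o₃| + |o₁|) ^ 2) * (1 + w) ^ 3 := by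
  have h1 : |o₃ * w + o₁| ≤ (|o₃| + |o₁|) * (1 + w) := by
    refine (abs_add_le _ _).trans ?_
    rw [abs_mul, abs_of_nonneg hw]
    have := mul_nonneg (abs_nonneg o₁) hw
    linarith [abs_nonneg o₃]
  have h2 : w ^ 2 ≤ (1 + w) ^ 3 := by nlinarith [pow_nonneg hw 3, sq_nonneg w]
  have h3 : w ≤ (1 + w) ^ 3 := by nlinarith [pow_nonneg hw 3, sq_nonneg w]
  calc |laplaceWeight e₄ e₂ o₃ o₁ w|
      ≤ |e₄ * w ^ 2| + |e₂ * w| + |w * (o₃ * w + o₁) ^ 2 / 2| :=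
        (abs_sub _ _).trans (add_le_add_left (abs_add_le _ _) _)
    _ = |e₄| * w ^ 2 + |e₂| * w + w * |o₃ * w + o₁| ^ 2 / 2 := by
        rw [abs_div, abs_mul, abs_mul, abs_mul, abs_two, abs_pow, abs_pow, abs_of_nonneg hw]
    _ ≤ |e₄| * (1 + w) ^ 3 + |e₂| * (1 + w) ^ 3 +
          (1 + w) * ((|o₃| + |o₁|) * (1 + w)) ^ 2 / 1 := by
        gcongr
        · linarith
        · norm_num
    _ = _ := by ring

/-- Rescaling by `√ε` turns the main term into Gaussian moments over the whole line. The remainder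
is dominated by `ε²` times a polynomial with weight `e^{-(a / 4) x²}`. Taking real parts suffices
because the price is real. -/
theorem laplace_integral {a C r₀ ε₀ e₄ e₂ o₃ o₁ : ℝ} (ha : 0 < a) (hC : 0 ≤ C) (hr₀ : 0 < r₀)
    (hε₀ : 0 < ε₀) (E : ℝ → ℝ → ℂ) (hcont : ∀ ε ∈ Ioo 0 ε₀, ContinuousOn (E ε) (Ioo (-r₀) r₀))
    (hre : ∀ ε ∈ Ioo 0 ε₀, ∀ ξ ∈ Ioo (-r₀) r₀,
      |ε * (E ε ξ).re - (-(a / 2) * ξ ^ 2 + e₄ * ξ ^ 4 + ε * e₂ * ξ ^ 2)| ≤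
        C * (ξ ^ 6 + ε * ξ ^ 4 + ε ^ 2 * ξ ^ 2))
    (him : ∀ ε ∈ Ioo 0 ε₀, ∀ ξ ∈ Ioo (-r₀) r₀,
      |ε * (E ε ξ).im - (o₃ * ξ ^ 3 + ε * o₁ * ξ)| ≤
        C * (|ξ| ^ 5 + ε * |ξ| ^ 3 + ε ^ 2 * |ξ|)) :
    ∃ r ∈ Ioc 0 r₀, (fun ε => (∫ ξ in Ioo (-r) r, (Complex.exp (E ε ξ)).re) -
      √ε * (√(2 * Real.pi / a) * (1 + ε * (3 * e₄ / a ^ 2 + e₂ / a - 15 * o₃ ^ 2 / (2 * a ^ 3)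
        - 3 * o₃ * o₁ / a ^ 2 - o₁ ^ 2 / (2 * a))))) =O[𝓝[>] 0] fun ε => √ε * ε ^ 2 := by
  obtain ⟨ρ, hρ, K, hK, hpt⟩ := laplace_pointwise ha hC e₄ e₂ o₃ o₁
  set r := min ρ r₀ with hr
  have hr0 : 0 < r := lt_min hρ hr₀
  set P := |e₄| + |e₂| + (|o₃| + |o₁|) ^ 2 with hP
  have hP0 : 0 ≤ P := by positivity
  -- The second summand covers the Gaussian outside the window: for `|ξ| ≥ r` one has `1 ≤ r⁻⁴ ε²
  -- (ξ² / ε)²`, so extending the integral also costs `O(ε²)`.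
  set K' := K + (1 + P) * (r ^ 4)⁻¹ with hK'
  set bd : ℝ → ℝ := fun x => x ^ 0 * (1 + x ^ 2) ^ 10 * Real.exp (-(a / 4) * x ^ 2) with hbd
  have hbdi : Integrable bd := integrable_pow_mul_one_add_sq_pow_mul_exp (by positivity) 10 0
  set p : ℝ → ℝ := laplaceWeight e₄ e₂ o₃ o₁ with hp
  refine ⟨r, ⟨hr0, min_le_right _ _⟩, IsBigO.of_bound (K' * ∫ x, bd x) ?_⟩
  have hev : ∀ᶠ ε in 𝓝[>] (0 : ℝ), ε ∈ Ioo 0 (min (min ρ ε₀) 1) :=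
    Ioo_mem_nhdsGT (lt_min (lt_min hρ hε₀) one_pos)
  filter_upwards [hev] with ε hε
  have hε0 : 0 < ε := hε.1
  have hερ : ε ∈ Ioo 0 ρ := ⟨hε0, hε.2.trans_le ((min_le_left _ _).trans (min_le_left _ _))⟩
  have hεε : ε ∈ Ioo 0 ε₀ := ⟨hε0, hε.2.trans_le ((min_le_left _ _).trans (min_le_right _ _))⟩
  have hε1 : ε ≤ 1 := hε.2.le.trans (min_le_right _ _)
  have hs : 0 < √ε := Real.sqrt_pos.mpr hε0
  have hw : ∀ ξ : ℝ, (ξ / √ε) ^ 2 = ξ ^ 2 / ε := fun ξ => by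
    rw [div_pow, Real.sq_sqrt hε0.le]
  set f : ℝ → ℝ := (Ioo (-r) r).indicator fun ξ => (Complex.exp (E ε ξ)).re with hf
  set g₀ : ℝ → ℝ := fun x => (1 + ε * p (x ^ 2)) * Real.exp (-(a / 2) * x ^ 2) with hg₀
  have hpc : Continuous p := by
    simp only [hp]; unfold laplaceWeight; fun_prop
  have hg₀b : ∀ x, |g₀ x| ≤ (1 + P) * bd x := by
    intro x
    have hx : 0 ≤ x ^ 2 := sq_nonneg x
    have h1 : |1 + ε * p (x ^ 2)| ≤ (1 + P) * (1 + x ^ 2) ^ 10 := by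
      have h2 := abs_laplaceWeight_le e₄ e₂ o₃ o₁ hx
      have h3 : (1 + x ^ 2) ^ 3 ≤ (1 + x ^ 2) ^ 10 :=
        pow_le_pow_right₀ (by linarith) (by norm_num)
      have h4 : 1 ≤ (1 + x ^ 2) ^ 10 := one_le_pow₀ (by linarith)
      calc |1 + ε * p (x ^ 2)| ≤ |1| + |ε * p (x ^ 2)| := abs_add_le _ _
        _ = 1 + ε * |p (x ^ 2)| := by rw [abs_one, abs_mul, abs_of_pos hε0]
        _ ≤ (1 + x ^ 2) ^ 10 + 1 * (P * (1 + x ^ 2) ^ 10) := by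
            gcongr
            exact h2.trans (by gcongr)
        _ = _ := by ring
    have h5 : Real.exp (-(a / 2) * x ^ 2) ≤ Real.exp (-(a / 4) * x ^ 2) := by
      apply Real.exp_le_exp.mpr; nlinarith
    simp only [hg₀, hbd]
    rw [abs_mul, Real.abs_exp, pow_zero, one_mul, ← mul_assoc]
    gcongr
  have hg₀i : Integrable g₀ := by
    refine Integrable.mono' (hbdi.const_mul (1 + P)) ?_ (Eventually.of_forall hg₀b)
    exact Continuous.aestronglyMeasurable (by fun_prop)
  have hgi := hg₀i.comp_div hs.ne'
  have hbi := (hbdi.comp_div hs.ne').const_mul (K' * ε ^ 2)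
  have hfg : ∀ ξ, |f ξ - g₀ (ξ / √ε)| ≤ K' * ε ^ 2 * bd (ξ / √ε) := by
    intro ξ
    have hbd0 : 0 ≤ bd (ξ / √ε) := by simp only [hbd]; positivity
    by_cases hξ : ξ ∈ Ioo (-r) r
    · have hξρ : |ξ| < ρ := (abs_lt.mpr hξ).trans_le (min_le_left _ _)
      have hξr : ξ ∈ Ioo (-r₀) r₀ := abs_lt.mp ((abs_lt.mpr hξ).trans_le (min_le_right _ _))
      have e1 : ε * ((E ε ξ).re + a / 2 * (ξ ^ 2 / ε)) = ε * (E ε ξ).re + a / 2 * ξ ^ 2 := by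
        field_simp
      have key := hpt ε hερ ξ hξρ ((E ε ξ).re + a / 2 * (ξ ^ 2 / ε)) (E ε ξ).im (by
        have := hre ε hεε ξ hξr
        rw [e1]
        convert this using 2; ring) (him ε hεε ξ hξr)
      have e2 : f ξ - g₀ (ξ / √ε) = Real.exp (-(a / 2) * (ξ ^ 2 / ε)) *
          (Real.exp ((E ε ξ).re + a / 2 * (ξ ^ 2 / ε)) * Real.cos (E ε ξ).im -
            (1 + ε * laplaceWeight e₄ e₂ o₃ o₁ (ξ ^ 2 / ε))) := by
        simp only [hf, hg₀]
        rw [indicator_of_mem hξ, Complex.exp_re, hw, mul_sub, ← mul_assoc, ← Real.exp_add]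
        congr 1
        · congr 2; ring
        · ring
      rw [e2, abs_mul, Real.abs_exp]
      calc _ ≤ Real.exp (-(a / 2) * (ξ ^ 2 / ε)) * (K * ε ^ 2 * (1 + ξ ^ 2 / ε) ^ 10 *
              Real.exp (a / 4 * (ξ ^ 2 / ε))) := by gcongr
        _ = K * ε ^ 2 * ((1 + ξ ^ 2 / ε) ^ 10 * (Real.exp (-(a / 2) * (ξ ^ 2 / ε)) *
              Real.exp (a / 4 * (ξ ^ 2 / ε)))) := by ring
        _ = K * ε ^ 2 * bd (ξ / √ε) := by
            simp only [hbd]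
            rw [← Real.exp_add, hw, pow_zero, one_mul]
            congr 3; ring
        _ ≤ _ := by
            gcongr
            rw [hK']
            have : 0 ≤ (1 + P) * (r ^ 4)⁻¹ := by positivity
            linarith
    · have hξr : r ≤ |ξ| := not_lt.mp fun h => hξ (abs_lt.mp h)
      rw [show f ξ = 0 from indicator_of_notMem hξ _, zero_sub, abs_neg]
      have h1 : 1 ≤ (r ^ 4)⁻¹ * (ε ^ 2 * (ξ ^ 2 / ε) ^ 2) := by
        have : ε ^ 2 * (ξ ^ 2 / ε) ^ 2 = |ξ| ^ 4 := by
          rw [show |ξ| ^ 4 = (|ξ| ^ 2) ^ 2 by ring, sq_abs]; field_simp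
        rw [this, ← div_eq_inv_mul, one_le_div (by positivity)]
        gcongr
      have hx : 0 ≤ ξ ^ 2 / ε := by positivity
      have h2 : |g₀ (ξ / √ε)| ≤ (1 + P) * ((1 + ξ ^ 2 / ε) ^ 3 *
          Real.exp (-(a / 4) * (ξ ^ 2 / ε))) := by
        have h3 := abs_laplaceWeight_le e₄ e₂ o₃ o₁ hx
        have h4 : 1 ≤ (1 + ξ ^ 2 / ε) ^ 3 := one_le_pow₀ (by linarith)
        have h5 : Real.exp (-(a / 2) * (ξ ^ 2 / ε)) ≤ Real.exp (-(a / 4) * (ξ ^ 2 / ε)) := by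
          apply Real.exp_le_exp.mpr; nlinarith
        simp only [hg₀]
        rw [abs_mul, Real.abs_exp, hw, ← mul_assoc]
        gcongr
        calc |1 + ε * p (ξ ^ 2 / ε)| ≤ |1| + |ε * p (ξ ^ 2 / ε)| := abs_add_le _ _
          _ = 1 + ε * |p (ξ ^ 2 / ε)| := by rw [abs_one, abs_mul, abs_of_pos hε0]
          _ ≤ (1 + ξ ^ 2 / ε) ^ 3 + 1 * (P * (1 + ξ ^ 2 / ε) ^ 3) := by gcongr
          _ = _ := by ring
      calc |g₀ (ξ / √ε)| ≤ (1 + P) * ((1 + ξ ^ 2 / ε) ^ 3 *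
            Real.exp (-(a / 4) * (ξ ^ 2 / ε))) * 1 := by rw [mul_one]; exact h2
        _ ≤ (1 + P) * ((1 + ξ ^ 2 / ε) ^ 3 * Real.exp (-(a / 4) * (ξ ^ 2 / ε))) *
              ((r ^ 4)⁻¹ * (ε ^ 2 * (1 + ξ ^ 2 / ε) ^ 2)) := by
            have : ξ ^ 2 / ε ≤ 1 + ξ ^ 2 / ε := by linarith
            gcongr
            exact h1.trans (by gcongr)
        _ = (1 + P) * (r ^ 4)⁻¹ * ε ^ 2 * ((1 + ξ ^ 2 / ε) ^ 5 *
              Real.exp (-(a / 4) * (ξ ^ 2 / ε))) := by ring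
        _ ≤ K' * ε ^ 2 * ((1 + ξ ^ 2 / ε) ^ 10 * Real.exp (-(a / 4) * (ξ ^ 2 / ε))) := by
            have h6 : (1 + ξ ^ 2 / ε) ^ 5 ≤ (1 + ξ ^ 2 / ε) ^ 10 :=
              pow_le_pow_right₀ (by linarith) (by norm_num)
            have h7 : (1 + P) * (r ^ 4)⁻¹ ≤ K' := by rw [hK']; linarith
            gcongr
        _ = _ := by simp only [hbd]; rw [hw, pow_zero, one_mul]
  have hfi : Integrable f := by
    refine Integrable.mono' (hgi.norm.add hbi) ?_ (Eventually.of_forall fun ξ => ?_)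
    · rw [hf, aestronglyMeasurable_indicator_iff measurableSet_Ioo]
      refine ContinuousOn.aestronglyMeasurable ?_ measurableSet_Ioo
      have hsub : Ioo (-r) r ⊆ Ioo (-r₀) r₀ :=
        Ioo_subset_Ioo (neg_le_neg (min_le_right _ _)) (min_le_right _ _)
      have h1 := (hcont ε hεε).mono hsub
      exact Complex.continuous_re.comp_continuousOn (Complex.continuous_exp.comp_continuousOn h1)
    · have h1 := hfg ξ
      have h2 : |f ξ| ≤ |f ξ - g₀ (ξ / √ε)| + |g₀ (ξ / √ε)| := by
        simpa using abs_add_le (f ξ - g₀ (ξ / √ε)) (g₀ (ξ / √ε))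
      simp only [Real.norm_eq_abs, Pi.add_apply]
      linarith
  have hint1 : ∫ ξ, g₀ (ξ / √ε) = √ε * ∫ x, g₀ x := by
    rw [Measure.integral_comp_div, abs_of_pos hs, smul_eq_mul]
  have hint2 : ∫ ξ, bd (ξ / √ε) = √ε * ∫ x, bd x := by
    rw [Measure.integral_comp_div, abs_of_pos hs, smul_eq_mul]
  rw [← integral_laplaceWeight ha, ← integral_indicator measurableSet_Ioo]
  change ‖(∫ ξ, f ξ) - √ε * ∫ x, g₀ x‖ ≤ _
  rw [← hint1, ← integral_sub hfi hgi]
  refine (norm_integral_le_of_norm_le hbi (Eventually.of_forall hfg)).trans (le_of_eq ?_)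
  rw [integral_const_mul, hint2, Real.norm_eq_abs, abs_of_nonneg (by positivity)]
  ring

/-- Taylor expansion along a vertical line of a function that is real on the real axis. -/
lemma vertical_taylor {f : ℂ → ℂ} {g : ℝ → ℝ} {u R A : ℝ} (hR : 0 < R)
    (hf : DifferentiableOn ℂ f (Metric.ball (u : ℂ) R)) (hA : ∀ z ∈ Metric.ball (u : ℂ) R, ‖f z‖ ≤ A)
    (hfg : ∀ x : ℝ, (x : ℂ) ∈ Metric.ball (u : ℂ) R → f x = g x) (n : ℕ) {ξ : ℝ}
    (hξ : |ξ| ≤ R / 4) :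
    ‖f (u + ξ * Complex.I) - ∑ j ∈ Finset.range n,
      (((j.factorial : ℝ)⁻¹ * iteratedDeriv j g u : ℝ) : ℂ) * (ξ * Complex.I) ^ j‖ ≤
      2 * A * (2 / R) ^ n * |ξ| ^ n := by
  have hn : ‖((u : ℂ) + ξ * Complex.I) - u‖ = |ξ| := by simp
  have h := taylor_remainder_bound hR hf hA n (z := u + ξ * Complex.I) (by rw [hn]; exact hξ)
  rw [hn] at h
  have hu : (u : ℂ) ∈ Metric.ball (u : ℂ) R := Metric.mem_ball_self hR
  convert h using 1
  · congr 2
    refine Finset.sum_congr rfl fun j _ => ?_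
    rw [iteratedDeriv_eq_of_real Metric.isOpen_ball hf hfg j u hu]
    simp
  · rw [mul_div_right_comm, mul_pow]; ring

/-- Even powers of `iξ` are real and odd ones imaginary, so the error of each part skips one order.
The constant `C` dominates the Taylor constants of all orders up to six. -/
lemma vertical_taylor_re_im {f : ℂ → ℂ} {g : ℝ → ℝ} {u R A : ℝ} (hR : 0 < R)
    (hf : DifferentiableOn ℂ f (Metric.ball (u : ℂ) R)) (hA : ∀ z ∈ Metric.ball (u : ℂ) R, ‖f z‖ ≤ A)
    (hfg : ∀ x : ℝ, (x : ℂ) ∈ Metric.ball (u : ℂ) R → f x = g x) {ξ : ℝ} (hξ : |ξ| ≤ R / 4) :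
    let C := 2 * A * (1 + 2 / R) ^ 6
    let z := f (u + ξ * Complex.I)
    |z.im| ≤ C * |ξ| ∧ |z.re - g u| ≤ C * ξ ^ 2 ∧
    |z.im - iteratedDeriv 1 g u * ξ| ≤ C * |ξ| ^ 3 ∧
    |z.re - g u + iteratedDeriv 2 g u / 2 * ξ ^ 2| ≤ C * ξ ^ 4 ∧
    |z.im - iteratedDeriv 1 g u * ξ + iteratedDeriv 3 g u / 6 * ξ ^ 3| ≤ C * |ξ| ^ 5 ∧
    |z.re - g u + iteratedDeriv 2 g u / 2 * ξ ^ 2 - iteratedDeriv 4 g u / 24 * ξ ^ 4| ≤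
      C * ξ ^ 6 := by
  intro C z
  have hA0 : 0 ≤ A := (norm_nonneg _).trans (hA u (Metric.mem_ball_self hR))
  have hC : ∀ n ≤ 6, 2 * A * (2 / R) ^ n ≤ C := by
    intro n hn
    calc 2 * A * (2 / R) ^ n ≤ 2 * A * (1 + 2 / R) ^ n := by gcongr; linarith
      _ ≤ C := by
        have : 1 ≤ 1 + 2 / R := by linarith [div_pos two_pos hR]
        simp only [C]; gcongr
  have h : ∀ n ≤ 6, ‖z - ∑ j ∈ Finset.range n,
      (((j.factorial : ℝ)⁻¹ * iteratedDeriv j g u : ℝ) : ℂ) * (ξ * Complex.I) ^ j‖ ≤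
      C * |ξ| ^ n := fun n hn => (vertical_taylor hR hf hA hfg n hξ).trans (by
    gcongr; exact hC n hn)
  have hI : ∀ n : ℕ, (ξ * Complex.I) ^ n = (ξ ^ n : ℝ) * Complex.I ^ n := fun n => by
    rw [mul_pow]; push_cast; rfl
  have i4 : Complex.I ^ 4 = 1 := Complex.I_pow_four
  have i3 : Complex.I ^ 3 = -Complex.I := Complex.I_pow_three
  have i5 : Complex.I ^ 5 = Complex.I := by rw [pow_succ, i4, one_mul]
  refine ⟨?_, ?_, ?_, ?_, ?_, ?_⟩
  · refine ((Complex.abs_im_le_norm _).trans (h 1 (by norm_num))).trans' (le_of_eq ?_) |>.trans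
      (by simp)
    simp
  · refine ((Complex.abs_re_le_norm _).trans (h 2 (by norm_num))).trans' (le_of_eq ?_) |>.trans
      (by simp)
    simp [Finset.sum_range_succ]
  · refine ((Complex.abs_im_le_norm _).trans (h 3 (by norm_num))).trans' (le_of_eq ?_)
    simp only [Finset.sum_range_succ, hI, Complex.I_sq]
    simp [-Complex.ofReal_pow]
  · refine ((Complex.abs_re_le_norm _).trans (h 4 (by norm_num))).trans' (le_of_eq ?_) |>.trans
      (by rw [show |ξ| ^ 4 = (|ξ| ^ 2) ^ 2 by ring, sq_abs]; exact le_of_eq (by ring))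
    simp only [Finset.sum_range_succ, hI, Complex.I_sq, i3]
    simp [-Complex.ofReal_pow]
    congr 1; ring
  · refine ((Complex.abs_im_le_norm _).trans (h 5 (by norm_num))).trans' (le_of_eq ?_)
    simp only [Finset.sum_range_succ, hI, Complex.I_sq, i3, i4]
    simp [-Complex.ofReal_pow, Nat.factorial]
    congr 1; ring
  · refine ((Complex.abs_re_le_norm _).trans (h 6 (by norm_num))).trans' (le_of_eq ?_) |>.trans
      (by rw [show |ξ| ^ 6 = (|ξ| ^ 2) ^ 3 by ring, sq_abs]; exact le_of_eq (by ring))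
    simp only [Finset.sum_range_succ, hI, Complex.I_sq, i3, i4, i5]
    simp [-Complex.ofReal_pow, Nat.factorial]
    congr 1; ring

/-- Laplace's method along a vertical line through a critical point of a family of analytic
functions that is real on the real axis. -/
theorem vertical_laplace {u R ε₀ B : ℝ} (hR : 0 < R) (hε₀ : 0 < ε₀) (hB : 0 ≤ B)
    {Q : ℝ → ℂ → ℂ} {H₀ H₁ : ℂ → ℂ} {g₀ g₁ : ℝ → ℝ}
    (hH₀ : DifferentiableOn ℂ H₀ (Metric.ball (u : ℂ) R))
    (hH₁ : DifferentiableOn ℂ H₁ (Metric.ball (u : ℂ) R))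
    (hg₀ : ∀ x : ℝ, (x : ℂ) ∈ Metric.ball (u : ℂ) R → H₀ x = g₀ x)
    (hg₁ : ∀ x : ℝ, (x : ℂ) ∈ Metric.ball (u : ℂ) R → H₁ x = g₁ x)
    (hQ : ∀ ε ∈ Ioo 0 ε₀, DifferentiableOn ℂ (Q ε) (Metric.ball (u : ℂ) R))
    (hQr : ∀ ε ∈ Ioo 0 ε₀, ∀ x : ℝ, (x : ℂ) ∈ Metric.ball (u : ℂ) R → (Q ε x).im = 0)
    (hQB : ∀ ε ∈ Ioo 0 ε₀, ∀ z ∈ Metric.ball (u : ℂ) R, ‖Q ε z - H₀ z - ε * H₁ z‖ ≤ B * ε ^ 2)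
    (ha : 0 < iteratedDeriv 2 g₀ u) :
    ∃ r ∈ Ioo 0 R, (fun ε => (∫ ξ in Ioo (-r) r,
        (Complex.exp ((Q ε (u + ξ * Complex.I) - Q ε u - ξ * deriv g₀ u * Complex.I) / ε)).re) -
      √ε * (√(2 * Real.pi / iteratedDeriv 2 g₀ u) * (1 + ε * (
        3 * (iteratedDeriv 4 g₀ u / 24) / iteratedDeriv 2 g₀ u ^ 2
        + (-iteratedDeriv 2 g₁ u / 2) / iteratedDeriv 2 g₀ u
        - 15 * (-iteratedDeriv 3 g₀ u / 6) ^ 2 / (2 * iteratedDeriv 2 g₀ u ^ 3)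
        - 3 * (-iteratedDeriv 3 g₀ u / 6) * deriv g₁ u / iteratedDeriv 2 g₀ u ^ 2
        - deriv g₁ u ^ 2 / (2 * iteratedDeriv 2 g₀ u))))) =O[𝓝[>] 0] fun ε => √ε * ε ^ 2 := by
  set k := deriv g₀ u with hk
  have hk1 : iteratedDeriv 1 g₀ u = k := by rw [iteratedDeriv_one]
  have hl1 : iteratedDeriv 1 g₁ u = deriv g₁ u := by rw [iteratedDeriv_one]
  have hR2 : 0 < R / 2 := by positivity
  have hsub : Metric.ball (u : ℂ) (R / 2) ⊆ Metric.ball (u : ℂ) R :=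
    Metric.ball_subset_ball (by linarith)
  have hcb : Metric.closedBall (u : ℂ) (R / 2) ⊆ Metric.ball (u : ℂ) R :=
    Metric.closedBall_subset_ball (by linarith)
  have hbd : ∀ H : ℂ → ℂ, DifferentiableOn ℂ H (Metric.ball (u : ℂ) R) →
      ∃ A, ∀ z ∈ Metric.ball (u : ℂ) (R / 2), ‖H z‖ ≤ A := by
    intro H hH
    obtain ⟨A, hA⟩ := (isCompact_closedBall (u : ℂ) (R / 2)).exists_bound_of_continuousOn
      (hH.continuousOn.mono hcb)
    exact ⟨A, fun z hz => hA z (Metric.ball_subset_closedBall hz)⟩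
  obtain ⟨A₀, hA₀⟩ := hbd H₀ hH₀
  obtain ⟨A₁, hA₁⟩ := hbd H₁ hH₁
  have hA₀0 : 0 ≤ A₀ := (norm_nonneg _).trans (hA₀ u (Metric.mem_ball_self hR2))
  have hA₁0 : 0 ≤ A₁ := (norm_nonneg _).trans (hA₁ u (Metric.mem_ball_self hR2))
  set c := 2 * (1 + 2 / (R / 2)) ^ 6 with hc
  have hc0 : 0 ≤ c := by positivity
  set C := c * (A₀ + A₁ + B) with hC
  have hC0 : 0 ≤ C := by positivity
  have hmem : ∀ ξ ∈ Ioo (-(R / 8)) (R / 8), |ξ| ≤ R / 2 / 4 := fun ξ hξ => by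
    have := abs_lt.mpr hξ; linarith
  have hball : ∀ ξ ∈ Ioo (-(R / 8)) (R / 8), (u : ℂ) + ξ * Complex.I ∈ Metric.ball (u : ℂ) R := by
    intro ξ hξ
    have := hmem ξ hξ
    simp [dist_eq_norm]; linarith
  set E : ℝ → ℝ → ℂ := fun ε ξ => (Q ε (u + ξ * Complex.I) - Q ε u - ξ * k * Complex.I) / ε with hE
  have hparts : ∀ ε ∈ Ioo 0 ε₀, ∀ ξ ∈ Ioo (-(R / 8)) (R / 8), ∃ X Y Z W x₀ y₀ : ℝ,
      |X - g₀ u + iteratedDeriv 2 g₀ u / 2 * ξ ^ 2 - iteratedDeriv 4 g₀ u / 24 * ξ ^ 4| ≤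
        c * A₀ * ξ ^ 6 ∧
      |Y - k * ξ + iteratedDeriv 3 g₀ u / 6 * ξ ^ 3| ≤ c * A₀ * |ξ| ^ 5 ∧
      |Z - g₁ u + iteratedDeriv 2 g₁ u / 2 * ξ ^ 2| ≤ c * A₁ * ξ ^ 4 ∧
      |W - deriv g₁ u * ξ| ≤ c * A₁ * |ξ| ^ 3 ∧
      |x₀| ≤ c * B * ξ ^ 2 ∧ |y₀| ≤ c * B * |ξ| ∧
      ε * (E ε ξ).re = X - g₀ u + ε * (Z - g₁ u) + ε ^ 2 * x₀ ∧
      ε * (E ε ξ).im = Y - k * ξ + ε * W + ε ^ 2 * y₀ := by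
    intro ε hε ξ hξ
    have hε0 : (ε : ℂ) ≠ 0 := by exact_mod_cast hε.1.ne'
    have hξ' := hmem ξ hξ
    -- The rescaled remainder is holomorphic, bounded by `B` and real on the axis. Parity makes its
    -- increment `O(ξ²)` in the real part and `O(|ξ|)` in the imaginary part, so no expansion
    -- coefficient of order two is needed.
    set F : ℂ → ℂ := fun z => (Q ε z - H₀ z - ε * H₁ z) / ε ^ 2 with hF
    have hFd : DifferentiableOn ℂ F (Metric.ball (u : ℂ) (R / 2)) :=
      ((((hQ ε hε).sub hH₀).sub (hH₁.const_mul _)).div_const _).mono hsub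
    have hFB : ∀ z ∈ Metric.ball (u : ℂ) (R / 2), ‖F z‖ ≤ B := by
      intro z hz
      rw [hF, norm_div, norm_pow, Complex.norm_real, Real.norm_of_nonneg hε.1.le,
        div_le_iff₀ (by have := hε.1; positivity)]
      exact hQB ε hε z (hsub hz)
    have hFr : ∀ x : ℝ, (x : ℂ) ∈ Metric.ball (u : ℂ) (R / 2) → F x = ((F x).re : ℝ) := by
      intro x hx
      have e : Q ε x = ((Q ε x).re : ℝ) := by
        apply Complex.ext <;> simp [hQr ε hε x (hsub hx)]
      apply Complex.ext
      · simp
      · rw [Complex.ofReal_im]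
        simp only [hF]
        rw [hg₀ x (hsub hx), hg₁ x (hsub hx), e, ← Complex.ofReal_pow, ← Complex.ofReal_mul,
          ← Complex.ofReal_sub, ← Complex.ofReal_sub, ← Complex.ofReal_div, Complex.ofReal_im]
    obtain ⟨-, -, -, -, p5, p6⟩ := vertical_taylor_re_im hR2 (hH₀.mono hsub) hA₀
      (fun x hx => hg₀ x (hsub hx)) hξ'
    obtain ⟨-, -, q3, q4, -, -⟩ := vertical_taylor_re_im hR2 (hH₁.mono hsub) hA₁
      (fun x hx => hg₁ x (hsub hx)) hξ'
    obtain ⟨s1, s2, -, -, -, -⟩ := vertical_taylor_re_im hR2 hFd hFB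
      (g := fun x => (F x).re) hFr hξ'
    rw [hk1] at p5
    rw [hl1] at q3
    have hcc : ∀ A, 2 * A * (1 + 2 / (R / 2)) ^ 6 = c * A := fun A => by rw [hc]; ring
    rw [hcc] at p5 p6 q3 q4 s1 s2
    have hu : (u : ℂ) ∈ Metric.ball (u : ℂ) R := Metric.mem_ball_self hR
    have hQe : ∀ z, Q ε z = H₀ z + ε * H₁ z + ε ^ 2 * F z := by
      intro z; simp only [hF]; field_simp; ring
    have hFu : F u = ((F u).re : ℝ) := hFr u (Metric.mem_ball_self hR2)
    have hEe : (ε : ℂ) * E ε ξ = H₀ (u + ξ * Complex.I) - (g₀ u : ℝ) +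
        (ε : ℝ) * (H₁ (u + ξ * Complex.I) - (g₁ u : ℝ)) +
        ((ε ^ 2 : ℝ) : ℂ) * (F (u + ξ * Complex.I) - ((F u).re : ℝ)) -
        ((ξ * k : ℝ) : ℂ) * Complex.I := by
      rw [← hFu, ← hg₀ u hu, ← hg₁ u hu]
      simp only [hE]
      rw [mul_div_cancel₀ _ hε0, hQe, hQe]
      push_cast; ring
    refine ⟨_, _, _, _, (F (u + ξ * Complex.I)).re - (F u).re, (F (u + ξ * Complex.I)).im,
      p6, p5, q4, q3, s2, s1, ?_, ?_⟩
    · have := congrArg Complex.re hEe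
      simpa [-Complex.ofReal_pow, -Complex.ofReal_mul] using this
    · have := congrArg Complex.im hEe
      simp [-Complex.ofReal_pow, -Complex.ofReal_mul] at this
      linarith
  have hres := laplace_integral (r₀ := R / 8) (e₄ := iteratedDeriv 4 g₀ u / 24)
    (e₂ := -iteratedDeriv 2 g₁ u / 2) (o₃ := -iteratedDeriv 3 g₀ u / 6) (o₁ := deriv g₁ u)
    ha hC0 (by positivity) hε₀ E ?_ ?_ ?_
  · obtain ⟨r, hr, h⟩ := hres
    exact ⟨r, ⟨hr.1, by linarith [hr.2]⟩, h⟩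
  · intro ε hε
    refine ContinuousOn.div_const (ContinuousOn.sub (ContinuousOn.sub ?_ continuousOn_const)
      (by fun_prop)) _
    exact (hQ ε hε).continuousOn.comp (by fun_prop) hball
  · intro ε hε ξ hξ
    obtain ⟨X, Y, Z, W, x₀, y₀, h1, -, h3, -, h5, -, h7, -⟩ := hparts ε hε ξ hξ
    rw [h7]
    have e : X - g₀ u + ε * (Z - g₁ u) + ε ^ 2 * x₀ - (-(iteratedDeriv 2 g₀ u / 2) * ξ ^ 2 +
        iteratedDeriv 4 g₀ u / 24 * ξ ^ 4 + ε * (-iteratedDeriv 2 g₁ u / 2) * ξ ^ 2) =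
        (X - g₀ u + iteratedDeriv 2 g₀ u / 2 * ξ ^ 2 - iteratedDeriv 4 g₀ u / 24 * ξ ^ 4) +
        ε * (Z - g₁ u + iteratedDeriv 2 g₁ u / 2 * ξ ^ 2) + ε ^ 2 * x₀ := by ring
    rw [e]
    have hε0 := hε.1.le
    calc _ ≤ |X - g₀ u + iteratedDeriv 2 g₀ u / 2 * ξ ^ 2 - iteratedDeriv 4 g₀ u / 24 * ξ ^ 4| +
          ε * |Z - g₁ u + iteratedDeriv 2 g₁ u / 2 * ξ ^ 2| + ε ^ 2 * |x₀| := by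
          refine (abs_add_three _ _ _).trans (le_of_eq ?_)
          rw [abs_mul, abs_mul, abs_of_nonneg hε0, abs_of_nonneg (sq_nonneg ε)]
      _ ≤ c * A₀ * ξ ^ 6 + ε * (c * A₁ * ξ ^ 4) + ε ^ 2 * (c * B * ξ ^ 2) := by gcongr
      _ ≤ C * ξ ^ 6 + ε * (C * ξ ^ 4) + ε ^ 2 * (C * ξ ^ 2) := by
          rw [hC]
          have k6 : 0 ≤ ξ ^ 6 := by positivity
          have k4 : 0 ≤ ξ ^ 4 := by positivity
          gcongr <;> linarith
      _ = _ := by ring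
  · intro ε hε ξ hξ
    obtain ⟨X, Y, Z, W, x₀, y₀, -, h2, -, h4, -, h6, -, h8⟩ := hparts ε hε ξ hξ
    rw [h8]
    have e : Y - k * ξ + ε * W + ε ^ 2 * y₀ - (-iteratedDeriv 3 g₀ u / 6 * ξ ^ 3 +
        ε * deriv g₁ u * ξ) =
        (Y - k * ξ + iteratedDeriv 3 g₀ u / 6 * ξ ^ 3) + ε * (W - deriv g₁ u * ξ) + ε ^ 2 * y₀ := by
      ring
    rw [e]
    have hε0 := hε.1.le
    calc _ ≤ |Y - k * ξ + iteratedDeriv 3 g₀ u / 6 * ξ ^ 3| + ε * |W - deriv g₁ u * ξ| +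
            ε ^ 2 * |y₀| := by
          refine (abs_add_three _ _ _).trans (le_of_eq ?_)
          rw [abs_mul, abs_mul, abs_of_nonneg hε0, abs_of_nonneg (sq_nonneg ε)]
      _ ≤ c * A₀ * |ξ| ^ 5 + ε * (c * A₁ * |ξ| ^ 3) + ε ^ 2 * (c * B * |ξ|) := by gcongr
      _ ≤ C * |ξ| ^ 5 + ε * (C * |ξ| ^ 3) + ε ^ 2 * (C * |ξ|) := by
          rw [hC]
          gcongr <;> linarith
      _ = _ := by ring

/-! ### Exponential smallness of the moment generating function off the real axis -/

section

variable {Ω : Type*} [MeasurableSpace Ω] {P : Measure Ω} {Y : ℝ → Ω → ℝ}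
  {Λ₀ Λ₁ Λ₂ : ℝ → ℝ} {ReΛ₀ : ℂ → ℝ}

lemma reLmgf_ofReal (ε u : ℝ) : reLmgf P Y ε u = lmgf P Y ε u := by
  rw [reLmgf, scaledComplexMGF_ofReal, Complex.norm_real, Real.norm_eq_abs, Real.log_abs, lmgf, cgf]

lemma norm_le_exp_of_reLmgf_le {ε x : ℝ} {z : ℂ} (hε : 0 < ε)
    (h : scaledComplexMGF P Y ε z ≠ 0 → reLmgf P Y ε z ≤ x) :
    ‖scaledComplexMGF P Y ε z‖ ≤ Real.exp (x / ε) := by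
  by_cases h0 : scaledComplexMGF P Y ε z = 0
  · rw [h0, norm_zero]; positivity
  · rw [← Real.log_le_iff_le_exp (norm_pos_iff.mpr h0), le_div_iff₀ hε, mul_comm]
    exact h h0

lemma Admissible.eventually_limitInterior_subset (hA : Admissible P Y Λ₀ Λ₁ Λ₂ ReΛ₀) :
    ∀ᶠ ε in 𝓝[>] (0 : ℝ), limitInterior P Y ⊆ lmgfDomain P Y ε := by
  obtain ⟨ε₀, hε₀, h, -⟩ := hA.smooth
  filter_upwards [Ioo_mem_nhdsGT hε₀] with ε hε using h ε hε

lemma Admissible.ReΛ₀_ofReal (hA : Admissible P Y Λ₀ Λ₁ Λ₂ ReΛ₀) {u : ℝ}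
    (hu : u ∈ limitInterior P Y) (hu0 : u ≠ 0) : ReΛ₀ u = Λ₀ u := by
  obtain ⟨-, h⟩ := hA.tail_expansion (u : ℂ) (by simpa using hu) (by simpa using hu0)
  have ht : Tendsto (fun ε : ℝ => (ε, (u : ℂ))) (𝓝[>] 0) ((𝓝[>] (0 : ℝ)) ×ˢ (𝓝 (u : ℂ))) :=
    tendsto_id.prodMk tendsto_const_nhds
  have h1 : (fun ε : ℝ => reLmgf P Y ε u - ReΛ₀ u) =O[𝓝[>] 0] fun ε => ε := h.comp_tendsto ht
  have h2 : Tendsto (fun ε : ℝ => reLmgf P Y ε u - ReΛ₀ u) (𝓝[>] 0) (𝓝 0) :=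
    h1.trans_tendsto (tendsto_id.mono_left nhdsWithin_le_nhds)
  have h3 : Tendsto (fun ε : ℝ => reLmgf P Y ε u - ReΛ₀ u) (𝓝[>] 0) (𝓝 (Λ₀ u - ReΛ₀ u)) := by
    simp_rw [reLmgf_ofReal]
    exact (hA.tendsto_lmgf hu).sub_const _
  have := tendsto_nhds_unique h2 h3
  linarith

/-- No continuity of `ReΛ₀` is assumed. A small `ε₂` is frozen, `reLmgf` at `ε₂` is continuous, and
the tail expansion transfers its values to other `ε`. Four errors of at most `η / 8` consume half of
the gap at `z₀`. -/
lemma Admissible.local_tail_bound (hA : Admissible P Y Λ₀ Λ₁ Λ₂ ReΛ₀) {u p : ℝ}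
    (hu : u ∈ limitInterior P Y) (hu0 : u ≠ 0) (hp : p ≠ 0) :
    ∃ η > 0, ∀ᶠ q in (𝓝[>] (0 : ℝ)) ×ˢ (𝓝 (⟨u, p⟩ : ℂ)),
      ‖scaledComplexMGF P Y q.1 q.2‖ ≤ Real.exp ((Λ₀ u - η) / q.1) := by
  set z₀ : ℂ := ⟨u, p⟩ with hz₀
  obtain ⟨hne, hO⟩ := hA.tail_expansion z₀ hu hu0
  obtain ⟨c, hc, hO⟩ := hO.exists_pos
  rw [IsBigOWith] at hO
  have hmax : ReΛ₀ z₀ < Λ₀ u := by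
    have := hA.tail_max u hu hu0 p hp
    rwa [show (⟨u, 0⟩ : ℂ) = (u : ℂ) from rfl, hA.ReΛ₀_ofReal hu hu0] at this
  set η := Λ₀ u - ReΛ₀ z₀ with hη
  have hη0 : 0 < η := sub_pos.mpr hmax
  obtain ⟨pa, hpa, pb, hpb, hab⟩ := eventually_prod_iff.mp (hne.and hO)
  have hsmall : ∀ᶠ ε in 𝓝[>] (0 : ℝ), ε ∈ Ioo 0 (η / (8 * c)) := Ioo_mem_nhdsGT (by positivity)
  obtain ⟨ε₂, ⟨h1, h2⟩, h3⟩ := ((hpa.and hsmall).and hA.eventually_limitInterior_subset).exists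
  have hcε : ∀ ε ∈ Ioo 0 (η / (8 * c)), c * ε ≤ η / 8 := by
    intro ε hε
    have := hε.2.le
    rw [le_div_iff₀ (by positivity)] at this
    linarith
  have hcont : ContinuousAt (fun z => reLmgf P Y ε₂ z) z₀ := by
    have hd := (differentiableAt_scaledComplexMGF h2.1 h3 (z := z₀) hu).continuousAt
    have hne0 : scaledComplexMGF P Y ε₂ z₀ ≠ 0 := (hab h1 hpb.self_of_nhds).1
    exact (hd.norm.log (norm_ne_zero_iff.mpr hne0)).const_mul _
  have hlt : ∀ᶠ z in 𝓝 z₀, reLmgf P Y ε₂ z < reLmgf P Y ε₂ z₀ + η / 8 :=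
    hcont.eventually_lt continuousAt_const (by linarith)
  refine ⟨η / 2, by positivity, eventually_prod_iff.mpr ⟨_, hpa.and hsmall, _, hpb.and hlt, ?_⟩⟩
  rintro ε ⟨hε, hεI⟩ z ⟨hz, hzlt⟩
  refine norm_le_exp_of_reLmgf_le hεI.1 fun _ => ?_
  have a1 := (abs_le.mp (hab hε hz).2).2
  have a2 := (abs_le.mp (hab h1 hz).2).1
  have a3 := (abs_le.mp (hab h1 hpb.self_of_nhds).2).2
  simp only [Real.norm_eq_abs, abs_of_pos hεI.1, abs_of_pos h2.1] at a1 a2 a3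
  have b1 := hcε ε hεI
  have b2 := hcε ε₂ h2
  have e : Λ₀ u = ReΛ₀ z₀ + η := by rw [hη]; ring
  change reLmgf P Y ε z ≤ _
  linarith

lemma Admissible.compact_tail_bound (hA : Admissible P Y Λ₀ Λ₁ Λ₂ ReΛ₀) {u : ℝ}
    (hu : u ∈ limitInterior P Y) (hu0 : u ≠ 0) {s : Set ℝ} (hs : IsCompact s)
    (h0 : (0 : ℝ) ∉ s) :
    ∃ η > 0, ∀ᶠ ε in 𝓝[>] (0 : ℝ), ∀ p ∈ s,
      ‖scaledComplexMGF P Y ε ⟨u, p⟩‖ ≤ Real.exp ((Λ₀ u - η) / ε) := by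
  refine hs.induction_on (p := fun s => ∃ η > 0, ∀ᶠ ε in 𝓝[>] (0 : ℝ), ∀ p ∈ s,
      ‖scaledComplexMGF P Y ε ⟨u, p⟩‖ ≤ Real.exp ((Λ₀ u - η) / ε)) ?_ ?_ ?_ ?_
  · exact ⟨1, one_pos, by simp⟩
  · rintro s t hst ⟨η, hη, h⟩
    exact ⟨η, hη, h.mono fun ε hε p hp => hε p (hst hp)⟩
  · rintro s t ⟨η₁, h₁, h⟩ ⟨η₂, h₂, h'⟩
    refine ⟨min η₁ η₂, lt_min h₁ h₂, ?_⟩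
    filter_upwards [h, h', self_mem_nhdsWithin] with ε e1 e2 (hε : 0 < ε) p hp
    have m1 := min_le_left η₁ η₂
    have m2 := min_le_right η₁ η₂
    rcases hp with hp | hp
    · exact (e1 p hp).trans (by gcongr)
    · exact (e2 p hp).trans (by gcongr)
  · intro p hp
    obtain ⟨η, hη, h⟩ := hA.local_tail_bound hu hu0 (p := p) (fun h => h0 (h ▸ hp))
    obtain ⟨pa, hpa, pb, hpb, hab⟩ := eventually_prod_iff.mp h
    have hc : ContinuousAt (fun p : ℝ => (⟨u, p⟩ : ℂ)) p := by
      have : (fun p : ℝ => (⟨u, p⟩ : ℂ)) = fun p : ℝ => (u : ℂ) + p * Complex.I := by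
        ext p; exact Complex.mk_eq_add_mul_I _ _
      rw [this]; fun_prop
    exact ⟨_, mem_nhdsWithin_of_mem_nhds (hc.eventually hpb), η, hη,
      hpa.mono fun ε hε q hq => hab hε hq⟩

/-- Bounded imaginary parts are handled by compactness, large ones by the gap at infinity with the
uniform error `M ε`, which contributes only the factor `e^{|M|}`. -/
theorem Admissible.tail_bound (hA : Admissible P Y Λ₀ Λ₁ Λ₂ ReΛ₀) {u r : ℝ}
    (hu : u ∈ limitInterior P Y) (hu0 : u ≠ 0) (hr : 0 < r) :
    ∃ η > 0, ∃ C ≥ 0, ∀ᶠ ε in 𝓝[>] (0 : ℝ), ∀ p : ℝ, r ≤ |p| →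
      ‖scaledComplexMGF P Y ε ⟨u, p⟩‖ ≤ C * Real.exp ((Λ₀ u - η) / ε) := by
  obtain ⟨η₁, hη₁, K, hK⟩ := hA.tail_gap u hu hu0
  obtain ⟨ε₁, hε₁, p₀, -, M, hM⟩ := hA.tail_uniform u hu hu0
  have hs : IsCompact (Icc (-(max K p₀)) (max K p₀) ∩ {p : ℝ | r ≤ |p|}) :=
    isCompact_Icc.inter_right (isClosed_le continuous_const continuous_abs)
  obtain ⟨η₂, hη₂, h⟩ := hA.compact_tail_bound hu hu0 hs (fun h0 => by
    have : r ≤ |(0 : ℝ)| := h0.2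
    rw [abs_zero] at this; linarith)
  refine ⟨min η₁ η₂, lt_min hη₁ hη₂, Real.exp |M|, (Real.exp_pos _).le, ?_⟩
  have m1 := min_le_left η₁ η₂
  have m2 := min_le_right η₁ η₂
  filter_upwards [h, Ioo_mem_nhdsGT hε₁] with ε h hε p hp
  have hε0 : 0 < ε := hε.1
  by_cases hpK : |p| ≤ max K p₀
  · calc _ ≤ 1 * Real.exp ((Λ₀ u - η₂) / ε) := by
          rw [one_mul]; exact h p ⟨abs_le.mp hpK, hp⟩
      _ ≤ _ := by
          gcongr
          exact Real.one_le_exp (abs_nonneg M)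
  · have hpK := not_le.mp hpK
    have h1 := hK p ((le_max_left _ _).trans hpK.le)
    rw [show (⟨u, 0⟩ : ℂ) = (u : ℂ) from rfl, hA.ReΛ₀_ofReal hu hu0] at h1
    have h2 : ‖scaledComplexMGF P Y ε ⟨u, p⟩‖ ≤ Real.exp ((Λ₀ u - η₁ + M * ε) / ε) :=
      norm_le_exp_of_reLmgf_le hε0 fun hne => by
        have := hM p ((le_max_right _ _).trans hpK.le) ε ⟨hε0, hε.2.le⟩ hne
        linarith
    refine h2.trans ?_
    rw [add_div, mul_div_cancel_right₀ _ hε0.ne', add_comm, Real.exp_add]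
    gcongr
    exact le_abs_self M

end

/-! ### Expansion of the Fourier integral -/

lemma norm_log_sub_log_le {w₁ w₂ : ℂ} (h₁ : w₁ ∈ Metric.ball (1 : ℂ) (1 / 2))
    (h₂ : w₂ ∈ Metric.ball (1 : ℂ) (1 / 2)) :
    ‖Complex.log w₁ - Complex.log w₂‖ ≤ 2 * ‖w₁ - w₂‖ := by
  have hre : ∀ w ∈ Metric.ball (1 : ℂ) (1 / 2), 1 / 2 < w.re := by
    intro w hw
    rw [Metric.mem_ball, dist_eq_norm] at hw
    have h := (abs_lt.mp ((Complex.abs_re_le_norm (w - 1)).trans_lt hw)).1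
    simp only [Complex.sub_re, Complex.one_re] at h
    linarith
  refine (convex_ball (1 : ℂ) (1 / 2)).norm_image_sub_le_of_norm_hasDerivWithin_le
    (f' := fun w => w⁻¹) (fun w hw => (Complex.hasDerivAt_log
      (Or.inl (by linarith [hre w hw]))).hasDerivWithinAt) (fun w hw => ?_) h₂ h₁
  rw [norm_inv]
  refine inv_le_of_inv_le₀ two_pos ?_
  have := (hre w hw).le.trans ((le_abs_self _).trans (Complex.abs_re_le_norm w))
  linarith

/-- Derivatives of the corrected first-order coefficient once the kernel `1 / (z (z - ε))` is moved
into the exponent. -/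
lemma iteratedDeriv_sub_log {f : ℝ → ℝ} {u : ℝ} (hf : ContDiffAt ℝ 2 f u) (hu : u ≠ 0) (c : ℝ) :
    deriv (fun x => f x - 2 * (Real.log x - c)) u = deriv f u - 2 / u ∧
    iteratedDeriv 2 (fun x => f x - 2 * (Real.log x - c)) u = iteratedDeriv 2 f u + 2 / u ^ 2 := by
  have hev : ∀ᶠ x in 𝓝 u, deriv (fun x => f x - 2 * (Real.log x - c)) x
      = deriv f x - 2 * x⁻¹ := by
    have h1 : ∀ᶠ x in 𝓝 u, ContDiffAt ℝ 2 f x := hf.eventually (by simp)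
    filter_upwards [h1, isOpen_ne.mem_nhds hu] with x hx hx0
    have hd := (hx.differentiableAt (by norm_num)).hasDerivAt.sub
      (((Real.hasDerivAt_log hx0).sub_const c).const_mul 2)
    exact hd.deriv
  refine ⟨by rw [hev.self_of_nhds]; ring, ?_⟩
  have hd2 : DifferentiableAt ℝ (deriv f) u := by
    have h := hf.fderiv_right (m := 1) (by norm_num)
    have h2 : DifferentiableAt ℝ (fun x => fderiv ℝ f x 1) u :=
      (h.differentiableAt (by norm_num)).clm_apply (differentiableAt_const _)
    simpa only [fderiv_apply_one_eq_deriv] using h2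
  rw [iteratedDeriv_succ, iteratedDeriv_one, iteratedDeriv_succ, iteratedDeriv_one,
    Filter.EventuallyEq.deriv_eq hev]
  have hd := hd2.hasDerivAt.sub ((hasDerivAt_inv hu).const_mul 2)
  refine hd.deriv.trans ?_
  field_simp
  ring

section

variable {Ω : Type*} [MeasurableSpace Ω] {P : Measure Ω} [IsProbabilityMeasure P]
  {Y : ℝ → Ω → ℝ} {Λ₀ Λ₁ Λ₂ : ℝ → ℝ} {ReΛ₀ : ℂ → ℝ}

/-- Second-order coefficient in the expansion of the normalised Fourier integral. -/
noncomputable def fourierCoeff (Λ₀ Λ₁ : ℝ → ℝ) (u : ℝ) : ℝ :=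
  3 * (iteratedDeriv 4 Λ₀ u / 24) / iteratedDeriv 2 Λ₀ u ^ 2
    + (-(iteratedDeriv 2 Λ₁ u + 2 / u ^ 2) / 2) / iteratedDeriv 2 Λ₀ u
    - 15 * (-iteratedDeriv 3 Λ₀ u / 6) ^ 2 / (2 * iteratedDeriv 2 Λ₀ u ^ 3)
    - 3 * (-iteratedDeriv 3 Λ₀ u / 6) * (deriv Λ₁ u - 2 / u) / iteratedDeriv 2 Λ₀ u ^ 2
    - (deriv Λ₁ u - 2 / u) ^ 2 / (2 * iteratedDeriv 2 Λ₀ u)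

/-- The factor that normalises the Fourier integrand to the value one at the saddlepoint. -/
noncomputable def fourierNormalizer (P : Measure Ω) (Y : ℝ → Ω → ℝ) (u k ε : ℝ) : ℝ :=
  u * (u - ε) * Real.exp (-((lmgf P Y ε u - u * k) / ε))

/-- The normalised kernel is written as an exponential: `log (z / u) + log ((z - ε) / (u - ε))`
equals `2 log (z / u) + O(ε)`. So `Λ₁` is replaced by `Λ₁ - 2 (log x - log u)`, and
`vertical_laplace` applies. -/
theorem Admissible.central_expansion (hA : Admissible P Y Λ₀ Λ₁ Λ₂ ReΛ₀) {u : ℝ}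
    (hu : u ∈ limitInterior P Y) (hu0 : u ≠ 0) :
    ∃ r > 0, (fun ε => (∫ ξ in Ioo (-r) r, (fourierNormalizer P Y u (deriv Λ₀ u) ε *
        priceIntegrand P (Y ε) u ε (deriv Λ₀ u) ξ).re) -
      √ε * (√(2 * Real.pi / iteratedDeriv 2 Λ₀ u) * (1 + ε * fourierCoeff Λ₀ Λ₁ u)))
        =O[𝓝[>] 0] fun ε => √ε * ε ^ 2 := by
  obtain ⟨r₁, hr₁, ε₁, hε₁, B, hB, L, H₀, H₁, -, hH₀, hH₁, hg₀, hg₁, hL⟩ :=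
    hA.exists_uniform_expansion hu hu0
  obtain ⟨-, hC2, ha⟩ := hA.regularity hu hu0
  obtain ⟨hd1, hd2⟩ := iteratedDeriv_sub_log hC2 hu0 (Real.log u)
  have hau : 0 < |u| := abs_pos.mpr hu0
  -- With both `‖z - u‖` and `ε` below `|u| / 4`, the two quotients stay within `1 / 2` of `1`,
  -- where the principal logarithm is holomorphic and 2-Lipschitz.
  set R := min r₁ (|u| / 4) with hR
  have hR0 : 0 < R := lt_min hr₁ (by positivity)
  have hsub : Metric.ball (u : ℂ) R ⊆ Metric.ball (u : ℂ) r₁ :=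
    Metric.ball_subset_ball (min_le_left _ _)
  have hzu : ∀ z ∈ Metric.ball (u : ℂ) R, ‖z - u‖ < |u| / 4 := fun z hz => by
    rw [Metric.mem_ball, dist_eq_norm] at hz
    exact hz.trans_le (min_le_right _ _)
  set ε₂ := min ε₁ (|u| / 4) with hε₂
  have hε₂0 : 0 < ε₂ := lt_min hε₁ (by positivity)
  have hεε : ∀ ε ∈ Ioo 0 ε₂, ε ∈ Ioo 0 ε₁ := fun ε hε => ⟨hε.1, hε.2.trans_le (min_le_left _ _)⟩
  have huε : ∀ ε ∈ Ioo 0 ε₂, 3 / 4 * |u| ≤ |u - ε| := by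
    intro ε hε
    have h1 := abs_sub_abs_le_abs_sub u ε
    have h2 := hε.2.trans_le (min_le_right _ _)
    rw [abs_of_pos hε.1] at h1
    linarith
  have huε0 : ∀ ε ∈ Ioo 0 ε₂, u - ε ≠ 0 := fun ε hε h => by
    have := huε ε hε
    rw [h, abs_zero] at this
    linarith
  have hb1 : ∀ z ∈ Metric.ball (u : ℂ) R, z / u ∈ Metric.ball (1 : ℂ) (1 / 2) := by
    intro z hz
    have hu' : (u : ℂ) ≠ 0 := by exact_mod_cast hu0
    rw [Metric.mem_ball, dist_eq_norm, div_sub_one hu', norm_div, Complex.norm_real,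
      Real.norm_eq_abs, div_lt_iff₀ hau]
    linarith [hzu z hz]
  have hb2 : ∀ ε ∈ Ioo 0 ε₂, ∀ z ∈ Metric.ball (u : ℂ) R,
      (z - ε) / ((u - ε : ℝ) : ℂ) ∈ Metric.ball (1 : ℂ) (1 / 2) := by
    intro ε hε z hz
    have hu' : ((u - ε : ℝ) : ℂ) ≠ 0 := by exact_mod_cast huε0 ε hε
    have e : z - ε - ((u - ε : ℝ) : ℂ) = z - u := by push_cast; ring
    have h1 := huε ε hε
    rw [Metric.mem_ball, dist_eq_norm, div_sub_one hu', e, norm_div, Complex.norm_real,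
      Real.norm_eq_abs, div_lt_iff₀ (by linarith)]
    linarith [hzu z hz]
  have hslit : ∀ w ∈ Metric.ball (1 : ℂ) (1 / 2), w ∈ Complex.slitPlane := by
    intro w hw
    rw [Metric.mem_ball, dist_eq_norm] at hw
    have h := (abs_lt.mp ((Complex.abs_re_le_norm (w - 1)).trans_lt hw)).1
    simp only [Complex.sub_re, Complex.one_re] at h
    exact Or.inl (by linarith)
  have hlogr : ∀ x : ℝ, (x : ℂ) ∈ Metric.ball (1 : ℂ) (1 / 2) →
      Complex.log x = (Real.log x : ℝ) := by
    intro x hx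
    have : 0 < x := by simpa using hslit x hx
    exact (Complex.ofReal_log this.le).symm
  set Q : ℝ → ℂ → ℂ := fun ε z =>
    L ε z - ε * (Complex.log (z / u) + Complex.log ((z - ε) / ((u - ε : ℝ) : ℂ))) with hQ
  have hlog1 : DifferentiableOn ℂ (fun z : ℂ => Complex.log (z / u)) (Metric.ball (u : ℂ) R) :=
    fun z hz => ((by fun_prop : DifferentiableAt ℂ (fun z : ℂ => z / u) z).clog
      (hslit _ (hb1 z hz))).differentiableWithinAt
  have hlog2 : ∀ ε ∈ Ioo 0 ε₂, DifferentiableOn ℂ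
      (fun z : ℂ => Complex.log ((z - ε) / ((u - ε : ℝ) : ℂ))) (Metric.ball (u : ℂ) R) :=
    fun ε hε z hz => ((by fun_prop :
      DifferentiableAt ℂ (fun z : ℂ => (z - ε) / ((u - ε : ℝ) : ℂ)) z).clog
      (hslit _ (hb2 ε hε z hz))).differentiableWithinAt
  have hx1 : ∀ x : ℝ, (x : ℂ) ∈ Metric.ball (u : ℂ) R →
      Complex.log ((x : ℂ) / u) = (Real.log x - Real.log u : ℝ) := by
    intro x hx
    have h1 := hb1 x hx
    rw [← Complex.ofReal_div] at h1 ⊢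
    have hx0 : x ≠ 0 := by
      rintro rfl
      have := hzu _ hx
      simp at this
      linarith
    rw [hlogr _ h1, Real.log_div hx0 hu0]
  -- The extra `1 / |u|` in the remainder bound pays for replacing the second logarithm by the
  -- first: the arguments differ by at most `ε / (2 |u|)`.
  have key := vertical_laplace (u := u) (R := R) (ε₀ := ε₂) (B := B + 1 / |u|) (Q := Q)
    (H₀ := H₀) (H₁ := fun z => H₁ z - 2 * Complex.log (z / u)) (g₀ := Λ₀)
    (g₁ := fun x => Λ₁ x - 2 * (Real.log x - Real.log u)) hR0 hε₂0 (by positivity)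
    (hH₀.mono hsub) ((hH₁.mono hsub).sub (hlog1.const_mul _))
    (fun x hx => hg₀ x (hsub hx))
    (fun x hx => by
      rw [hg₁ x (hsub hx), hx1 x hx]; push_cast; ring)
    (fun ε hε => ((hL ε (hεε ε hε)).1.mono hsub).sub
      ((hlog1.add (hlog2 ε hε)).const_mul _))
    (fun ε hε x hx => by
      have h2 := hb2 ε hε x hx
      simp only [hQ]
      rw [hx1 x hx, (hL ε (hεε ε hε)).2.2.1 x (hsub hx)]
      rw [← Complex.ofReal_sub, ← Complex.ofReal_div] at h2 ⊢
      rw [hlogr _ h2, ← Complex.ofReal_add, ← Complex.ofReal_mul, ← Complex.ofReal_sub,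
        Complex.ofReal_im])
    (fun ε hε z hz => by
      have h1 := (hL ε (hεε ε hε)).2.2.2 z (hsub hz)
      have h2 := norm_log_sub_log_le (hb2 ε hε z hz) (hb1 z hz)
      have hu' : (u : ℂ) ≠ 0 := by exact_mod_cast hu0
      have hu'' : ((u - ε : ℝ) : ℂ) ≠ 0 := by exact_mod_cast huε0 ε hε
      have e : (z - ε) / ((u - ε : ℝ) : ℂ) - z / u = ε * (z - u) / (((u - ε : ℝ) : ℂ) * u) := by
        rw [div_sub_div _ _ hu'' hu']
        congr 1
        push_cast; ring
      have h3 : ‖(z - ε) / ((u - ε : ℝ) : ℂ) - z / u‖ ≤ ε / (2 * |u|) := by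
        rw [e, norm_div, norm_mul, norm_mul, Complex.norm_real, Complex.norm_real,
          Complex.norm_real, Real.norm_eq_abs, Real.norm_eq_abs, Real.norm_eq_abs,
          abs_of_pos hε.1]
        have h4 := huε ε hε
        rw [div_le_div_iff₀ (by nlinarith) (by positivity)]
        have h5 : ‖z - u‖ * 2 ≤ |u - ε| := by linarith [hzu z hz]
        have h6 : 0 ≤ ε * |u| := mul_nonneg hε.1.le hau.le
        nlinarith
      have e2 : Q ε z - H₀ z - ε * (H₁ z - 2 * Complex.log (z / u)) =
          (L ε z - H₀ z - ε * H₁ z) -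
            ε * (Complex.log ((z - ε) / ((u - ε : ℝ) : ℂ)) - Complex.log (z / u)) := by
        simp only [hQ]; ring
      rw [e2]
      refine (norm_sub_le _ _).trans ?_
      rw [norm_mul, Complex.norm_real, Real.norm_eq_abs, abs_of_pos hε.1]
      have h7 : ε * ‖Complex.log ((z - ε) / ((u - ε : ℝ) : ℂ)) - Complex.log (z / u)‖ ≤
          ε * (2 * (ε / (2 * |u|))) := by
        have := hε.1.le
        gcongr
        exact h2.trans (by gcongr)
      have h8 : ε * (2 * (ε / (2 * |u|))) = 1 / |u| * ε ^ 2 := by field_simp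
      rw [add_mul]
      linarith)
    ha
  obtain ⟨r, hr, hO⟩ := key
  refine ⟨r, hr.1, ?_⟩
  rw [hd1, hd2] at hO
  refine hO.congr' ?_ EventuallyEq.rfl
  filter_upwards [Ioo_mem_nhdsGT hε₂0] with ε hε
  congr 1
  refine setIntegral_congr_fun measurableSet_Ioo fun ξ hξ => ?_
  congr 1
  have hε0 : (ε : ℂ) ≠ 0 := by exact_mod_cast hε.1.ne'
  have hzm : (u : ℂ) + ξ * Complex.I ∈ Metric.ball (u : ℂ) R := by
    have := (abs_lt.mpr hξ).trans hr.2
    simpa [dist_eq_norm] using this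
  have hum : (u : ℂ) ∈ Metric.ball (u : ℂ) R := Metric.mem_ball_self hR0
  have hu' : (u : ℂ) ≠ 0 := by exact_mod_cast hu0
  have hu'' : ((u - ε : ℝ) : ℂ) ≠ 0 := by exact_mod_cast huε0 ε hε
  have hexpQ : ∀ z ∈ Metric.ball (u : ℂ) R, Complex.exp (Q ε z / ε) =
      scaledComplexMGF P Y ε z * ((z / u) * ((z - ε) / ((u - ε : ℝ) : ℂ)))⁻¹ := by
    intro z hz
    simp only [hQ]
    rw [sub_div, mul_div_cancel_left₀ _ hε0, Complex.exp_sub, Complex.exp_add,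
      Complex.exp_log (Complex.slitPlane_ne_zero (hslit _ (hb1 z hz))),
      Complex.exp_log (Complex.slitPlane_ne_zero (hslit _ (hb2 ε hε z hz))),
      (hL ε (hεε ε hε)).2.1 z (hsub hz), div_eq_mul_inv]
  have hQu : Q ε u = (lmgf P Y ε u : ℝ) := by
    simp only [hQ]
    rw [(hL ε (hεε ε hε)).2.2.1 u (hsub hum), div_self hu', Complex.log_one,
      show (u : ℂ) - ε = ((u - ε : ℝ) : ℂ) by push_cast; rfl, div_self hu'', Complex.log_one]
    simp
  rw [sub_div, sub_div, Complex.exp_sub, Complex.exp_sub, hexpQ _ hzm, hQu, fourierNormalizer,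
    priceIntegrand, otmKernel, ← scaledComplexMGF]
  have hk : Complex.exp (-(u + ξ * Complex.I) * deriv Λ₀ u / ε) =
      Complex.exp (-(u * deriv Λ₀ u / ε)) * (Complex.exp (ξ * deriv Λ₀ u * Complex.I / ε))⁻¹ := by
    rw [← Complex.exp_neg, ← Complex.exp_add]; congr 1; ring
  have hk2 : ((Real.exp (-((lmgf P Y ε u - u * deriv Λ₀ u) / ε)) : ℝ) : ℂ) =
      (Complex.exp ((lmgf P Y ε u : ℝ) / ε))⁻¹ * (Complex.exp (-(u * deriv Λ₀ u / ε)))⁻¹ := by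
    rw [← Complex.exp_neg, ← Complex.exp_neg, ← Complex.exp_add]
    push_cast; congr 1; ring
  rw [hk, Complex.ofReal_mul, hk2]
  have he := Complex.exp_ne_zero (-(u * deriv Λ₀ u / ε : ℂ))
  have e3 : (u : ℂ) + ξ * Complex.I - ε = ((u - ε : ℝ) : ℂ) + ξ * Complex.I := by push_cast; ring
  rw [e3, Complex.ofReal_mul]
  field_simp

end

/-! ### Tail integral and logarithm of the price -/

section

variable {Ω : Type*} [MeasurableSpace Ω] {P : Measure Ω} {Y : ℝ → Ω → ℝ}
  {Λ₀ Λ₁ Λ₂ : ℝ → ℝ} {ReΛ₀ : ℂ → ℝ}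

lemma norm_priceIntegrand (u ε k ξ : ℝ) : ‖priceIntegrand P (Y ε) u ε k ξ‖ =
    ‖otmKernel u ε ξ‖ * (Real.exp (-(u * k / ε)) * ‖scaledComplexMGF P Y ε ⟨u, ξ⟩‖) := by
  rw [priceIntegrand, norm_mul, norm_mul, Complex.norm_exp, scaledComplexMGF,
    Complex.mk_eq_add_mul_I]
  congr 3
  rw [show -((u : ℂ) + ξ * Complex.I) * k / ε =
    ((-(u * k / ε) : ℝ) : ℂ) + ((-(ξ * k / ε) : ℝ) : ℂ) * Complex.I by push_cast; ring]
  simp [-Complex.ofReal_neg, -Complex.ofReal_div, -Complex.ofReal_mul]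

lemma integrable_priceIntegrand {u ε k : ℝ} (hε : 0 < ε) (hu0 : u ≠ 0) (huε : u - ε ≠ 0)
    (h : limitInterior P Y ⊆ lmgfDomain P Y ε) (hu : u ∈ limitInterior P Y) :
    Integrable (priceIntegrand P (Y ε) u ε k) := by
  have hc : Continuous fun ξ : ℝ => Complex.exp (-(u + ξ * Complex.I) * k / ε) *
      complexMGF (Y ε) P ((u + ξ * Complex.I) / ε) := by
    refine Continuous.mul (by fun_prop) (continuous_iff_continuousAt.mpr fun ξ => ?_)
    have h1 := (differentiableAt_scaledComplexMGF hε h (z := u + ξ * Complex.I)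
      (by simpa using hu)).continuousAt
    exact h1.comp (f := fun ξ : ℝ => (u : ℂ) + ξ * Complex.I) (by fun_prop)
  have h2 := (integrable_inv_mul hu0 huε).bdd_mul (c := Real.exp (-(u * k / ε)) *
    mgf (Y ε) P (u / ε)) hc.aestronglyMeasurable (Eventually.of_forall fun ξ => by
      rw [norm_mul, Complex.norm_exp]
      have h3 := norm_scaledComplexMGF_le (P := P) (Y := Y) ε (u + ξ * Complex.I)
      rw [scaledComplexMGF] at h3
      gcongr
      · rw [show -((u : ℂ) + ξ * Complex.I) * k / ε =
          ((-(u * k / ε) : ℝ) : ℂ) + ((-(ξ * k / ε) : ℝ) : ℂ) * Complex.I by push_cast; ring]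
        simp [-Complex.ofReal_neg, -Complex.ofReal_div, -Complex.ofReal_mul]
      · simpa using h3)
  refine h2.congr (Eventually.of_forall fun ξ => ?_)
  simp only [priceIntegrand, otmKernel]
  ring

lemma exp_neg_div_isBigO {η : ℝ} (hη : 0 < η) :
    (fun ε : ℝ => Real.exp (-η / ε)) =O[𝓝[>] 0] fun ε => √ε * ε ^ 2 := by
  refine IsBigO.of_bound (6 / η ^ 3) ?_
  filter_upwards [Ioo_mem_nhdsGT one_pos] with ε hε
  have hε0 := hε.1
  have h1 := Real.pow_div_factorial_le_exp (η / ε) (by positivity) 3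
  have h2 : ε ≤ √ε := Real.le_sqrt_of_sq_le (by nlinarith [hε.2])
  rw [Real.norm_eq_abs, Real.abs_exp, Real.norm_eq_abs, abs_of_nonneg (by positivity), neg_div,
    Real.exp_neg]
  calc (Real.exp (η / ε))⁻¹ ≤ ((η / ε) ^ 3 / (3 : ℕ).factorial)⁻¹ := by gcongr
    _ = 6 / η ^ 3 * (ε * ε ^ 2) := by
        simp [Nat.factorial]; field_simp
    _ ≤ _ := by gcongr

variable [IsProbabilityMeasure P]

theorem Admissible.fourier_expansion (hA : Admissible P Y Λ₀ Λ₁ Λ₂ ReΛ₀) {u : ℝ}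
    (hu : u ∈ limitInterior P Y) (hu0 : u ≠ 0) :
    (fun ε => fourierNormalizer P Y u (deriv Λ₀ u) ε *
        (∫ ξ, priceIntegrand P (Y ε) u ε (deriv Λ₀ u) ξ).re -
      √ε * (√(2 * Real.pi / iteratedDeriv 2 Λ₀ u) * (1 + ε * fourierCoeff Λ₀ Λ₁ u)))
        =O[𝓝[>] 0] fun ε => √ε * ε ^ 2 := by
  obtain ⟨r, hr, hcen⟩ := hA.central_expansion hu hu0
  obtain ⟨η, hη, C, hC, htail⟩ := hA.tail_bound hu hu0 hr
  have hau : 0 < |u| := abs_pos.mpr hu0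
  set k := deriv Λ₀ u with hk
  set m := min 1 (u ^ 2 / 4) with hm
  have hm0 : 0 < m := lt_min one_pos (by positivity)
  have hsmall : ∀ᶠ ε in 𝓝[>] (0 : ℝ), ε ∈ Ioo 0 (|u| / 2) := Ioo_mem_nhdsGT (by positivity)
  -- The normaliser contains `Λ_ε(u)`, the tail bound `Λ₀(u)`. Their difference is `O(ε)`, so after
  -- division by `ε` the mismatch is only a bounded factor `e^M`.
  have hlow : ∃ M, ∀ᶠ ε in 𝓝[>] (0 : ℝ), Λ₀ u - lmgf P Y ε u ≤ M * ε := by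
    have h1 : (fun ε : ℝ => lmgf P Y ε u - Λ₀ u) =O[𝓝[>] 0] fun ε => ε := by
      have e1 : (fun ε : ℝ => ε ^ 3) =O[𝓝[>] 0] fun ε => ε :=
        isBigO_pow_of_eq_mul (n := 1) (g := fun ε => ε ^ 2) (by fun_prop)
          (Eventually.of_forall fun ε => by ring) |>.congr_right (by simp)
      have e2 : (fun ε : ℝ => Λ₁ u * ε + Λ₂ u * ε ^ 2) =O[𝓝[>] 0] fun ε => ε :=
        isBigO_pow_of_eq_mul (n := 1) (g := fun ε => Λ₁ u + Λ₂ u * ε) (by fun_prop)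
          (Eventually.of_forall fun ε => by ring) |>.congr_right (by simp)
      exact (((hA.expansion u hu).trans e1).add e2).congr_left fun ε => by ring
    obtain ⟨M, hM⟩ := h1.bound
    refine ⟨M, ?_⟩
    filter_upwards [hM, self_mem_nhdsWithin] with ε h (hε : 0 < ε)
    rw [Real.norm_eq_abs, Real.norm_eq_abs, abs_of_pos hε] at h
    linarith [(abs_le.mp h).1]
  obtain ⟨M, hM⟩ := hlow
  have hrest : (fun ε => ∫ ξ in (Ioo (-r) r)ᶜ, (fourierNormalizer P Y u k ε *
      priceIntegrand P (Y ε) u ε k ξ).re) =O[𝓝[>] 0] fun ε => √ε * ε ^ 2 := by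
    refine IsBigO.trans (IsBigO.of_bound
      ((2 * u ^ 2) * Real.exp M * C * (m⁻¹ * Real.pi)) ?_) (exp_neg_div_isBigO hη)
    filter_upwards [hsmall, htail, hM] with ε hε ht hM
    have hε0 : 0 < ε := hε.1
    have hq : m ≤ (u - ε) ^ 2 := by
      have h1 : |u| / 2 ≤ |u - ε| := by
        have h1 := abs_sub_abs_le_abs_sub u ε
        rw [abs_of_pos hε0] at h1
        linarith [hε.2]
      calc m ≤ u ^ 2 / 4 := min_le_right _ _
        _ = (|u| / 2) ^ 2 := by rw [div_pow, sq_abs]; norm_num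
        _ ≤ |u - ε| ^ 2 := by gcongr
        _ = _ := sq_abs _
    have hp : m ≤ u ^ 2 := (min_le_right _ _).trans (by nlinarith [sq_nonneg u])
    have hker : ∀ ξ, ‖otmKernel u ε ξ‖ ≤ m⁻¹ * (1 + ξ ^ 2)⁻¹ := by
      intro ξ
      rw [otmKernel, norm_inv, ← mul_inv]
      exact inv_anti₀ (by positivity) (le_norm_add_mul_I_mul hm0.le (min_le_left _ _) hp hq ξ)
    have hnorm : |fourierNormalizer P Y u k ε| ≤
        2 * u ^ 2 * Real.exp (-((lmgf P Y ε u - u * k) / ε)) := by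
      rw [fourierNormalizer, abs_mul, Real.abs_exp]
      gcongr
      rw [abs_mul, ← sq_abs u]
      have : |u - ε| ≤ 2 * |u| := by
        refine (abs_sub _ _).trans ?_
        rw [abs_of_pos hε0]; linarith [hε.2]
      nlinarith
    have hb : ∀ ξ ∈ (Ioo (-r) r)ᶜ, ‖(fourierNormalizer P Y u k ε *
        priceIntegrand P (Y ε) u ε k ξ).re‖ ≤
        (2 * u ^ 2) * Real.exp M * C * Real.exp (-η / ε) * (m⁻¹ * (1 + ξ ^ 2)⁻¹) := by
      intro ξ hξ
      have hξr : r ≤ |ξ| := not_lt.mp fun h => hξ (abs_lt.mp h)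
      refine (Complex.abs_re_le_norm _).trans ?_
      rw [norm_mul, Complex.norm_real, Real.norm_eq_abs, norm_priceIntegrand]
      calc _ ≤ (2 * u ^ 2 * Real.exp (-((lmgf P Y ε u - u * k) / ε))) *
            ((m⁻¹ * (1 + ξ ^ 2)⁻¹) * (Real.exp (-(u * k / ε)) *
              (C * Real.exp ((Λ₀ u - η) / ε)))) := by
            gcongr
            · exact hker ξ
            · exact ht ξ hξr
        _ = 2 * u ^ 2 * C * (m⁻¹ * (1 + ξ ^ 2)⁻¹) *
              (Real.exp (-((lmgf P Y ε u - u * k) / ε)) * Real.exp (-(u * k / ε)) *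
                Real.exp ((Λ₀ u - η) / ε)) := by ring
        _ = 2 * u ^ 2 * C * (m⁻¹ * (1 + ξ ^ 2)⁻¹) *
              (Real.exp ((Λ₀ u - lmgf P Y ε u) / ε) * Real.exp (-η / ε)) := by
            rw [← Real.exp_add, ← Real.exp_add, ← Real.exp_add]
            congr 2; ring
        _ ≤ 2 * u ^ 2 * C * (m⁻¹ * (1 + ξ ^ 2)⁻¹) * (Real.exp M * Real.exp (-η / ε)) := by
            gcongr
            rwa [div_le_iff₀ hε0]
        _ = _ := by ring
    have hint : Integrable fun ξ : ℝ => (2 * u ^ 2) * Real.exp M * C * Real.exp (-η / ε) *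
        (m⁻¹ * (1 + ξ ^ 2)⁻¹) := (integrable_inv_one_add_sq.const_mul _).const_mul _
    calc _ ≤ ∫ ξ in (Ioo (-r) r)ᶜ, (2 * u ^ 2) * Real.exp M * C * Real.exp (-η / ε) *
          (m⁻¹ * (1 + ξ ^ 2)⁻¹) :=
          norm_integral_le_of_norm_le hint.integrableOn
            ((ae_restrict_iff' measurableSet_Ioo.compl).mpr (Eventually.of_forall hb))
      _ ≤ ∫ ξ : ℝ, (2 * u ^ 2) * Real.exp M * C * Real.exp (-η / ε) *
          (m⁻¹ * (1 + ξ ^ 2)⁻¹) :=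
          setIntegral_le_integral hint (Eventually.of_forall fun ξ => by positivity)
      _ = _ := by
          rw [integral_const_mul, integral_const_mul, integral_univ_inv_one_add_sq,
            Real.norm_eq_abs, Real.abs_exp]
          ring
  refine (hcen.add hrest).congr' ?_ EventuallyEq.rfl
  filter_upwards [hsmall, hA.eventually_limitInterior_subset] with ε hε hsub
  have huε : u - ε ≠ 0 := by
    intro h
    have : u = ε := by linarith
    have h2 := hε.2
    rw [this, abs_of_pos hε.1] at h2
    linarith [hε.1]
  have hI := (integrable_priceIntegrand (k := k) hε.1 hu0 huε hsub hu).const_mul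
    (fourierNormalizer P Y u k ε : ℂ)
  have e1 : ∫ ξ, (fourierNormalizer P Y u k ε * priceIntegrand P (Y ε) u ε k ξ).re =
      fourierNormalizer P Y u k ε * (∫ ξ, priceIntegrand P (Y ε) u ε k ξ).re := by
    have h1 := integral_re (𝕜 := ℂ) hI
    simp only [RCLike.re_to_complex] at h1
    rw [h1, integral_const_mul, Complex.re_ofReal_mul]
  have e2 := integral_add_compl (measurableSet_Ioo (a := -r) (b := r)) hI.re
  simp only [RCLike.re_to_complex] at e2
  rw [← e1, ← e2]
  ring

lemma log_isBigO_of_laplace {D : ℝ → ℝ} {s U : ℝ} (hs : 0 < s)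
    (hD : (fun ε => D ε - √ε * (s * (1 + ε * U))) =O[𝓝[>] 0] fun ε => √ε * ε ^ 2) :
    (∀ᶠ ε in 𝓝[>] (0 : ℝ), 0 < D ε) ∧
    (fun ε => Real.log (D ε) - (1 / 2 * Real.log ε + Real.log s + U * ε))
      =O[𝓝[>] 0] fun ε => ε ^ 2 := by
  set N : ℝ → ℝ := fun ε => D ε / (√ε * s) with hN
  have h1 : (fun ε => N ε - (1 + ε * U)) =O[𝓝[>] 0] fun ε => ε ^ 2 := by
    have h2 := hD.mul (isBigO_refl (fun ε : ℝ => (√ε * s)⁻¹) (𝓝[>] 0))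
    have h3 : (fun ε => √ε * ε ^ 2 * (√ε * s)⁻¹) =O[𝓝[>] 0] fun ε => ε ^ 2 := by
      refine isBigO_pow_of_eq_mul (g := fun _ => s⁻¹) (by fun_prop) ?_
      filter_upwards [self_mem_nhdsWithin] with ε (hε : 0 < ε)
      have := Real.sqrt_pos.mpr hε
      field_simp
    refine (h2.trans h3).congr' ?_ EventuallyEq.rfl
    filter_upwards [self_mem_nhdsWithin] with ε (hε : 0 < ε)
    have := Real.sqrt_pos.mpr hε
    simp only [hN]
    field_simp
  have h2 : (fun ε => N ε - 1) =O[𝓝[>] 0] fun ε => ε := by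
    have e1 : (fun ε : ℝ => ε ^ 2) =O[𝓝[>] 0] fun ε => ε :=
      isBigO_pow_of_eq_mul (n := 1) (g := fun ε => ε) (by fun_prop)
        (Eventually.of_forall fun ε => by ring) |>.congr_right (by simp)
    have e2 : (fun ε : ℝ => ε * U) =O[𝓝[>] 0] fun ε => ε :=
      isBigO_pow_of_eq_mul (n := 1) (g := fun ε => U) (by fun_prop)
        (Eventually.of_forall fun ε => by ring) |>.congr_right (by simp)
    exact ((h1.trans e1).add e2).congr_left fun ε => by ring
  have h3 : Tendsto N (𝓝[>] 0) (𝓝 1) := by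
    have h4 : Tendsto (fun ε => N ε - 1) (𝓝[>] 0) (𝓝 0) :=
      h2.trans_tendsto (tendsto_id.mono_left nhdsWithin_le_nhds)
    simpa using h4.add_const 1
  have h4 : ∀ᶠ ε in 𝓝[>] (0 : ℝ), 1 / 2 < N ε := h3.eventually_const_lt (by norm_num)
  have h5 : (fun ε => Real.log (N ε) - (N ε - 1)) =O[𝓝[>] 0] fun ε => ε ^ 2 := by
    refine IsBigO.trans (IsBigO.of_bound 2 ?_) (h2.pow 2)
    filter_upwards [h4] with ε hε
    rw [Real.norm_eq_abs, Real.norm_of_nonneg (sq_nonneg _)]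
    exact abs_log_sub_le hε.le
  have hDN : ∀ᶠ ε in 𝓝[>] (0 : ℝ), 0 < ε ∧ 0 < N ε ∧ D ε = √ε * s * N ε := by
    filter_upwards [self_mem_nhdsWithin, h4] with ε (hε : 0 < ε) hN'
    have := Real.sqrt_pos.mpr hε
    exact ⟨hε, by linarith, by simp only [hN]; field_simp⟩
  refine ⟨?_, ?_⟩
  · filter_upwards [hDN] with ε ⟨hε, hN', e⟩
    have := Real.sqrt_pos.mpr hε
    rw [e]; positivity
  · refine (h5.add h1).congr' ?_ EventuallyEq.rfl
    filter_upwards [hDN] with ε ⟨hε, hN', e⟩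
    have := Real.sqrt_pos.mpr hε
    rw [e, Real.log_mul (by positivity) hN'.ne', Real.log_mul this.ne' hs.ne',
      Real.log_sqrt hε.le]
    ring

/-- Second-order expansion of the logarithm of an out-of-the-money option price. -/
theorem Admissible.log_price_expansion (hA : Admissible P Y Λ₀ Λ₁ Λ₂ ReΛ₀) {u k : ℝ}
    (hu : u ∈ limitInterior P Y) (hu0 : u ≠ 0) (hk : deriv Λ₀ u = k) {price : ℝ → ℝ}
    (hprice : ∀ᶠ ε in 𝓝[>] (0 : ℝ), (price ε : ℂ) =
      (Real.exp k * (ε / (2 * Real.pi)) : ℝ) * ∫ ξ : ℝ, priceIntegrand P (Y ε) u ε k ξ) :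
    (∀ᶠ ε in 𝓝[>] (0 : ℝ), 0 < price ε) ∧
    (fun ε => Real.log (price ε) - (-(u * k - Λ₀ u) / ε + 3 / 2 * Real.log ε +
      (k + Λ₁ u - Real.log (2 * Real.pi) - Real.log (u ^ 2)
        + Real.log √(2 * Real.pi / iteratedDeriv 2 Λ₀ u)) +
      (Λ₂ u + 1 / u + fourierCoeff Λ₀ Λ₁ u) * ε)) =O[𝓝[>] 0] fun ε => ε ^ 2 := by
  obtain ⟨-, -, ha⟩ := hA.regularity hu hu0
  have hau : 0 < |u| := abs_pos.mpr hu0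
  have hF := hA.fourier_expansion hu hu0
  rw [hk] at hF
  obtain ⟨hpos, hlog⟩ := log_isBigO_of_laplace (Real.sqrt_pos.mpr (by positivity)) hF
  set D : ℝ → ℝ := fun ε => fourierNormalizer P Y u k ε *
        (∫ ξ, priceIntegrand P (Y ε) u ε k ξ).re with hD
  have hsmall : ∀ᶠ ε in 𝓝[>] (0 : ℝ), ε ∈ Ioo 0 (|u| / 2) := Ioo_mem_nhdsGT (by positivity)
  have hy : ∀ᶠ ε in 𝓝[>] (0 : ℝ), 0 < ε ∧ 1 / 2 ≤ 1 - ε / u := by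
    filter_upwards [hsmall] with ε hε
    refine ⟨hε.1, ?_⟩
    have h1 : |ε / u| ≤ 1 / 2 := by
      rw [abs_div, abs_of_pos hε.1, div_le_iff₀ hau]; linarith [hε.2]
    linarith [(abs_le.mp h1).2]
  have hpr : ∀ᶠ ε in 𝓝[>] (0 : ℝ), price ε = Real.exp k * (ε / (2 * Real.pi)) *
      (D ε * ((u ^ 2 * (1 - ε / u))⁻¹ * Real.exp ((lmgf P Y ε u - u * k) / ε))) := by
    filter_upwards [hprice, hy] with ε h ⟨hε, hε2⟩
    have h1 := congrArg Complex.re h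
    rw [Complex.ofReal_re, Complex.re_ofReal_mul] at h1
    rw [h1]
    congr 1
    simp only [hD]
    rw [fourierNormalizer, Real.exp_neg]
    have h2 : u * (u - ε) = u ^ 2 * (1 - ε / u) := by field_simp
    have h3 : u ^ 2 * (1 - ε / u) ≠ 0 := mul_ne_zero (pow_ne_zero _ hu0) (by linarith)
    have h4 := Real.exp_ne_zero ((lmgf P Y ε u - u * k) / ε)
    rw [h2]
    generalize u ^ 2 * (1 - ε / u) = A at h3
    field_simp
  refine ⟨?_, ?_⟩
  · filter_upwards [hpr, hy, hpos] with ε h ⟨hε, hε2⟩ hp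
    rw [h]
    have : 0 < 1 - ε / u := by linarith
    positivity
  -- The factor `u (u - ε) = u² (1 - ε / u)` of the normaliser is the source of `-log u²` and of the
  -- term `1 / u` in the coefficient of `ε`.
  · have h1 : (fun ε : ℝ => Real.log (1 - ε / u) - (1 - ε / u - 1)) =O[𝓝[>] 0] fun ε => ε ^ 2 := by
      refine IsBigO.trans (IsBigO.of_bound 2 (g := fun ε : ℝ => (1 - ε / u - 1) ^ 2) ?_) ?_
      · filter_upwards [hy] with ε hε
        rw [Real.norm_eq_abs, Real.norm_of_nonneg (sq_nonneg _)]
        exact abs_log_sub_le hε.2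
      · exact isBigO_pow_of_eq_mul (g := fun _ => (u ^ 2)⁻¹) (by fun_prop)
          (Eventually.of_forall fun ε => by field_simp; ring)
    have h2 : (fun ε => (lmgf P Y ε u - (Λ₀ u + Λ₁ u * ε + Λ₂ u * ε ^ 2)) / ε)
        =O[𝓝[>] 0] fun ε => ε ^ 2 := by
      have h3 := (hA.expansion u hu).mul (isBigO_refl (fun ε : ℝ => ε⁻¹) (𝓝[>] 0))
      refine h3.congr' (Eventually.of_forall fun ε => by simp [div_eq_mul_inv]) ?_
      filter_upwards [self_mem_nhdsWithin] with ε (hε : 0 < ε)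
      field_simp
    refine ((hlog.sub h1).add h2).congr' ?_ EventuallyEq.rfl
    filter_upwards [hpr, hy, hpos] with ε h ⟨hε, hε2⟩ hp
    have h5 : 0 < 1 - ε / u := by linarith
    have hu2 : u ^ 2 ≠ 0 := pow_ne_zero _ hu0
    have hpi := Real.pi_pos
    change 0 < D ε at hp
    have e : Real.log (price ε) = k + (Real.log ε - Real.log (2 * Real.pi)) + (Real.log (D ε) +
        (-(Real.log (u ^ 2) + Real.log (1 - ε / u)) + (lmgf P Y ε u - u * k) / ε)) := by
      rw [h, Real.log_mul (by positivity) (by positivity), Real.log_mul (Real.exp_pos k).ne'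
        (by positivity), Real.log_exp, Real.log_div hε.ne' (by positivity),
        Real.log_mul hp.ne' (by positivity), Real.log_mul (by positivity) (Real.exp_pos _).ne',
        Real.log_exp, Real.log_inv, Real.log_mul hu2 h5.ne']
    change Real.log (D ε) - _ - _ + _ = _
    rw [e]
    generalize Real.log (D ε) = a₁
    generalize Real.log (1 - ε / u) = a₂
    generalize Real.log (u ^ 2) = a₃
    generalize Real.log (2 * Real.pi) = a₄
    generalize Real.log √(2 * Real.pi / iteratedDeriv 2 Λ₀ u) = a₅
    field_simp
    ring

end

/-! ### Assembling the smile expansion -/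

lemma SmileExpansion.congr {bs bs' : ℝ → ℝ → ℝ} {price price' : ℝ → ℝ} {w₀ w₁ w₂ : ℝ}
    (h : SmileExpansion bs price w₀ w₁ w₂)
    (heq : ∀ᶠ ε in 𝓝[>] (0 : ℝ), ∀ σ, price' ε = bs' ε σ ↔ price ε = bs ε σ) :
    SmileExpansion bs' price' w₀ w₁ w₂ := by
  refine ⟨?_, fun σ hσ => h.2 σ ?_⟩
  · filter_upwards [h.1, heq] with ε h1 h2
    simpa only [IsImpliedVol, h2] using h1
  · filter_upwards [hσ, heq] with ε h1 h2
    exact ⟨h1.1, (h2 _).mp h1.2⟩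

lemma callPrice_eq_putPrice_add {Ω : Type*} [MeasurableSpace Ω] {P : Measure Ω}
    [IsProbabilityMeasure P] {Z : Ω → ℝ} (h : ∫ x, Real.exp (Z x) ∂P = 1) (k : ℝ) :
    callPrice P Z k = putPrice P Z k + 1 - Real.exp k := by
  have hi : Integrable (fun x => Real.exp (Z x)) P := by
    -- The integral of a non-integrable function is `0` by convention, so the value `1` forces
    -- integrability.
    by_contra hn
    rw [integral_undef hn] at h
    exact zero_ne_one h
  have h1 : Integrable (fun x => max (Real.exp (Z x) - Real.exp k) 0) P :=
    (hi.sub (integrable_const _)).pos_part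
  have h2 : Integrable (fun x => max (Real.exp k - Real.exp (Z x)) 0) P :=
    ((integrable_const _).sub hi).pos_part
  have h3 : callPrice P Z k - putPrice P Z k = ∫ x, (Real.exp (Z x) - Real.exp k) ∂P := by
    rw [callPrice, putPrice, ← integral_sub h1 h2]
    refine integral_congr_ae (Eventually.of_forall fun x => ?_)
    simp only
    have := max_zero_sub_eq_self (Real.exp (Z x) - Real.exp k)
    rwa [neg_sub, max_comm, max_comm 0] at this
  rw [integral_sub hi (integrable_const _), h] at h3
  simp at h3
  linarith

lemma measurable_diag {Ω : Type*} [MeasurableSpace Ω] {X : ℝ≥0 → Ω → ℝ}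
    (hX : ∀ s, Measurable (X s)) (t τ : ℝ≥0) (ε : ℝ) : Measurable (diag X t τ ε) :=
  (hX _).sub (hX _)

lemma upsilon_zero {Λ₀ Λ₁ : ℝ → ℝ} (Λ₂ : ℝ → ℝ) {u : ℝ} (hu : u ≠ 0)
    (ha : 0 < iteratedDeriv 2 Λ₀ u) :
    Λ₂ u + 1 / u + fourierCoeff Λ₀ Λ₁ u = upsilon Λ₀ Λ₁ Λ₂ 0 u + 1 / u := by
  simp only [upsilon, fourierCoeff, iteratedDeriv_one]
  generalize iteratedDeriv 2 Λ₀ u = a at ha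
  field_simp
  ring

section

variable {Ω : Type*} [MeasurableSpace Ω] {P : Measure Ω} [IsProbabilityMeasure P]
  {Y : ℝ → Ω → ℝ} {Λ₀ Λ₁ Λ₂ : ℝ → ℝ} {ReΛ₀ : ℂ → ℝ}

/-- The tangent at `0` is the zero function, so `Λ₀ u > 0`; the tangent at `u`, evaluated at `0`,
gives `Λ₀ u < u k`. In particular `u` and `k` have the same sign. -/
lemma Admissible.saddle_pos (hA : Admissible P Y Λ₀ Λ₁ Λ₂ ReΛ₀) (h0 : deriv Λ₀ 0 = 0) {k u : ℝ}
    (hk : k ≠ 0) (hu : IsSaddle (limitInterior P Y) Λ₀ k u) :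
    u ≠ 0 ∧ 0 < Λ₀ u ∧ Λ₀ u < u * k := by
  have hu0 : u ≠ 0 := by
    rintro rfl
    exact hk (hu.2.symm.trans h0)
  have h1 := tangent_lt isOpen_limitInterior hA.strictConvex hA.differentiable hu.1 hA.zero_mem
    hu0.symm
  have h2 := tangent_lt isOpen_limitInterior hA.strictConvex hA.differentiable hA.zero_mem hu.1 hu0
  rw [h0, hA.apply_zero] at h2
  rw [hu.2, hA.apply_zero] at h1
  exact ⟨hu0, by linarith, by linarith⟩

/-- The smile expansion for prices with the Fourier representation of out-of-the-money options. -/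
theorem Admissible.smileExpansion (hA : Admissible P Y Λ₀ Λ₁ Λ₂ ReΛ₀) (h0 : deriv Λ₀ 0 = 0)
    {k τ : ℝ} (hk : k ≠ 0) (hτ : 0 < τ)
    (hs : IsSaddle (limitInterior P Y) Λ₀ k (saddle (limitInterior P Y) Λ₀ k)) {price : ℝ → ℝ}
    (hprice : ∀ᶠ ε in 𝓝[>] (0 : ℝ), (price ε : ℂ) = (Real.exp k * (ε / (2 * Real.pi)) : ℝ) *
      ∫ ξ : ℝ, priceIntegrand P (Y ε) (saddle (limitInterior P Y) Λ₀ k) ε k ξ) :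
    SmileExpansion (fun ε σ => bsOtm k (σ * √(ε * τ))) price (v0 (limitInterior P Y) Λ₀ τ k)
      (v1 (limitInterior P Y) Λ₀ Λ₁ τ k) (v2 (limitInterior P Y) Λ₀ Λ₁ Λ₂ τ k) := by
  have hrate := rate_eq isOpen_limitInterior hA.strictConvex hA.differentiable hs
  rw [v2, v1]
  set u := saddle (limitInterior P Y) Λ₀ k with hu
  set w₀ := v0 (limitInterior P Y) Λ₀ τ k with hw₀
  obtain ⟨hu0, hpos, hlt⟩ := hA.saddle_pos h0 hk hs
  obtain ⟨hp, hlog⟩ := hA.log_price_expansion hs.1 hu0 hs.2 hprice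
  obtain ⟨-, -, ha⟩ := hA.regularity hs.1 hu0
  rw [upsilon_zero Λ₂ hu0 ha] at hlog
  have hI : 0 < u * k - Λ₀ u := by linarith
  have hw₀e : w₀ = k ^ 2 / (2 * τ * (u * k - Λ₀ u)) := by rw [hw₀, v0, hrate]
  have hw₀0 : 0 < w₀ := by rw [hw₀e]; positivity
  have hpi := Real.pi_pos
  refine smileExpansion_bsOtm hk hτ hw₀0 (I := u * k - Λ₀ u) ?_ ?_ ?_ hp hlog
  · rw [hw₀e]; field_simp
  · have hsa := Real.sqrt_pos.mpr ha
    have hu2 : 0 < u ^ 2 := by positivity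
    have hk2 : 0 < k ^ 2 := by positivity
    rw [Real.log_div (by positivity) (by positivity), Real.log_mul hk2.ne' (Real.exp_pos _).ne',
      Real.log_exp, Real.log_mul (by positivity) (by positivity), Real.log_mul hu2.ne' hsa.ne',
      Real.log_rpow (by positivity), Real.log_mul hk2.ne' (by positivity), Real.log_sqrt ha.le,
      Real.log_sqrt (by positivity), Real.log_sqrt (by positivity),
      Real.log_div (by positivity) ha.ne']
    field_simp
    ring
  · field_simp
    ring

end

end FwdSmile

theorem proposition2p12 {Ω : Type*} [MeasurableSpace Ω] (P : Measure Ω) [IsProbabilityMeasure P]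
    (X : ℝ≥0 → Ω → ℝ) (hX : ∀ s, Measurable (X s))
    (t τ : ℝ≥0) (hτ : 0 < τ)
    (Λ₀ Λ₁ Λ₂ : ℝ → ℝ) (ReΛ₀ : ℂ → ℝ)
    (hA : FwdSmile.Admissible P (FwdSmile.diag X t τ) Λ₀ Λ₁ Λ₂ ReΛ₀)
    (h0 : deriv Λ₀ 0 = 0)
    (D : Set ℝ) (hD : D = FwdSmile.limitInterior P (FwdSmile.diag X t τ))
    (k : ℝ) (hk : k ≠ 0) (hkdom : k ∈ interior (FwdSmile.rateDomain D Λ₀)) :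
    -- the ingredients of the coefficients are well defined
    (∃! u, FwdSmile.IsSaddle D Λ₀ k u) ∧
    FwdSmile.saddle D Λ₀ k ≠ 0 ∧
    0 < FwdSmile.rate D Λ₀ k ∧
    ContDiffAt ℝ 4 Λ₀ (FwdSmile.saddle D Λ₀ k) ∧
    ContDiffAt ℝ 2 Λ₁ (FwdSmile.saddle D Λ₀ k) ∧
    0 < iteratedDeriv 2 Λ₀ (FwdSmile.saddle D Λ₀ k) ∧
    -- smile of call prices; for negative log-strikes this uses that the forward is fairly priced
    ((0 < k ∨ ∀ᶠ ε in 𝓝[>] (0 : ℝ), ∫ x, Real.exp (FwdSmile.diag X t τ ε x) ∂P = 1) →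
      FwdSmile.SmileExpansion (fun ε σ => FwdSmile.bsCall (ε * τ) k σ)
        (fun ε => FwdSmile.callPrice P (FwdSmile.diag X t τ ε) k)
        (FwdSmile.v0 D Λ₀ τ k) (FwdSmile.v1 D Λ₀ Λ₁ τ k) (FwdSmile.v2 D Λ₀ Λ₁ Λ₂ τ k)) ∧
    -- smile of put prices at negative log-strikes, without that condition
    (k < 0 →
      FwdSmile.SmileExpansion (fun ε σ => FwdSmile.bsPut (ε * τ) k σ)
        (fun ε => FwdSmile.putPrice P (FwdSmile.diag X t τ ε) k)
        (FwdSmile.v0 D Λ₀ τ k) (FwdSmile.v1 D Λ₀ Λ₁ τ k) (FwdSmile.v2 D Λ₀ Λ₁ Λ₂ τ k)) := by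
  subst hD
  have hex := FwdSmile.existsUnique_isSaddle FwdSmile.isOpen_limitInterior ⟨0, hA.zero_mem⟩
    hA.strictConvex hA.differentiable hA.steep hkdom
  have hs := Classical.epsilon_spec hex.exists
  change FwdSmile.IsSaddle _ Λ₀ k (FwdSmile.saddle _ Λ₀ k) at hs
  obtain ⟨hu0, hpos, hlt⟩ := hA.saddle_pos h0 hk hs
  obtain ⟨hC4, hC2, ha⟩ := hA.regularity hs.1 hu0
  have hrate := FwdSmile.rate_eq FwdSmile.isOpen_limitInterior hA.strictConvex hA.differentiable hs
  have hput : k < 0 →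
      FwdSmile.SmileExpansion (fun ε σ => FwdSmile.bsPut (ε * τ) k σ)
        (fun ε => FwdSmile.putPrice P (FwdSmile.diag X t τ ε) k)
        (FwdSmile.v0 (FwdSmile.limitInterior P (FwdSmile.diag X t τ)) Λ₀ τ k)
        (FwdSmile.v1 (FwdSmile.limitInterior P (FwdSmile.diag X t τ)) Λ₀ Λ₁ τ k)
        (FwdSmile.v2 (FwdSmile.limitInterior P (FwdSmile.diag X t τ)) Λ₀ Λ₁ Λ₂ τ k) := by
    intro hk0
    refine (hA.smileExpansion h0 hk (NNReal.coe_pos.mpr hτ) hs ?_).congr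
      (Eventually.of_forall fun ε σ => by rw [FwdSmile.bsPut_eq_bsOtm hk0])
    have hneg : FwdSmile.saddle (FwdSmile.limitInterior P (FwdSmile.diag X t τ)) Λ₀ k < 0 := by
      by_contra hn
      have := mul_nonpos_of_nonneg_of_nonpos (not_lt.mp hn) hk0.le
      linarith
    filter_upwards [hA.eventually_limitInterior_subset, self_mem_nhdsWithin] with ε h (hε : 0 < ε)
    exact FwdSmile.putPrice_eq (FwdSmile.measurable_diag hX t τ ε) hε hneg (h hs.1)
  refine ⟨hex, hu0, by rw [hrate]; linarith, hC4, hC2, ha, fun hor => ?_, hput⟩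
  rcases lt_or_gt_of_ne hk with hk0 | hk0
  · have hone := hor.resolve_left hk0.not_gt
    -- For a fair forward, put-call parity shifts the observed and the Black-Scholes price by the
    -- same constant `1 - e^k`, so call and put have the same implied volatilities.
    refine (hput hk0).congr ?_
    filter_upwards [hone] with ε hε σ
    rw [FwdSmile.callPrice_eq_putPrice_add hε, FwdSmile.bsPut_eq]
    constructor <;> intro h <;> linarith
  · refine (hA.smileExpansion h0 hk (NNReal.coe_pos.mpr hτ) hs ?_).congr
      (Eventually.of_forall fun ε σ => by rw [FwdSmile.bsCall_eq_bsOtm hk0])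
    have hupos : 0 < FwdSmile.saddle (FwdSmile.limitInterior P (FwdSmile.diag X t τ)) Λ₀ k := by
      by_contra hn
      have := mul_nonpos_of_nonpos_of_nonneg (not_lt.mp hn) hk0.le
      linarith
    filter_upwards [hA.eventually_limitInterior_subset, Ioo_mem_nhdsGT hupos] with ε h hε
    exact FwdSmile.callPrice_eq (FwdSmile.measurable_diag hX t τ ε) hε.1 hε.2 (h hs.1)
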